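/- Let $n\ge 0$, $N=2n+1$, and $q=\mathrm e^{2\pi\mathrm i/3}$ or $q=\mathrm e^{-2\pi\mathrm i/3}$. **The transfer matrix.** Put $$a(x)=\frac{qx-q^{-1}}{q-q^{-1}x},\quad b(x)=\frac{x-1}{q-q^{-1}x},\quad c(x)=\frac{(q-q^{-1})x}{q-q^{-1}x},\quad c'(x)=\frac{q-q^{-1}}{q-q^{-1}x}.$$ Let $e_\uparrow,e_\downarrow$ be the standard basis of $\mathbb C^2$, and let $R(x)$ be the operator on $\mathbb C^2\otimes\mathbb C^2$ with $R(x)\,e_\beta\otimes e_\nu=\sum_{\alpha,\mu}R^{\alpha\mu}{}_{\beta\nu}(x)\,e_\alpha\otimes e_\mu$, whose only nonzero entries are $$R^{\uparrow\uparrow}{}_{\uparrow\uparrow}=R^{\downarrow\downarrow}{}_{\downarrow\downarrow}=a,\quad R^{\uparrow\downarrow}{}_{\uparrow\downarrow}=R^{\downarrow\uparrow}{}_{\downarrow\uparrow}=b,\quad R^{\downarrow\uparrow}{}_{\uparrow\downarrow}=c,\quad R^{\uparrow\downarrow}{}_{\downarrow\uparrow}=c'.$$ The inhomogeneous six-vertex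 transfer matrix on $V_1\otimes\cdots\otimes V_N=(\mathbb C^2)^{\otimes N}$ is $$T(x|z_1,\dots,z_N)=\mathrm{tr}_0\,[R_{0,1}(x/z_1)\cdots R_{0,N}(x/z_N)],$$ where $R_{0,i}$ acts as $R$ in $V_0\otimes V_i$, with $V_0=\mathbb C^2$, and $\mathrm{tr}_0$ is the partial trace over $V_0$. **The vector $\Psi$.** For $1\le a_1<\dots<a_n\le N$ consider the integral $$\Psi_{a_1,\dots,a_n}(z_1,\dots,z_N)=\prod_{1\le i<j\le N}(qz_i-q^{-1}z_j)\oint\!\cdots\!\oint\prod_{\ell=1}^n\frac{\mathrm dw_\ell}{2\pi\mathrm i}\ (q-q^{-1})^n\prod_{\ell=1}^n z_{a_\ell}\,\frac{\prod_{\ell=1}^n w_\ell\prod_{1\le\ell<m\le n}(w_m-w_\ell)(qw_\ell-q^{-1}w_m)}{\prod_{\ell=1}^n\bigl[\prod_{1\le i\le a_\ell}(w_\ell-z_i)\prod_{a_\ell\le i\le N}(qw_\ell-q^{-1}z_i)\bigr]},$$ where the contours surround all the points $z_i$ and none of the points $q^{-2}z_i$; they exist when $z_i\ne q^{-2}z_j$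 for all $i,j$ (in particular all $z_i\neq0$). For definiteness, each contour is the union of the positively oriented circles of a common radius $r>0$ about the distinct points among $z_1,\dots,z_N$, where $r$ is any radius such that the closed discs are pairwise disjoint and contain no $q^{-2}z_j$. **Proposition.** 1. There is exactly one family of polynomials $\Psi_{a_1,\dots,a_n}\in\mathbb C[z_1,\dots,z_N]$ given by this formula for all such $z$ and $r$. Put $$\Psi(z_1,\dots,z_N)=\sum_{a_1<\dots<a_n}\Psi_{a_1,\dots,a_n}(z_1,\dots,z_N)\,e_{a_1,\dots,a_n},$$ where $e_{a_1,\dots,a_n}$ is the basis vector of $(\mathbb C^2)^{\otimes N}$ with down arrows exactly at the positions $a_1,\dots,a_n$. 2. For all nonzero $z_1,\dots,z_N$ and all $x\in\mathbb C$ with $q-q^{-1}x/z_i\ne0$ for every $i$ (that is, wherever $T$ is defined), $$T(x|z_1,\dots,z_N)\,\Psi(z_1,\dots,z_N)=\Psi(z_1,\dots,z_N).$$ If moreover $z_i\ne q^{-2}z_j$ for all $i,j$, then $\Psi(z_1,\dots,z_N)\ne0$, so that it is an eigenvector of $T(x|z_1,\dots,z_N)$ with eigenvalue $1$. 3. The homogeneous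 limit $\Psi(1,\dots,1)$ is nonzero and is an eigenvector, with eigenvalue $-3N/4$, of $$H_{\mathrm{XXZ}}(-\tfrac12)=-\tfrac12\sum_{i=1}^N\Bigl[\sigma^x_i\sigma^x_{i+1}+\sigma^y_i\sigma^y_{i+1}-\tfrac12\,\sigma^z_i\sigma^z_{i+1}\Bigr],\qquad \sigma_{N+1}=\sigma_1.$$ -/

import Mathlib

/-! ## The six-vertex model

Basis vectors of `ℂ² = span(e_↑, e_↓)` are indexed by `Fin 2`, with `0 = ↑` and `1 = ↓`.  For a
finite ordered set of sites `Fin m`, the standard basis of `(ℂ²)^{⊗ m}` is indexed by the spin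
configurations `Fin m → Fin 2`, vectors are functions `(Fin m → Fin 2) → ℂ`, and operators are
matrices in this basis. -/

/-- The Boltzmann weight `a(x)`. -/
noncomputable def weightA (q x : ℂ) : ℂ := (q * x - q⁻¹) / (q - q⁻¹ * x)

/-- The Boltzmann weight `b(x)`. -/
noncomputable def weightB (q x : ℂ) : ℂ := (x - 1) / (q - q⁻¹ * x)

/-- The Boltzmann weight `c(x)`. -/
noncomputable def weightC (q x : ℂ) : ℂ := ((q - q⁻¹) * x) / (q - q⁻¹ * x)

/-- The Boltzmann weight `c'(x)`. -/
noncomputable def weightC' (q x : ℂ) : ℂ := (q - q⁻¹) / (q - q⁻¹ * x)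

/-- The `R`-matrix `R^{αμ}_{βν}(x)`, with row `(α, μ)` and column `(β, ν)`, where `α`, `μ`, `β`, `ν`
are the states of the left, top, right and bottom edge of a vertex.  A vertical edge has state
`↑` or `↓` according to its arrow; a horizontal edge has state `↑` if its arrow points to the left
and `↓` if it points to the right.  The weight `c(x)` belongs to the vertex whose horizontal arrows
both point towards it, that is `(α, μ; β, ν) = (↓, ↑; ↑, ↓)`, and `c'(x)` to the vertex
whose horizontal arrows both point away from it. -/
noncomputable def sixVertexR (q x : ℂ) : Matrix (Fin 2 × Fin 2) (Fin 2 × Fin 2) ℂ :=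
  fun s t =>
    if s = t then (if s.1 = s.2 then weightA q x else weightB q x)
    else if s = (1, 0) ∧ t = (0, 1) then weightC q x
    else if s = (0, 1) ∧ t = (1, 0) then weightC' q x
    else 0

/-- The operator on `(ℂ²)^{⊗ m}` acting as the operator `R` of `ℂ² ⊗ ℂ²` in the factors
`j` and `k` (`j ≠ k`) and identically in all the others. -/
noncomputable def twoSiteOp {m : ℕ} (j k : Fin m) (R : Matrix (Fin 2 × Fin 2) (Fin 2 × Fin 2) ℂ) :
    Matrix (Fin m → Fin 2) (Fin m → Fin 2) ℂ :=
  fun μ ν => if ∀ l, l ≠ j → l ≠ k → μ l = ν l then R (μ j, μ k) (ν j, ν k) else 0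

/-- The partial trace over the factor `V_0` of `V_0 ⊗ V_1 ⊗ ⋯ ⊗ V_N`. -/
noncomputable def partialTrace {N : ℕ}
    (M : Matrix (Fin (N + 1) → Fin 2) (Fin (N + 1) → Fin 2) ℂ) :
    Matrix (Fin N → Fin 2) (Fin N → Fin 2) ℂ :=
  fun μ ν => ∑ α : Fin 2, M (Fin.cons α μ) (Fin.cons α ν)

/-- The inhomogeneous transfer matrix
`T(x | z_1, …, z_N) = tr_0 [R_{0,1}(x/z_1) ⋯ R_{0,N}(x/z_N)]`. -/
noncomputable def transferMatrix {N : ℕ} (q x : ℂ) (z : Fin N → ℂ) :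
    Matrix (Fin N → Fin 2) (Fin N → Fin 2) ℂ :=
  partialTrace
    (List.ofFn fun i : Fin N => twoSiteOp (0 : Fin (N + 1)) i.succ (sixVertexR q (x / z i))).prod

/-! ## The XXZ spin chain -/

/-- The operator on `(ℂ²)^{⊗ m}` acting as `A` in the factor `i` and identically in the others. -/
noncomputable def siteOp {m : ℕ} (A : Matrix (Fin 2) (Fin 2) ℂ) (i : Fin m) :
    Matrix (Fin m → Fin 2) (Fin m → Fin 2) ℂ :=
  fun μ ν => if ∀ l, l ≠ i → μ l = ν l then A (μ i) (ν i) else 0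

noncomputable def pauliX : Matrix (Fin 2) (Fin 2) ℂ := !![0, 1; 1, 0]

noncomputable def pauliY : Matrix (Fin 2) (Fin 2) ℂ := !![0, -Complex.I; Complex.I, 0]

noncomputable def pauliZ : Matrix (Fin 2) (Fin 2) ℂ := !![1, 0; 0, -1]

/-- The Hamiltonian `H_XXZ(Δ)` of the periodic chain; `i + 1` is addition modulo `N`. -/
noncomputable def hamiltonianXXZ (N : ℕ) [NeZero N] (Δ : ℂ) :
    Matrix (Fin N → Fin 2) (Fin N → Fin 2) ℂ :=
  -(1 / 2 : ℂ) • ∑ i : Fin N,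
    (siteOp pauliX i * siteOp pauliX (i + 1) + siteOp pauliY i * siteOp pauliY (i + 1)
      + Δ • (siteOp pauliZ i * siteOp pauliZ (i + 1)))

/-! ## The integral formula

The positions `1 ≤ a_1 < ⋯ < a_n ≤ N = 2n+1` of the down arrows are given by an order embedding
`a : Fin n ↪o Fin (2 * n + 1)`; sites are numbered from `0`. -/

/-- The integrand `Φ_{a_1,…,a_n}(w_1, …, w_n | z_1, …, z_N)`. -/
noncomputable def integrandPhi {n : ℕ} (q : ℂ) (z : Fin (2 * n + 1) → ℂ)
    (a : Fin n ↪o Fin (2 * n + 1)) (w : Fin n → ℂ) : ℂ :=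
  (q - q⁻¹) ^ n * (∏ l, z (a l)) *
    ((∏ l, w l) * ∏ l, ∏ m ∈ Finset.Ioi l, ((w m - w l) * (q * w l - q⁻¹ * w m))) /
    ∏ l, ((∏ i ∈ Finset.Iic (a l), (w l - z i)) *
      ∏ i ∈ Finset.Ici (a l), (q * w l - q⁻¹ * z i))

/-- `r` is an admissible radius: the closed discs of radius `r` about the distinct points among
`z_1, …, z_N` are pairwise disjoint and contain none of the points `q⁻² z_j`. -/
def IsContourRadius {N : ℕ} (q : ℂ) (z : Fin N → ℂ) (r : ℝ) : Prop :=
  0 < r ∧ (∀ i j, z i ≠ z j → 2 * r < dist (z i) (z j)) ∧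
    ∀ i j, r < dist (z i) ((q ^ 2)⁻¹ * z j)

/-- The right-hand side of the integral formula for `Ψ_{a_1,…,a_n}(z_1, …, z_N)`.  Each variable
`w_ℓ` runs over the union of the positively oriented circles of radius `r` about the distinct points
among `z_1, …, z_N`, so that the multiple integral is a sum of integrals over products of circles,
one for each choice of the `n` centres. -/
noncomputable def psiIntegral {n : ℕ} (q : ℂ) (z : Fin (2 * n + 1) → ℂ) (r : ℝ)
    (a : Fin n ↪o Fin (2 * n + 1)) : ℂ :=
  (∏ i, ∏ j ∈ Finset.Ioi i, (q * z i - q⁻¹ * z j)) *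
    ((1 / (2 * (Real.pi : ℂ) * Complex.I)) ^ n *
      ∑ s ∈ Fintype.piFinset (fun _ : Fin n => Finset.univ.image z),
        torusIntegral (integrandPhi q z a) s (fun _ => r))

/-- A family of polynomials `Ψ_{a_1,…,a_n}` in `z_1, …, z_N`, `N = 2n+1`. -/
abbrev PolynomialComponents (n : ℕ) : Type :=
  (Fin n ↪o Fin (2 * n + 1)) → MvPolynomial (Fin (2 * n + 1)) ℂ

/-- The polynomials `Ψ_{a_1,…,a_n}` are given by the integral formula, wherever there are contours
surrounding all the points `z_i` and none of the points `q⁻² z_j`. -/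
def IsGivenByIntegral {n : ℕ} (q : ℂ) (Ψ : PolynomialComponents n) : Prop :=
  ∀ (z : Fin (2 * n + 1) → ℂ) (r : ℝ), IsContourRadius q z r →
    ∀ a, MvPolynomial.eval z (Ψ a) = psiIntegral q z r a

/-- The spin configuration with down arrows exactly at the positions `a_1, …, a_n`. -/
noncomputable def downConfig {n N : ℕ} (a : Fin n ↪o Fin N) : Fin N → Fin 2 :=
  open Classical in fun k => if k ∈ Set.range a then 1 else 0

/-- The vector `Ψ(z_1, …, z_N) = ∑ Ψ_{a_1,…,a_n}(z_1, …, z_N) e_{a_1,…,a_n}`. -/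
noncomputable def psiVector {n : ℕ} (Ψ : PolynomialComponents n) (z : Fin (2 * n + 1) → ℂ) :
    (Fin (2 * n + 1) → Fin 2) → ℂ :=
  ∑ a : Fin n ↪o Fin (2 * n + 1), MvPolynomial.eval z (Ψ a) • Pi.single (downConfig a) (1 : ℂ)

/-! Write [u,v] = q u - q⁻¹ v. When the z_i are distinct and no [z_i,z_j] vanishes, the integral is
a finite sum of residues at the z_i. Over a denominator common to all positions of an arrow, this
sum can be read site by site (`residueSum`), so a component becomes a function of a list of pairs
(spin, inhomogeneity), `chainComponent`. Two properties of this function carry the proof.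

Exchange (`chainComponent_exchange`): interchanging the inhomogeneities of two neighbouring sites
acts by the R-matrix. This comes down to a rational identity in one residue variable, or an
antisymmetry in two, and holds for every nonzero q.

Cyclicity (`chainComponent_rotate`): moving the first site, with its spin and its z, to the end
changes nothing. The exchange relation reduces this to chains whose other down arrows all stand on
the left. The three components involved are computed in closed form by Lagrange interpolation
(`residueComponent_sorted`, `residueComponent_sorted_concat_down`,
`residueComponent_up_cons_sorted`), and they match because q³ = 1.

Since R(1) is the flip, T(z_i) carries site i once around the chain by exchanges and cyclicity
closes the loop, so T(z_i)Ψ = Ψ. At x = 0 the transfer matrix is the scalar -(q⁻¹ + q⁻²) = 1 on the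
sector of Ψ. After multiplication by ∏ [z_i,x], T(x)Ψ - Ψ is a polynomial in x of degree at most N
with N+1 zeros, so it vanishes (`transferApply_chainComponent`).

Solved for the component in which a down arrow has moved one step to the right, the exchange
relation is a divided difference. Starting from the explicit product for all down arrows on the
left, every component is therefore a polynomial. Generic points are dense, and with contours held
fixed the integral is continuous in the z_i; this gives existence and uniqueness of the family and
extends all identities to the remaining points. The component with all down arrows on the left is a
product of factors z_i and [z_i,z_j], which gives Ψ ≠ 0.

For the Hamiltonian, the exchange relation is differentiated at z = (1,…,1). Each bond operator then
acts as 3/2 plus differences between its two sites (`bond_identity`), and these telescope around the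
ring, leaving 3N/2 (`sum_bondOp_mulVec`). -/

/-! ### Residue sums along a chain -/

/-- The bilinear bracket `q u - q⁻¹ v`. -/
noncomputable def bracket (q u v : ℂ) : ℂ := q * u - q⁻¹ * v

/-- The two-variable factor `(v - u) (q u - q⁻¹ v)` of the integrand. -/
noncomputable def pairWeight (q u v : ℂ) : ℂ := (v - u) * bracket q u v

/-- The residue at `w ∈ S` of `(q - q⁻¹) w / ∏ s ∈ S, (w - s) (q w - q⁻¹ s)`. -/
noncomputable def nodeWeight (q : ℂ) (S : Finset ℂ) (w : ℂ) : ℂ :=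
  (q - q⁻¹) * w / ((∏ s ∈ S.erase w, (w - s)) * ∏ s ∈ S, bracket q w s)

/-- The iterated sum of residues over the nodes `S`, reading the sites of the chain from left to
right; `C` is the weight which the sites already read attach to the remaining variables. -/
noncomputable def residueSum (q : ℂ) (S : Finset ℂ) : (ℂ → ℂ) → List (Fin 2 × ℂ) → ℂ
  | _, [] => 1
  | C, (s, z) :: L =>
    if s = 0 then residueSum q S (fun v => C v * bracket q v z) L
    else ∑ w ∈ S, nodeWeight q S w * C w * z * (L.map fun p => w - p.2).prod *
      residueSum q S (fun v => C v * bracket q v z * pairWeight q w v) L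

/-- The product of `q z_i - q⁻¹ z_j` over the pairs `i < j` of a list. -/
noncomputable def bracketProd (q : ℂ) : List ℂ → ℂ
  | [] => 1
  | z :: zs => (zs.map (bracket q z)).prod * bracketProd q zs

/-- The component of the solution as a sum of residues. -/
noncomputable def residueComponent (q : ℂ) (L : List (Fin 2 × ℂ)) : ℂ :=
  bracketProd q (L.map Prod.snd) * residueSum q (L.map Prod.snd).toFinset (fun _ => 1) L

/-- The component of the solution, extended by zero outside the sector with one more up than down
arrows. -/
noncomputable def chainComponent (q : ℂ) (L : List (Fin 2 × ℂ)) : ℂ :=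
  if 2 * (L.map Prod.fst).count 1 + 1 = L.length then residueComponent q L else 0

/-- The points of the list are distinct and `q u ≠ q⁻¹ v` for any two of them. -/
def IsGeneric (q : ℂ) (zs : List ℂ) : Prop :=
  zs.Nodup ∧ ∀ u ∈ zs, ∀ v ∈ zs, bracket q u v ≠ 0

theorem IsGeneric.perm {q : ℂ} {l₁ l₂ : List ℂ} (h : IsGeneric q l₁) (p : l₁.Perm l₂) :
    IsGeneric q l₂ :=
  ⟨p.nodup_iff.1 h.1, fun u hu v hv => h.2 u (p.mem_iff.2 hu) v (p.mem_iff.2 hv)⟩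

/-! ### Exchange relations for neighbouring sites -/

/-- Makes a relation at the head of a chain valid in its interior. A prefix sees what follows only
through the multiset of its inhomogeneities, and it acts on it by changing the weight `C`, which is
why the relation is required for every `C`. -/
theorem residueSum_append (q : ℂ) (S : Finset ℂ) (l₁ l₂ l₃ : ℂ) {X₁ X₂ X₃ : List (Fin 2 × ℂ)}
    (h12 : (X₁.map Prod.snd).Perm (X₂.map Prod.snd)) (h13 : (X₁.map Prod.snd).Perm (X₃.map Prod.snd))
    (h : ∀ C, l₁ * residueSum q S C X₁ + l₂ * residueSum q S C X₂ = l₃ * residueSum q S C X₃)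
    (A : List (Fin 2 × ℂ)) (C : ℂ → ℂ) :
    l₁ * residueSum q S C (A ++ X₁) + l₂ * residueSum q S C (A ++ X₂) =
      l₃ * residueSum q S C (A ++ X₃) := by
  induction A generalizing C with
  | nil => exact h C
  | cons p A ih =>
    obtain ⟨s, z⟩ := p
    have key : ∀ w : ℂ, ∀ {X Y : List (Fin 2 × ℂ)}, (X.map Prod.snd).Perm (Y.map Prod.snd) →
        ((A ++ X).map fun p => w - p.2).prod = ((A ++ Y).map fun p => w - p.2).prod := by
      intro w X Y hp
      have := (hp.map (fun z => w - z)).prod_eq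
      rw [List.map_map, List.map_map] at this
      rw [List.map_append, List.map_append, List.prod_append, List.prod_append]
      exact congrArg _ this
    by_cases hs : s = 0
    · simp only [List.cons_append, residueSum, hs, if_true]
      exact ih _
    · simp only [List.cons_append, residueSum, hs, if_false]
      rw [Finset.mul_sum, Finset.mul_sum, Finset.mul_sum, ← Finset.sum_add_distrib]
      refine Finset.sum_congr rfl fun w _ => ?_
      rw [← key w h12, ← key w h13]
      linear_combination (nodeWeight q S w * C w * z * ((A ++ X₁).map fun p => w - p.2).prod) *
        ih (fun v => C v * bracket q v z * pairWeight q w v)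

theorem residueSum_swap_up (q : ℂ) (S : Finset ℂ) (z y : ℂ) (L : List (Fin 2 × ℂ)) (C : ℂ → ℂ) :
    residueSum q S C ((0, z) :: (0, y) :: L) = residueSum q S C ((0, y) :: (0, z) :: L) := by
  simp only [residueSum, if_true]
  congr 1
  funext v
  ring

/-- The two sites hold a single residue variable w, and all later variables see the same weight in
the three terms. Only the identity (y-z)(w-y) + (q-q⁻¹)y[w,z] = [y,z][w,y] remains, summand by
summand. -/
theorem residueSum_up_down (q : ℂ) (hq : q ≠ 0) (S : Finset ℂ) (z y : ℂ) (L : List (Fin 2 × ℂ))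
    (C : ℂ → ℂ) :
    (y - z) * residueSum q S C ((1, z) :: (0, y) :: L) +
      (q - q⁻¹) * z * residueSum q S C ((0, z) :: (1, y) :: L) =
      bracket q y z * residueSum q S C ((0, y) :: (1, z) :: L) := by
  simp only [residueSum, if_true, one_ne_zero, if_false, List.map_cons, List.prod_cons]
  rw [Finset.mul_sum, Finset.mul_sum, Finset.mul_sum, ← Finset.sum_add_distrib]
  refine Finset.sum_congr rfl fun w _ => ?_
  have e1 : (fun v => C v * bracket q v z * pairWeight q w v * bracket q v y) =
    (fun v => C v * bracket q v z * bracket q v y * pairWeight q w v) := by funext v; ring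
  have e2 : (fun v => C v * bracket q v y * bracket q v z * pairWeight q w v) =
    (fun v => C v * bracket q v z * bracket q v y * pairWeight q w v) := by funext v; ring
  rw [e1, e2]
  have hq' : q * q⁻¹ = 1 := mul_inv_cancel₀ hq
  have : (y - z) * (w - y) + (q - q⁻¹) * y * bracket q w z = bracket q y z * bracket q w y := by
    unfold bracket
    linear_combination (-y * z + w * z - w * y + y * y) * hq'
  linear_combination nodeWeight q S w * C w * z * (L.map fun p => w - p.2).prod *
    residueSum q S (fun v => C v * bracket q v z * bracket q v y * pairWeight q w v) L * this

theorem residueSum_down_up (q : ℂ) (S : Finset ℂ) (z y : ℂ) (L : List (Fin 2 × ℂ))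
    (C : ℂ → ℂ) :
    (y - z) * residueSum q S C ((0, z) :: (1, y) :: L) +
      (q - q⁻¹) * y * residueSum q S C ((1, z) :: (0, y) :: L) =
      bracket q y z * residueSum q S C ((1, y) :: (0, z) :: L) := by
  simp only [residueSum, if_true, one_ne_zero, if_false, List.map_cons, List.prod_cons]
  rw [Finset.mul_sum, Finset.mul_sum, Finset.mul_sum, ← Finset.sum_add_distrib]
  refine Finset.sum_congr rfl fun w _ => ?_
  have e1 : (fun v => C v * bracket q v z * pairWeight q w v * bracket q v y) =
    (fun v => C v * bracket q v z * bracket q v y * pairWeight q w v) := by funext v; ring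
  have e2 : (fun v => C v * bracket q v y * pairWeight q w v * bracket q v z) =
    (fun v => C v * bracket q v z * bracket q v y * pairWeight q w v) := by funext v; ring
  rw [e1, e2]
  have : (y - z) * bracket q w z + (q - q⁻¹) * z * (w - y) = bracket q y z * (w - z) := by
    unfold bracket
    ring
  linear_combination nodeWeight q S w * C w * y * (L.map fun p => w - p.2).prod *
    residueSum q S (fun v => C v * bracket q v z * bracket q v y * pairWeight q w v) L * this

theorem Finset.sum_sum_eq_zero_of_antisymm {ι : Type*} (S : Finset ι) (f : ι → ι → ℂ)
    (h : ∀ u v, f u v = -f v u) : ∑ u ∈ S, ∑ v ∈ S, f u v = 0 := by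
  have h1 : ∑ u ∈ S, ∑ v ∈ S, f u v = -∑ u ∈ S, ∑ v ∈ S, f u v := by
    conv_lhs => rw [Finset.sum_comm]
    rw [← Finset.sum_neg_distrib]
    refine Finset.sum_congr rfl fun u _ => ?_
    rw [← Finset.sum_neg_distrib]
    exact Finset.sum_congr rfl fun v _ => h _ _
  linear_combination h1 / 2

/-- Here the equality holds only after summation. In the difference of the summands for nodes u and
w, (u-y)[w,z] - (u-z)[w,y] = (z-y)[w,u]; multiplied by the pair weight (w-u)[u,w] it is
antisymmetric in u and w, while all other factors are symmetric. -/
theorem residueSum_swap_down (q : ℂ) (S : Finset ℂ) (z y : ℂ) (L : List (Fin 2 × ℂ)) (C : ℂ → ℂ) :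
    residueSum q S C ((1, z) :: (1, y) :: L) = residueSum q S C ((1, y) :: (1, z) :: L) := by
  simp only [residueSum, one_ne_zero, if_false, List.map_cons, List.prod_cons]
  rw [← sub_eq_zero, ← Finset.sum_sub_distrib]
  simp_rw [Finset.mul_sum, ← Finset.sum_sub_distrib]
  refine Finset.sum_sum_eq_zero_of_antisymm S _ fun u w => ?_
  have e : ∀ a b u w : ℂ, residueSum q S (fun v => C v * bracket q v a * pairWeight q u v *
      bracket q v b * pairWeight q w v) L = residueSum q S (fun v => C v * bracket q v a *
        bracket q v b * (pairWeight q u v * pairWeight q w v)) L := by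
    intro a b u w; congr 1; funext v; ring
  have e2 : ∀ a b u w : ℂ, residueSum q S (fun v => C v * bracket q v a *
        bracket q v b * (pairWeight q u v * pairWeight q w v)) L = residueSum q S (fun v => C v *
        bracket q v b * bracket q v a * (pairWeight q w v * pairWeight q u v)) L := by
    intro a b u w; congr 1; funext v; ring
  have e3 : ∀ a b u w : ℂ, residueSum q S (fun v => C v * bracket q v a *
        bracket q v b * (pairWeight q u v * pairWeight q w v)) L = residueSum q S (fun v => C v *
        bracket q v b * bracket q v a * (pairWeight q u v * pairWeight q w v)) L := by
    intro a b u w; congr 1; funext v; ring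
  simp only [e]
  rw [e2 z y w u, e3 z y u w]
  unfold pairWeight bracket
  ring_nf

theorem bracketProd_swap (q z y : ℂ) (A B : List ℂ) :
    bracket q y z * bracketProd q (A ++ z :: y :: B) =
      bracket q z y * bracketProd q (A ++ y :: z :: B) := by
  induction A with
  | nil => simp only [List.nil_append, bracketProd, List.map_cons, List.prod_cons]; ring
  | cons a A ih =>
    simp only [List.cons_append, bracketProd, List.map_append, List.map_cons, List.prod_append,
      List.prod_cons]
    linear_combination ((A.map (bracket q a)).prod * (bracket q a z * (bracket q a y *
      (B.map (bracket q a)).prod))) * ih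

theorem toFinset_swap (z y : ℂ) (A B : List ℂ) :
    (A ++ z :: y :: B).toFinset = (A ++ y :: z :: B).toFinset :=
  List.toFinset_eq_of_perm _ _ (List.Perm.append_left _ (List.Perm.swap _ _ _))

theorem chainComponent_swap_same (q : ℂ) (s : Fin 2) (z y : ℂ) (A B : List (Fin 2 × ℂ)) :
    bracket q y z * chainComponent q (A ++ (s, z) :: (s, y) :: B) =
      bracket q z y * chainComponent q (A ++ (s, y) :: (s, z) :: B) := by
  unfold chainComponent residueComponent
  simp only [List.map_append, List.map_cons, List.length_append, List.length_cons]
  split_ifs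
  · rw [toFinset_swap z y]
    have h : ∀ S C, residueSum q S C (A ++ (s, z) :: (s, y) :: B) =
        residueSum q S C (A ++ (s, y) :: (s, z) :: B) := by
      intro S C
      have hp : ((((s, z) :: (s, y) :: B).map Prod.snd).Perm
          (((s, y) :: (s, z) :: B).map Prod.snd)) := List.Perm.swap _ _ _
      have := residueSum_append q S 1 0 1 hp hp (fun C => by
        obtain rfl | rfl : s = 0 ∨ s = 1 := by omega
        · rw [residueSum_swap_up]; ring
        · rw [residueSum_swap_down]; ring) A C
      simpa using this
    rw [h]
    linear_combination residueSum q _ (fun _ => 1) (A ++ (s, y) :: (s, z) :: B) *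
      bracketProd_swap q z y (A.map Prod.snd) (B.map Prod.snd)
  · simp

theorem count_swap (s t : Fin 2) (A B : List (Fin 2)) :
    (A ++ s :: t :: B).count 1 = (A ++ t :: s :: B).count 1 :=
  (List.Perm.append_left _ (List.Perm.swap _ _ _)).count_eq _

theorem chainComponent_exchange_up_down (q : ℂ) (hq : q ≠ 0) (z y : ℂ) (A B : List (Fin 2 × ℂ))
    (hyz : bracket q y z ≠ 0) :
    (y - z) * chainComponent q (A ++ (1, z) :: (0, y) :: B) +
      (q - q⁻¹) * z * chainComponent q (A ++ (0, z) :: (1, y) :: B) =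
      bracket q z y * chainComponent q (A ++ (0, y) :: (1, z) :: B) := by
  unfold chainComponent residueComponent
  simp only [List.map_append, List.map_cons, List.length_append, List.length_cons]
  rw [count_swap 1 0]
  split_ifs
  · rw [toFinset_swap z y]
    have h := residueSum_append q
      (A.map Prod.snd ++ y :: z :: B.map Prod.snd).toFinset _ _ _
      (by exact List.Perm.refl _) (by exact List.Perm.swap y z _) (residueSum_up_down q hq _ z y B) A (fun _ => 1)
    have h2 := bracketProd_swap q z y (A.map Prod.snd) (B.map Prod.snd)
    -- The prefactors of the two orders of sites are comparable only through `bracketProd_swap`,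
    -- that is after multiplication by [y,z].
    apply mul_left_cancel₀ hyz
    linear_combination bracket q y z * bracketProd q (A.map Prod.snd ++ z :: y :: B.map Prod.snd) * h
      + bracket q y z * residueSum q (A.map Prod.snd ++ y :: z :: B.map Prod.snd).toFinset
        (fun _ => 1) (A ++ (0, y) :: (1, z) :: B) * h2
  · simp

theorem chainComponent_exchange_down_up (q : ℂ) (z y : ℂ) (A B : List (Fin 2 × ℂ))
    (hyz : bracket q y z ≠ 0) :
    (y - z) * chainComponent q (A ++ (0, z) :: (1, y) :: B) +
      (q - q⁻¹) * y * chainComponent q (A ++ (1, z) :: (0, y) :: B) =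
      bracket q z y * chainComponent q (A ++ (1, y) :: (0, z) :: B) := by
  unfold chainComponent residueComponent
  simp only [List.map_append, List.map_cons, List.length_append, List.length_cons]
  rw [count_swap 0 1]
  split_ifs
  · rw [toFinset_swap z y]
    have h := residueSum_append q
      (A.map Prod.snd ++ y :: z :: B.map Prod.snd).toFinset _ _ _
      (by exact List.Perm.refl _) (by exact List.Perm.swap y z _) (residueSum_down_up q _ z y B) A (fun _ => 1)
    have h2 := bracketProd_swap q z y (A.map Prod.snd) (B.map Prod.snd)
    apply mul_left_cancel₀ hyz
    linear_combination bracket q y z * bracketProd q (A.map Prod.snd ++ z :: y :: B.map Prod.snd) * h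
      + bracket q y z * residueSum q (A.map Prod.snd ++ y :: z :: B.map Prod.snd).toFinset
        (fun _ => 1) (A ++ (1, y) :: (0, z) :: B) * h2
  · simp

/-- The exchange relation. -/
theorem chainComponent_exchange (q : ℂ) (hq : q ≠ 0) (z y : ℂ) (A B : List (Fin 2 × ℂ))
    (hz : z ≠ 0) (hyz : bracket q y z ≠ 0) (hzy : bracket q z y ≠ 0) (α m : Fin 2) :
    ∑ γ, ∑ ν, sixVertexR q (y / z) (α, m) (γ, ν) * chainComponent q (A ++ (ν, z) :: (γ, y) :: B) =
      chainComponent q (A ++ (α, y) :: (m, z) :: B) := by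
  have hd : q - q⁻¹ * (y / z) = bracket q z y / z := by unfold bracket; field_simp
  have ha : weightA q (y / z) = bracket q y z / bracket q z y := by
    unfold weightA; rw [hd]; unfold bracket at *; field_simp
  have hb : weightB q (y / z) = (y - z) / bracket q z y := by
    unfold weightB; rw [hd]; field_simp
  have hc : weightC q (y / z) = (q - q⁻¹) * y / bracket q z y := by
    unfold weightC; rw [hd]; field_simp
  have hc' : weightC' q (y / z) = (q - q⁻¹) * z / bracket q z y := by
    unfold weightC'; rw [hd]; field_simp
  have h1 := chainComponent_swap_same q 0 z y A B
  have h2 := chainComponent_swap_same q 1 z y A B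
  have h3 := chainComponent_exchange_up_down q hq z y A B hyz
  have h4 := chainComponent_exchange_down_up q z y A B hyz
  fin_cases α <;> fin_cases m <;>
    simp [Fin.sum_univ_two, sixVertexR, ha, hb, hc, hc'] <;> apply mul_left_cancel₀ hzy
  · rw [← h1]; field_simp
  · rw [← h3]; field_simp
  · rw [← h4]; field_simp; ring
  · rw [← h2]; field_simp

/-! ### Interpolation identities and explicit components -/

-- The sum is the divided difference of `P` over `T`, i.e. the coefficient of degree `T.card - 1`,
-- the top one of the interpolating polynomial.
open Polynomial in
theorem sum_eval_div_prod_sub_eq_zero (T : Finset ℂ) (P : ℂ[X]) (h : P.natDegree + 1 < T.card) :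
    ∑ u ∈ T, P.eval u / ∏ s ∈ T.erase u, (u - s) = 0 := by
  have hd : P.degree < T.card :=
    lt_of_le_of_lt P.degree_le_natDegree (by exact_mod_cast (by omega : P.natDegree < T.card))
  have := Lagrange.coeff_eq_sum (v := id) (s := T) (Function.injective_id.injOn) hd
  simp only [id] at this
  rw [← this]
  exact P.coeff_eq_zero_of_natDegree_lt (by omega)

open Polynomial in
theorem sum_eval_mul_prod_div_eq_eval (T : Finset ℂ) (P : ℂ[X]) (h : P.natDegree < T.card)
    (Y : ℂ) :
    ∑ u ∈ T, P.eval u * ∏ s ∈ T.erase u, ((Y - s) / (u - s)) = P.eval Y := by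
  have hd : P.degree < T.card :=
    lt_of_le_of_lt P.degree_le_natDegree (by exact_mod_cast h)
  have := Lagrange.eq_interpolate (v := id) (s := T) (Function.injective_id.injOn) hd
  conv_rhs => rw [this, Lagrange.interpolate_apply]
  rw [eval_finsetSum]
  refine Finset.sum_congr rfl fun u _ => ?_
  simp only [id, eval_mul, eval_C, Lagrange.basis, eval_prod, Lagrange.basisDivisor, eval_sub,
    eval_X]
  congr 1
  refine Finset.prod_congr rfl fun s _ => ?_
  rw [div_eq_inv_mul]

theorem list_prod_map_eq_prod_toFinset {l : List ℂ} (h : l.Nodup) (f : ℂ → ℂ) :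
    (l.map f).prod = ∏ s ∈ l.toFinset, f s := (List.prod_toFinset f h).symm

theorem bracket_self (q z : ℂ) : bracket q z z = (q - q⁻¹) * z := by unfold bracket; ring

theorem pairWeight_self (q z : ℂ) : pairWeight q z z = 0 := by unfold pairWeight; ring

/-- The variable of a down arrow only has residues at the sites up to that arrow. -/
theorem residueSum_down (q : ℂ) (D : Finset ℂ) (C : ℂ → ℂ) (z : ℂ) (L : List (Fin 2 × ℂ))
    (hL : (L.map Prod.snd).Nodup) (hD : Disjoint D (L.map Prod.snd).toFinset) :
    residueSum q (D ∪ (L.map Prod.snd).toFinset) C ((1, z) :: L) =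
      ∑ w ∈ D, (q - q⁻¹) * w * C w * z / ((∏ s ∈ D.erase w, (w - s)) * (∏ s ∈ D, bracket q w s) *
        ∏ s ∈ (L.map Prod.snd).toFinset, bracket q w s) *
        residueSum q (D ∪ (L.map Prod.snd).toFinset)
          (fun v => C v * bracket q v z * pairWeight q w v) L := by
  simp only [residueSum, one_ne_zero, if_false]
  set R := (L.map Prod.snd).toFinset with hR
  have hp : ∀ w, (L.map fun p => w - p.2).prod = ∏ s ∈ R, (w - s) := by
    intro w
    rw [hR, ← list_prod_map_eq_prod_toFinset hL, List.map_map]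
    rfl
  rw [Finset.sum_union hD]
  have h0 : ∑ w ∈ R, nodeWeight q (D ∪ R) w * C w * z * (L.map fun p => w - p.2).prod *
      residueSum q (D ∪ R) (fun v => C v * bracket q v z * pairWeight q w v) L = 0 := by
    refine Finset.sum_eq_zero fun w hw => ?_
    rw [hp, Finset.prod_eq_zero hw (sub_self w)]
    ring
  rw [h0, add_zero]
  refine Finset.sum_congr rfl fun w hw => ?_
  have hwR : w ∉ R := Finset.disjoint_left.1 hD hw
  have e : (D ∪ R).erase w = D.erase w ∪ R := by
    rw [Finset.erase_union_distrib, Finset.erase_eq_of_notMem hwR]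
  have hn : ∏ s ∈ R, (w - s) ≠ 0 := Finset.prod_ne_zero_iff.2 fun s hs =>
    sub_ne_zero.2 fun h => hwR (h ▸ hs)
  congr 1
  rw [hp, nodeWeight, e, Finset.prod_union (hD.mono_left (Finset.erase_subset _ _)),
    Finset.prod_union hD]
  generalize ∏ s ∈ R, (w - s) = x at *
  generalize ∏ s ∈ D.erase w, (w - s) = a
  generalize ∏ s ∈ D, bracket q w s = b
  generalize ∏ s ∈ R, bracket q w s = c
  rw [show a * x * (b * c) = x * (a * b * c) by ring, div_mul_eq_mul_div, div_mul_eq_mul_div,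
    div_mul_eq_mul_div, show (q - q⁻¹) * w * C w * z * x = x * ((q - q⁻¹) * w * C w * z) by ring,
    mul_div_mul_left _ _ hn]

/-- Down arrows at the given sites. -/
def downSites (zs : List ℂ) : List (Fin 2 × ℂ) := zs.map fun z => (1, z)

/-- Up arrows at the given sites. -/
def upSites (zs : List ℂ) : List (Fin 2 × ℂ) := zs.map fun z => (0, z)

theorem map_snd_downSites (zs : List ℂ) : (downSites zs).map Prod.snd = zs := by
  simp [downSites, Function.comp_def]

theorem map_snd_upSites (zs : List ℂ) : (upSites zs).map Prod.snd = zs := by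
  simp [upSites, Function.comp_def]

/-- The weight attached to the remaining variables when the nodes `E` carry the preceding ones. -/
noncomputable def filledWeight (q : ℂ) (E : Finset ℂ) (v : ℂ) : ℂ :=
  ∏ e ∈ E, (bracket q v e * pairWeight q e v)

/-- Only one residue survives: nodes of sites further right are excluded by `residueSum_down`, and
those in `E` by the zero of the pair weight on the diagonal. The new variable must therefore sit at
z itself. -/
theorem residueSum_filledWeight_cons (q : ℂ) (E : Finset ℂ) (z : ℂ) (L : List (Fin 2 × ℂ))
    (hz : z ∉ E) (hL : (L.map Prod.snd).Nodup)
    (hD : Disjoint (insert z E) (L.map Prod.snd).toFinset)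
    (hbz : bracket q z z ≠ 0) (hb : ∀ e ∈ E, bracket q z e ≠ 0) :
    residueSum q (insert z E ∪ (L.map Prod.snd).toFinset) (filledWeight q E) ((1, z) :: L) =
      z * (∏ e ∈ E, bracket q e z) / (∏ s ∈ (L.map Prod.snd).toFinset, bracket q z s) *
        residueSum q (insert z E ∪ (L.map Prod.snd).toFinset) (filledWeight q (insert z E)) L := by
  rw [residueSum_down q (insert z E) _ z L hL hD, Finset.sum_insert hz]
  rw [Finset.sum_eq_zero (s := E), add_zero]
  · have e1 : (fun v => filledWeight q E v * bracket q v z * pairWeight q z v) =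
        filledWeight q (insert z E) := by
      funext v
      rw [filledWeight, filledWeight, Finset.prod_insert hz]
      ring
    rw [e1, Finset.erase_insert hz, Finset.prod_insert hz]
    congr 1
    have hz0 : (q - q⁻¹) * z ≠ 0 := by rwa [← bracket_self]
    have h1 : ∏ e ∈ E, bracket q z e ≠ 0 := Finset.prod_ne_zero_iff.2 hb
    have h2 : ∏ e ∈ E, (z - e) ≠ 0 := Finset.prod_ne_zero_iff.2 fun e he =>
      sub_ne_zero.2 fun h => hz (h ▸ he)
    have e2 : filledWeight q E z =
        (∏ e ∈ E, bracket q z e) * ((∏ e ∈ E, (z - e)) * ∏ e ∈ E, bracket q e z) := by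
      simp only [filledWeight, pairWeight, Finset.prod_mul_distrib]
    rw [e2, bracket_self]
    generalize ∏ e ∈ E, bracket q z e = a at *
    generalize ∏ e ∈ E, (z - e) = b at *
    rw [show (q - q⁻¹) * z * (a * (b * ∏ e ∈ E, bracket q e z)) * z =
      ((q - q⁻¹) * z * a * b) * (z * ∏ e ∈ E, bracket q e z) by ring,
      show b * ((q - q⁻¹) * z * a) * ∏ s ∈ (L.map Prod.snd).toFinset, bracket q z s =
      ((q - q⁻¹) * z * a * b) * ∏ s ∈ (L.map Prod.snd).toFinset, bracket q z s by ring,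
      mul_div_mul_left]
    exact mul_ne_zero (mul_ne_zero hz0 h1) h2
  · intro w hw
    rw [filledWeight, Finset.prod_eq_zero hw (by rw [pairWeight_self, mul_zero])]
    simp

/-- Iterates the collapse to a single residue over an initial block of down arrows. The factors of
`bracketProd` cancel the denominators left at each step. -/
theorem residueSum_filledWeight_append (q : ℂ) (zs : List ℂ) (L : List (Fin 2 × ℂ)) (E : Finset ℂ)
    (hnd : (zs ++ L.map Prod.snd).Nodup) (hE : Disjoint E (zs ++ L.map Prod.snd).toFinset)
    (hb : ∀ u ∈ zs, ∀ v ∈ E ∪ (zs ++ L.map Prod.snd).toFinset, bracket q u v ≠ 0) :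
    bracketProd q (zs ++ L.map Prod.snd) *
        residueSum q (E ∪ (zs ++ L.map Prod.snd).toFinset) (filledWeight q E) (downSites zs ++ L) =
      zs.prod * (zs.map fun z => ∏ e ∈ E, bracket q e z).prod * bracketProd q zs *
        (bracketProd q (L.map Prod.snd) *
          residueSum q (E ∪ (zs ++ L.map Prod.snd).toFinset) (filledWeight q (E ∪ zs.toFinset)) L) := by
  induction zs generalizing E with
  | nil => simp [bracketProd, downSites]
  | cons z zs ih =>
    have hmap : (downSites zs ++ L).map Prod.snd = zs ++ L.map Prod.snd := by
      rw [List.map_append, map_snd_downSites]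
    have hz : z ∉ E := fun h => Finset.disjoint_left.1 hE h (by simp)
    have hnd' : z ∉ zs ++ L.map Prod.snd ∧ (zs ++ L.map Prod.snd).Nodup := List.nodup_cons.1 hnd
    have hset : E ∪ (z :: zs ++ L.map Prod.snd).toFinset =
        insert z E ∪ (zs ++ L.map Prod.snd).toFinset := by
      ext; simp
    have hE' : Disjoint (insert z E) (zs ++ L.map Prod.snd).toFinset := by
      rw [Finset.disjoint_insert_left]
      refine ⟨by simpa using hnd'.1, hE.mono_right ?_⟩
      intro; simp; tauto
    have h1 := residueSum_filledWeight_cons q E z (downSites zs ++ L) hz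
      (by rw [hmap]; exact hnd'.2) (by rw [hmap]; exact hE')
      (hb z (by simp) z (by simp)) (fun e he => hb z (by simp) e (by simp [he]))
    rw [hmap] at h1
    have h2 := ih (insert z E) hnd'.2 hE' (fun u hu v hv => hb u (by simp [hu]) v (by
      rw [hset]; exact hv))
    rw [hset]
    have h3 : ∏ s ∈ (zs ++ L.map Prod.snd).toFinset, bracket q z s ≠ 0 :=
      Finset.prod_ne_zero_iff.2 fun s hs => hb z (by simp) s (by
        rw [hset]; exact Finset.mem_union_right _ hs)
    have h4 : insert z E ∪ zs.toFinset = E ∪ (z :: zs).toFinset := by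
      ext; simp
    have h5 : (zs.map fun z' => ∏ e ∈ insert z E, bracket q e z').prod =
        (zs.map (bracket q z)).prod * (zs.map fun z' => ∏ e ∈ E, bracket q e z').prod := by
      rw [← List.prod_map_mul]
      congr 1
      refine List.map_congr_left fun z' _ => ?_
      rw [Finset.prod_insert hz]
    rw [show downSites (z :: zs) ++ L = (1, z) :: (downSites zs ++ L) from rfl, h1, ← h4]
    rw [List.cons_append, bracketProd, bracketProd, list_prod_map_eq_prod_toFinset hnd'.2,
      List.prod_cons, List.map_cons, List.prod_cons]
    rw [h5] at h2
    rw [show ∀ a b c d e : ℂ, b ≠ 0 → b * a * (c / b * d) = c * (a * d) by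
      intro a b c d _ hb; field_simp]
    · rw [h2]; ring
    · exact 0
    · exact h3

theorem residueSum_upSites_append (q : ℂ) (S : Finset ℂ) (ts : List ℂ) (L : List (Fin 2 × ℂ))
    (C : ℂ → ℂ) : residueSum q S C (upSites ts ++ L) =
      residueSum q S (fun v => C v * (ts.map (bracket q v)).prod) L := by
  induction ts generalizing C with
  | nil => simp [upSites]
  | cons t ts ih =>
    simp only [upSites, List.map_cons, List.cons_append, residueSum, if_true] at ih ⊢
    rw [ih]
    simp only [List.prod_cons, mul_assoc]

theorem residueSum_upSites (q : ℂ) (S : Finset ℂ) (ts : List ℂ) (C : ℂ → ℂ) :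
    residueSum q S C (upSites ts) = 1 := by
  have := residueSum_upSites_append q S ts [] C
  simpa [residueSum] using this

theorem filledWeight_empty (q : ℂ) : filledWeight q ∅ = fun _ => 1 := by
  funext v; simp [filledWeight]

/-- The component with all the down arrows to the left. -/
theorem residueComponent_sorted (q : ℂ) (zs ts : List ℂ) (h : IsGeneric q (zs ++ ts)) :
    residueComponent q (downSites zs ++ upSites ts) =
      zs.prod * bracketProd q zs * bracketProd q ts := by
  have := residueSum_filledWeight_append q zs (upSites ts) ∅ (by rw [map_snd_upSites]; exact h.1)
    (by simp) (by
      intro u hu v hv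
      rw [map_snd_upSites] at hv
      exact h.2 u (by simp [hu]) v (by simpa using hv))
  rw [residueSum_upSites, filledWeight_empty] at this
  simp only [map_snd_upSites, Finset.empty_union, Finset.prod_empty] at this
  rw [residueComponent, List.map_append, map_snd_upSites, map_snd_downSites, this]
  simp

theorem bracketProd_append_singleton (q : ℂ) (ts : List ℂ) (y : ℂ) :
    bracketProd q (ts ++ [y]) = bracketProd q ts * (ts.map fun t => bracket q t y).prod := by
  induction ts with
  | nil => simp [bracketProd]
  | cons t ts ih =>
    simp only [List.cons_append, bracketProd, ih, List.map_append, List.prod_append, List.map_cons,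
      List.prod_cons, List.map_nil, List.prod_nil]
    ring

theorem list_prod_map_const_mul (c : ℂ) (l : List ℂ) (f : ℂ → ℂ) :
    (l.map fun t => c * f t).prod = c ^ l.length * (l.map f).prod := by
  induction l with
  | nil => simp
  | cons a l ih => simp [ih, pow_succ]; ring

open Polynomial in
/-- The residue sum of the variable of a down arrow at the last site. -/
theorem sum_last_residue (q : ℂ) (hq : q ≠ 0) (Z : Finset ℂ) (T : Finset ℂ) (y : ℂ)
    (hcard : Z.card + 1 < T.card) (hb : ∀ t ∈ T, bracket q t y ≠ 0) :
    ∑ w ∈ T, w * (∏ e ∈ Z, bracket q e w) / ((∏ s ∈ T.erase w, (w - s)) * bracket q w y) =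
      -q⁻¹ * (q⁻¹ * q⁻¹ * y) * (∏ e ∈ Z, bracket q e (q⁻¹ * q⁻¹ * y)) /
        ∏ t ∈ T, (q⁻¹ * q⁻¹ * y - t) := by
  -- Y is the zero of [w,y]. Adding it to the nodes turns the sum into all but one term of a divided
  -- difference, which vanishes by degree.
  set Y := q⁻¹ * q⁻¹ * y with hY
  have hbr : ∀ w, bracket q w y = q * (w - Y) := by
    intro w; rw [hY]; unfold bracket; field_simp
  have hYT : Y ∉ T := fun h => hb Y h (by rw [hbr, sub_self, mul_zero])
  let P : ℂ[X] := X * ∏ e ∈ Z, (C (q * e) - C q⁻¹ * X)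
  have hP : ∀ w, P.eval w = w * ∏ e ∈ Z, bracket q e w := by
    intro w; simp [P, eval_prod, bracket]
  have hdeg : P.natDegree ≤ 1 + Z.card := by
    refine natDegree_mul_le.trans (add_le_add natDegree_X_le ?_)
    refine (natDegree_prod_le _ _).trans ?_
    refine (Finset.sum_le_card_nsmul _ _ 1 fun e _ => ?_).trans (by simp)
    compute_degree
  have hsum := sum_eval_div_prod_sub_eq_zero (insert Y T) P (by
    rw [Finset.card_insert_of_notMem hYT]; omega)
  rw [Finset.sum_insert hYT, Finset.erase_insert hYT, hP] at hsum
  have : ∀ w ∈ T, w * (∏ e ∈ Z, bracket q e w) / ((∏ s ∈ T.erase w, (w - s)) * bracket q w y) =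
      q⁻¹ * (P.eval w / ∏ s ∈ (insert Y T).erase w, (w - s)) := by
    intro w hw
    have hne : Y ≠ w := fun h => hYT (h ▸ hw)
    rw [Finset.erase_insert_of_ne hne, Finset.prod_insert (by simp [hYT]), hP, hbr,
      ← div_eq_inv_mul, div_div]
    congr 1
    ring
  rw [Finset.sum_congr rfl this, ← Finset.mul_sum, eq_neg_of_add_eq_zero_right hsum]
  ring

theorem inv_mul_inv_of_cube {q : ℂ} (h3 : q ^ 3 = 1) : q⁻¹ * q⁻¹ = q := by
  have : q ≠ 0 := by rintro rfl; norm_num at h3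
  field_simp
  exact h3.symm

/-- The component with the down arrows at the first sites and at the last one. -/
theorem residueComponent_sorted_concat_down (q : ℂ) (h3 : q ^ 3 = 1) (zs ts : List ℂ) (y : ℂ)
    (hlen : ts.length = zs.length + 2) (h : IsGeneric q (zs ++ (ts ++ [y]))) :
    residueComponent q (downSites zs ++ (upSites ts ++ [(1, y)])) =
      zs.prod * y * bracketProd q (y :: zs) * bracketProd q ts := by
  have hq : q ≠ 0 := by rintro rfl; norm_num at h3
  have hmap : (upSites ts ++ [((1 : Fin 2), y)]).map Prod.snd = ts ++ [y] := by
    simp [map_snd_upSites]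
  have hmain := residueSum_filledWeight_append q zs (upSites ts ++ [(1, y)]) ∅
    (by rw [hmap]; exact h.1) (by simp) (by
      intro u hu v hv
      rw [hmap, Finset.empty_union, List.mem_toFinset] at hv
      exact h.2 u (by simp [hu]) v hv)
  rw [residueSum_upSites_append, filledWeight_empty] at hmain
  simp only [hmap, Finset.empty_union, Finset.prod_empty] at hmain
  rw [residueComponent, List.map_append, hmap, map_snd_downSites, hmain]
  set S := (zs ++ (ts ++ [y])).toFinset with hS
  set Z := zs.toFinset with hZ
  set T := (ts ++ [y]).toFinset with hT
  have hSZT : S = Z ∪ T := by rw [hS, List.toFinset_append]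
  obtain ⟨hnz, hnt, hdisj⟩ := List.nodup_append'.1 h.1
  have hZT : Disjoint Z T := by
    rw [Finset.disjoint_left]
    intro a ha hb
    exact hdisj (by simpa [hZ] using ha) (by simpa only [hT, List.mem_toFinset] using hb)
  have hyt : y ∉ ts := by
    have := (List.nodup_append'.1 hnt).2.2
    intro h'; exact this h' (by simp)
  have hnts : ts.Nodup := (List.nodup_append'.1 hnt).1
  have hTins : T = insert y ts.toFinset := by rw [hT]; ext; simp
  have hyts : y ∉ ts.toFinset := by simpa using hyt
  have hmem : ∀ u, u ∈ S ↔ u ∈ zs ++ (ts ++ [y]) := fun u => List.mem_toFinset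
  have hbr : ∀ u ∈ S, ∀ v ∈ S, bracket q u v ≠ 0 := fun u hu v hv =>
    h.2 u ((hmem u).1 hu) v ((hmem v).1 hv)
  have hZS : Z ⊆ S := hSZT ▸ Finset.subset_union_left
  have hTS : T ⊆ S := hSZT ▸ Finset.subset_union_right
  have hyT : y ∈ T := by simp [hT]
  -- The last variable cannot return to the occupied nodes `Z`. At the nodes of `T` its brackets
  -- with `Z` and `ts` cancel against the node weight, and only [w,y] is left in the denominator.
  have hrs : residueSum q S (fun v => filledWeight q Z v * (ts.map (bracket q v)).prod) [(1, y)] =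
      (q - q⁻¹) * y * ∑ w ∈ T, w * (∏ e ∈ Z, bracket q e w) /
        ((∏ s ∈ T.erase w, (w - s)) * bracket q w y) := by
    have := residueSum_down q S (fun v => filledWeight q Z v * (ts.map (bracket q v)).prod) y []
      (by simp) (by simp)
    have hnil : ∀ C, residueSum q S C [] = 1 := fun _ => rfl
    simp only [List.map_nil, List.toFinset_nil, Finset.union_empty, Finset.prod_empty, mul_one,
      hnil] at this
    rw [this, hSZT, Finset.sum_union hZT, Finset.sum_eq_zero (s := Z), zero_add, Finset.mul_sum]
    · refine Finset.sum_congr rfl fun w hw => ?_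
      have hwZ : w ∉ Z := Finset.disjoint_right.1 hZT hw
      have e : (Z ∪ T).erase w = Z ∪ T.erase w := by
        rw [Finset.erase_union_distrib, Finset.erase_eq_of_notMem hwZ]
      rw [e, Finset.prod_union (hZT.mono_right (Finset.erase_subset _ _)), Finset.prod_union hZT,
        list_prod_map_eq_prod_toFinset hnts, hTins, Finset.prod_insert hyts, ← hTins]
      have n1 : ∏ s ∈ Z, (w - s) ≠ 0 := Finset.prod_ne_zero_iff.2 fun s hs =>
        sub_ne_zero.2 fun h => hwZ (h ▸ hs)
      have n2 : ∏ s ∈ Z, bracket q w s ≠ 0 := Finset.prod_ne_zero_iff.2 fun s hs =>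
        hbr w (hTS hw) s (hZS hs)
      have n3 : ∏ s ∈ ts.toFinset, bracket q w s ≠ 0 := Finset.prod_ne_zero_iff.2 fun s hs =>
        hbr w (hTS hw) s (hTS (hTins ▸ Finset.mem_insert_of_mem hs))
      simp only [filledWeight, pairWeight, Finset.prod_mul_distrib]
      generalize ∏ s ∈ Z, (w - s) = a at *
      generalize ∏ s ∈ Z, bracket q w s = b at *
      generalize ∏ s ∈ ts.toFinset, bracket q w s = c at *
      generalize ∏ s ∈ T.erase w, (w - s) = d
      rw [show (q - q⁻¹) * w * (b * (a * ∏ e ∈ Z, bracket q e w) * c) * y = (a * b * c) *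
        ((q - q⁻¹) * y * (w * ∏ e ∈ Z, bracket q e w)) by ring,
        show a * d * (b * (bracket q w y * c)) = (a * b * c) * (d * bracket q w y) by ring,
        mul_div_mul_left _ _ (mul_ne_zero (mul_ne_zero n1 n2) n3), mul_div_assoc]
    · intro w hw
      rw [filledWeight, Finset.prod_eq_zero hw (by rw [pairWeight_self, mul_zero])]
      simp
  have hcZ : Z.card = zs.length := List.toFinset_card_of_nodup hnz
  have hcT : T.card = ts.length + 1 := by rw [hT, List.toFinset_card_of_nodup hnt]; simp
  rw [hrs, sum_last_residue q hq Z T y (by omega) fun t ht => hbr t (hTS ht) y (hTS hyT)]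
  have e1 : ∀ t, q⁻¹ * q⁻¹ * y - t = -q⁻¹ * bracket q t y := by
    intro t; unfold bracket; field_simp; ring
  -- This is where q³ = 1 enters: it turns brackets ending at q⁻²y into brackets starting at y, as
  -- if y stood at the head of the chain.
  have e2 : ∀ e, bracket q e (q⁻¹ * q⁻¹ * y) = -q⁻¹ * bracket q y e := by
    intro t
    have : q⁻¹ * (q⁻¹ * q⁻¹ * y) = y := by
      rw [inv_mul_inv_of_cube h3]; field_simp
    unfold bracket
    rw [this]
    have := inv_mul_inv_of_cube h3
    have h4 : q⁻¹ * q = 1 := inv_mul_cancel₀ hq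
    linear_combination -t * this + y * h4
  simp only [e1, e2]
  rw [bracketProd_append_singleton, bracketProd, hTins, Finset.prod_insert hyts,
    ← list_prod_map_eq_prod_toFinset hnts, hZ, ← list_prod_map_eq_prod_toFinset hnz]
  simp only [list_prod_map_const_mul, bracket_self]
  have hyy : (q - q⁻¹) * y ≠ 0 := by rw [← bracket_self]; exact hbr y (hTS hyT) y (hTS hyT)
  have hty : (ts.map fun t => bracket q t y).prod ≠ 0 := by
    rw [list_prod_map_eq_prod_toFinset hnts]
    exact Finset.prod_ne_zero_iff.2 fun s hs =>
        hbr s (hTS (hTins ▸ Finset.mem_insert_of_mem hs)) y (hTS hyT)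
  rw [hlen]
  have hp : (-q⁻¹) ^ zs.length ≠ 0 := pow_ne_zero _ (neg_ne_zero.2 (inv_ne_zero hq))
  generalize (ts.map fun t => bracket q t y).prod = a at *
  have hqi : q⁻¹ ≠ 0 := inv_ne_zero hq
  rw [pow_add]
  generalize (-q⁻¹) ^ zs.length = b at *
  simp only [List.map_const', List.prod_replicate, one_pow]
  generalize q - q⁻¹ = d at *
  have hd : d ≠ 0 := left_ne_zero_of_mul hyy
  have hy0 : y ≠ 0 := right_ne_zero_of_mul hyy
  generalize q⁻¹ = r at *
  generalize (zs.map (bracket q y)).prod = c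
  field_simp

/-! ### Chains beginning with an up arrow -/

/-- The weight attached to the remaining variables when the sites `E` have been read and the nodes
`E \ {u}` carry the preceding variables. -/
noncomputable def omittedWeight (q : ℂ) (E : Finset ℂ) (u v : ℂ) : ℂ :=
  (∏ e ∈ E, bracket q v e) * ∏ m ∈ E.erase u, pairWeight q m v

theorem omittedWeight_eq_zero (q : ℂ) (E : Finset ℂ) {u v : ℂ} (hv : v ∈ E.erase u) :
    omittedWeight q E u v = 0 := by
  rw [omittedWeight, Finset.prod_eq_zero (f := fun m => pairWeight q m v) hv (pairWeight_self q v),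
    mul_zero]

/-- After an initial up arrow there is always one more available node than there are variables, so
exactly one node stays free. The next variable sits either at the new site z, leaving u free, or at
u, leaving z free. -/
theorem residueSum_omittedWeight_cons (q : ℂ) (E : Finset ℂ) (u z : ℂ) (L : List (Fin 2 × ℂ))
    (hu : u ∈ E) (hz : z ∉ E) (hL : (L.map Prod.snd).Nodup)
    (hD : Disjoint (insert z E) (L.map Prod.snd).toFinset)
    (hb : ∀ a ∈ insert z E, ∀ b ∈ insert z E, bracket q a b ≠ 0) :
    residueSum q (insert z E ∪ (L.map Prod.snd).toFinset) (omittedWeight q E u) ((1, z) :: L) =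
      z * (∏ m ∈ E.erase u, bracket q m z) /
          ((z - u) * ∏ s ∈ (L.map Prod.snd).toFinset, bracket q z s) *
        residueSum q (insert z E ∪ (L.map Prod.snd).toFinset) (omittedWeight q (insert z E) u) L +
      (q - q⁻¹) * u * z * (∏ m ∈ E.erase u, bracket q m u) /
          ((u - z) * (bracket q u z * ∏ s ∈ (L.map Prod.snd).toFinset, bracket q u s)) *
        residueSum q (insert z E ∪ (L.map Prod.snd).toFinset) (omittedWeight q (insert z E) z) L := by
  have hne : z ≠ u := fun h => hz (h ▸ hu)
  rw [residueSum_down q (insert z E) _ z L hL hD, Finset.sum_insert hz]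
  rw [Finset.sum_eq_single_of_mem u hu]
  · have e1 : (fun v => omittedWeight q E u v * bracket q v z * pairWeight q z v) =
        omittedWeight q (insert z E) u := by
      funext v
      rw [omittedWeight, omittedWeight, Finset.prod_insert hz, Finset.erase_insert_of_ne hne,
        Finset.prod_insert (by simp [hz])]
      ring
    have e2 : (fun v => omittedWeight q E u v * bracket q v z * pairWeight q u v) =
        omittedWeight q (insert z E) z := by
      funext v
      rw [omittedWeight, omittedWeight, Finset.prod_insert hz, Finset.erase_insert hz,
        ← Finset.mul_prod_erase E (fun m => pairWeight q m v) hu]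
      ring
    have f : ∀ v, omittedWeight q E u v = (∏ e ∈ E, bracket q v e) *
        ((∏ m ∈ E.erase u, (v - m)) * ∏ m ∈ E.erase u, bracket q m v) := by
      intro v
      simp only [omittedWeight, pairWeight, Finset.prod_mul_distrib]
    rw [e1, e2, f z, f u, Finset.erase_insert hz, Finset.prod_insert hz,
      Finset.erase_insert_of_ne hne, Finset.prod_insert (by simp [hz]), Finset.prod_insert hz,
      bracket_self, ← Finset.mul_prod_erase E (fun s => z - s) hu]
    have n1 : ∏ e ∈ E, bracket q z e ≠ 0 := Finset.prod_ne_zero_iff.2 fun e he =>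
      hb z (by simp) e (by simp [he])
    have n2 : ∏ e ∈ E, bracket q u e ≠ 0 := Finset.prod_ne_zero_iff.2 fun e he =>
      hb u (by simp [hu]) e (by simp [he])
    have n3 : ∏ e ∈ E.erase u, (z - e) ≠ 0 := Finset.prod_ne_zero_iff.2 fun e he =>
      sub_ne_zero.2 fun h => hz (h ▸ Finset.mem_of_mem_erase he)
    have n4 : ∏ e ∈ E.erase u, (u - e) ≠ 0 := Finset.prod_ne_zero_iff.2 fun e he =>
      sub_ne_zero.2 fun h => (Finset.ne_of_mem_erase he) h.symm
    have n5 : (q - q⁻¹) * z ≠ 0 := by rw [← bracket_self]; exact hb z (by simp) z (by simp)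
    generalize ∏ e ∈ E, bracket q z e = a1 at *
    generalize ∏ e ∈ E, bracket q u e = a2 at *
    generalize ∏ e ∈ E.erase u, (z - e) = a3 at *
    generalize ∏ e ∈ E.erase u, (u - e) = a4 at *
    congr 2
    · rw [← mul_div_mul_left (z * _) _ (mul_ne_zero (mul_ne_zero n5 n1) n3)]
      congr 1 <;> ring
    · rw [← mul_div_mul_left ((q - q⁻¹) * u * z * _) _ (mul_ne_zero n2 n4)]
      congr 1 <;> ring
  · intro w hw hwu
    rw [omittedWeight_eq_zero q E (Finset.mem_erase.2 ⟨hwu, hw⟩)]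
    simp

-- Sums over u the contributions in which the free node moves from u to z. The right-hand side is,
-- up to the factor -1/(q²y-z) and brackets with z, the interpolation weight of z among the nodes
-- `insert z E`.
open Polynomial in
theorem sum_omitted_residue (q : ℂ) (hq : q ≠ 0) (E : Finset ℂ) (y z : ℂ) (hy : y ∈ E) (hz : z ∉ E)
    (hY : bracket q y z ≠ 0) :
    (q - q⁻¹) * ∑ u ∈ E, u * (∏ s ∈ E.erase u, ((q ^ 2 * y - s) / (u - s))) *
        (∏ m ∈ E.erase u, bracket q m u) / (u - z) =
      -((∏ s ∈ E, bracket q s z) * ∏ s ∈ E, ((q ^ 2 * y - s) / (z - s))) / (q ^ 2 * y - z) := by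
  set Y := q ^ 2 * y with hYd
  have hbr : ∀ w, bracket q y w = q⁻¹ * (Y - w) := by
    intro w; rw [hYd]; unfold bracket; field_simp
  -- Omitting e = y removes the factor [y,w] = q⁻¹(Y-w), which is supplied by the interpolation
  -- weights. This lowers the degree by one, exactly what the vanishing of the divided difference
  -- over `insert z E` requires.
  let P : ℂ[X] := ∏ e ∈ E.erase y, (C (q * e) - C q⁻¹ * X)
  have hP : ∀ w, q⁻¹ * (Y - w) * P.eval w = ∏ e ∈ E, bracket q e w := by
    intro w
    rw [← Finset.mul_prod_erase E _ hy, hbr]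
    simp [P, eval_prod, bracket]
  have hdeg : P.natDegree ≤ (E.erase y).card := by
    refine (natDegree_prod_le _ _).trans ?_
    refine (Finset.sum_le_card_nsmul _ _ 1 fun e _ => ?_).trans (by simp)
    compute_degree
  have hc : (E.erase y).card + 1 = E.card := Finset.card_erase_add_one hy
  have hsum := sum_eval_div_prod_sub_eq_zero (insert z E) P (by
    rw [Finset.card_insert_of_notMem hz]; omega)
  rw [Finset.sum_insert hz, Finset.erase_insert hz] at hsum
  have h1 : ∀ u ∈ E, (q - q⁻¹) * (u * (∏ s ∈ E.erase u, ((Y - s) / (u - s))) *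
        (∏ m ∈ E.erase u, bracket q m u) / (u - z)) =
      q⁻¹ * (∏ s ∈ E, (Y - s)) * (P.eval u / ∏ s ∈ (insert z E).erase u, (u - s)) := by
    intro u hu
    have hne : z ≠ u := fun h => hz (h ▸ hu)
    have hne' : u - z ≠ 0 := sub_ne_zero.2 hne.symm
    have h2 := hP u
    rw [← Finset.mul_prod_erase E _ hu, bracket_self] at h2
    rw [Finset.erase_insert_of_ne hne, Finset.prod_insert (by simp [hz]), Finset.prod_div_distrib,
      ← Finset.mul_prod_erase E _ hu]
    have n4 : ∏ e ∈ E.erase u, (u - e) ≠ 0 := Finset.prod_ne_zero_iff.2 fun e he =>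
      sub_ne_zero.2 fun h => (Finset.ne_of_mem_erase he) h.symm
    have h3 : (q - q⁻¹) * (u * ((∏ s ∈ E.erase u, (Y - s)) / ∏ e ∈ E.erase u, (u - e)) *
      (∏ m ∈ E.erase u, bracket q m u) / (u - z)) =
      (∏ s ∈ E.erase u, (Y - s)) * ((q - q⁻¹) * u * (∏ m ∈ E.erase u, bracket q m u)) /
        ((u - z) * ∏ e ∈ E.erase u, (u - e)) := by
      field_simp
    rw [h3, ← h2]
    field_simp
  rw [Finset.mul_sum, Finset.sum_congr rfl h1, ← Finset.mul_sum, eq_neg_of_add_eq_zero_right hsum,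
    ← hP z, Finset.prod_div_distrib]
  have h4 : Y - z ≠ 0 := fun h => hY (by rw [hbr, h, mul_zero])
  field_simp

/-- The weighted sum of the residue sums in which the node `u` is left free. -/
noncomputable def omittedSum (q : ℂ) (S : Finset ℂ) (Y : ℂ) (E : Finset ℂ) (zs ts : List ℂ) : ℂ :=
  ∑ u ∈ E, (∏ s ∈ (zs ++ ts).toFinset, bracket q u s) *
    (∏ s ∈ E.erase u, ((Y - s) / (u - s))) *
    residueSum q S (omittedWeight q E u) (downSites zs ++ upSites ts)

/-- The Lagrange weights at Y = q²y in `omittedSum` are chosen so that this recursion closes: terms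
keeping u free acquire a common factor, and by `sum_omitted_residue` the terms freeing z add up to
the missing term with that same factor. -/
theorem omittedSum_cons (q : ℂ) (hq : q ≠ 0) (E : Finset ℂ) (y z : ℂ) (zs ts : List ℂ) (hy : y ∈ E)
    (hz : z ∉ E) (hnd : (z :: zs ++ ts).Nodup)
    (hD : Disjoint (insert z E) (zs ++ ts).toFinset)
    (hb : ∀ a ∈ insert z E ∪ (zs ++ ts).toFinset, ∀ b ∈ insert z E ∪ (zs ++ ts).toFinset,
      bracket q a b ≠ 0) :
    (∏ s ∈ (zs ++ ts).toFinset, bracket q z s) *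
      omittedSum q (insert z E ∪ (zs ++ ts).toFinset) (q ^ 2 * y) E (z :: zs) ts =
      -(z * (∏ m ∈ E, bracket q m z) / (q ^ 2 * y - z)) *
        omittedSum q (insert z E ∪ (zs ++ ts).toFinset) (q ^ 2 * y) (insert z E) zs ts := by
  have hmap : (downSites zs ++ upSites ts).map Prod.snd = zs ++ ts := by
    rw [List.map_append, map_snd_downSites, map_snd_upSites]
  have hnd' : z ∉ zs ++ ts ∧ (zs ++ ts).Nodup := List.nodup_cons.1 hnd
  have hzR : z ∉ (zs ++ ts).toFinset := by rw [List.mem_toFinset]; exact hnd'.1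
  have hRins : (z :: zs ++ ts).toFinset = insert z (zs ++ ts).toFinset := by simp
  unfold omittedSum
  rw [hRins]
  set R := (zs ++ ts).toFinset with hR
  set S := insert z E ∪ R with hS
  set Y := q ^ 2 * y with hYd
  have hbr : ∀ w, bracket q y w = q⁻¹ * (Y - w) := by
    intro w; rw [hYd]; unfold bracket; field_simp
  have hYz : Y - z ≠ 0 := fun h => hb y (by simp [hS, hy]) z (by simp [hS]) (by
    rw [hbr, h, mul_zero])
  have hRz : ∏ s ∈ R, bracket q z s ≠ 0 := Finset.prod_ne_zero_iff.2 fun s hs =>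
    hb z (by simp [hS]) s (by simp [hS, hs])
  have key : ∀ u ∈ E, (∏ s ∈ R, bracket q z s) * ((∏ s ∈ insert z R, bracket q u s) *
      (∏ s ∈ E.erase u, ((Y - s) / (u - s))) *
      residueSum q S (omittedWeight q E u) (downSites (z :: zs) ++ upSites ts)) =
      -(z * (∏ m ∈ E, bracket q m z) / (Y - z)) * ((∏ s ∈ R, bracket q u s) *
        (∏ s ∈ (insert z E).erase u, ((Y - s) / (u - s))) *
        residueSum q S (omittedWeight q (insert z E) u) (downSites zs ++ upSites ts)) +
      (∏ s ∈ R, bracket q z s) * z * residueSum q S (omittedWeight q (insert z E) z)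
        (downSites zs ++ upSites ts) * ((q - q⁻¹) *
        (u * (∏ s ∈ E.erase u, ((Y - s) / (u - s))) * (∏ m ∈ E.erase u, bracket q m u) /
          (u - z))) := by
    intro u hu
    have hne : z ≠ u := fun h => hz (h ▸ hu)
    have h1 := residueSum_omittedWeight_cons q E u z (downSites zs ++ upSites ts) hu hz
      (by rw [hmap]; exact hnd'.2) (by rw [hmap]; exact hD)
      (fun a ha b hb' => hb a (Finset.mem_union_left _ ha) b (Finset.mem_union_left _ hb'))
    rw [hmap] at h1
    rw [show downSites (z :: zs) ++ upSites ts = (1, z) :: (downSites zs ++ upSites ts) from rfl, h1,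
      Finset.erase_insert_of_ne hne, Finset.prod_insert hzR,
      Finset.prod_insert (s := E.erase u) (a := z) (by simp [hz]),
      ← Finset.mul_prod_erase E (fun m => bracket q m z) hu]
    have n1 : z - u ≠ 0 := sub_ne_zero.2 hne
    have n2 : u - z ≠ 0 := sub_ne_zero.2 hne.symm
    have n3 : bracket q u z ≠ 0 := hb u (by simp [hS, hu]) z (by simp [hS])
    have n4 : ∏ s ∈ R, bracket q u s ≠ 0 := Finset.prod_ne_zero_iff.2 fun s hs =>
      hb u (by simp [hS, hu]) s (by simp [hS, hs])
    rw [← hR, ← hS]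
    generalize ∏ s ∈ R, bracket q u s = a1 at *
    generalize ∏ s ∈ R, bracket q z s = a2 at *
    generalize ∏ s ∈ E.erase u, ((Y - s) / (u - s)) = a3 at *
    generalize residueSum q S _ _ = b1
    generalize residueSum q S _ _ = b2
    generalize ∏ m ∈ E.erase u, bracket q m z = b3
    generalize ∏ m ∈ E.erase u, bracket q m u = b4
    generalize bracket q u z = b5 at *
    generalize q - q⁻¹ = b6
    rw [show z - u = -(u - z) by ring]
    generalize u - z = b7 at *
    generalize Y - z = b8 at *
    field_simp
  rw [Finset.mul_sum, Finset.sum_congr rfl key, Finset.sum_add_distrib, ← Finset.mul_sum,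
    ← Finset.mul_sum, ← Finset.mul_sum (a := q - q⁻¹),
    sum_omitted_residue q hq E y z hy hz (hb y (by simp [hS, hy]) z (by simp [hS])),
    Finset.sum_insert hz, Finset.erase_insert hz, ← hYd]
  ring

-- Once only up arrows remain, the sum is Lagrange interpolation at Y of ∏ [X,t], of degree at most
-- `ts.length`, over `ts.length + 1` nodes.
open Polynomial in
theorem omittedSum_nil (q : ℂ) (S : Finset ℂ) (Y : ℂ) (E : Finset ℂ) (ts : List ℂ) (hnd : ts.Nodup)
    (hcard : E.card = ts.length + 1) :
    omittedSum q S Y E [] ts = (ts.map (bracket q Y)).prod := by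
  let P : ℂ[X] := ∏ t ∈ ts.toFinset, (C q * X - C (q⁻¹ * t))
  have hP : ∀ w, P.eval w = ∏ t ∈ ts.toFinset, bracket q w t := by
    intro w
    simp [P, eval_prod, bracket]
  have hdeg : P.natDegree ≤ ts.toFinset.card := by
    refine (natDegree_prod_le _ _).trans ?_
    refine (Finset.sum_le_card_nsmul _ _ 1 fun e _ => ?_).trans (by simp)
    compute_degree
  have hc : ts.toFinset.card = ts.length := List.toFinset_card_of_nodup hnd
  rw [list_prod_map_eq_prod_toFinset hnd, ← hP, ← sum_eval_mul_prod_div_eq_eval E P (by omega) Y]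
  unfold omittedSum
  refine Finset.sum_congr rfl fun u _ => ?_
  rw [show downSites [] ++ upSites ts = upSites ts from rfl, residueSum_upSites, hP]
  simp

theorem omittedSum_eq (q : ℂ) (hq : q ≠ 0) (y : ℂ) (zs ts : List ℂ) (E : Finset ℂ) (hy : y ∈ E)
    (hcard : E.card + zs.length = ts.length + 1) (hnd : (zs ++ ts).Nodup)
    (hD : Disjoint E (zs ++ ts).toFinset)
    (hb : ∀ a ∈ E ∪ (zs ++ ts).toFinset, ∀ b ∈ E ∪ (zs ++ ts).toFinset, bracket q a b ≠ 0) :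
    bracketProd q (zs ++ ts) * omittedSum q (E ∪ (zs ++ ts).toFinset) (q ^ 2 * y) E zs ts =
      (-1) ^ zs.length * zs.prod * (zs.map fun z => (∏ m ∈ E, bracket q m z) / (q ^ 2 * y - z)).prod *
        bracketProd q zs * bracketProd q ts * (ts.map (bracket q (q ^ 2 * y))).prod := by
  induction zs generalizing E with
  | nil =>
    rw [omittedSum_nil q _ _ E ts hnd (by simpa using hcard)]
    simp [bracketProd]
  | cons z zs ih =>
    have hz : z ∉ E := fun h => Finset.disjoint_left.1 hD h (by simp)
    have hnd' : z ∉ zs ++ ts ∧ (zs ++ ts).Nodup := List.nodup_cons.1 hnd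
    have hset : E ∪ (z :: zs ++ ts).toFinset = insert z E ∪ (zs ++ ts).toFinset := by
      ext; simp
    have hD' : Disjoint (insert z E) (zs ++ ts).toFinset := by
      rw [Finset.disjoint_insert_left]
      refine ⟨by simpa using hnd'.1, hD.mono_right ?_⟩
      intro; simp; tauto
    rw [hset] at hb ⊢
    have h1 := omittedSum_cons q hq E y z zs ts hy hz hnd hD' hb
    have h2 := ih (insert z E) (by simp [hy]) (by
      rw [Finset.card_insert_of_notMem hz]; simp at hcard; omega) hnd'.2 hD' hb
    have h5 : (zs.map fun z' => (∏ e ∈ insert z E, bracket q e z') / (q ^ 2 * y - z')).prod =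
        (zs.map (bracket q z)).prod *
          (zs.map fun z' => (∏ e ∈ E, bracket q e z') / (q ^ 2 * y - z')).prod := by
      rw [← List.prod_map_mul]
      congr 1
      refine List.map_congr_left fun z' _ => ?_
      rw [Finset.prod_insert hz, mul_div_assoc]
    rw [h5] at h2
    rw [List.cons_append, bracketProd, bracketProd, list_prod_map_eq_prod_toFinset hnd'.2,
      List.map_cons, List.prod_cons, List.prod_cons, List.length_cons, pow_succ (-1 : ℂ)]
    linear_combination bracketProd q (zs ++ ts) * h1 +
      -(z * (∏ m ∈ E, bracket q m z) / (q ^ 2 * y - z)) * h2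

/-- The component with an up arrow at the first site, followed by all the down arrows. -/
theorem residueComponent_up_cons_sorted (q : ℂ) (h3 : q ^ 3 = 1) (zs ts : List ℂ) (y : ℂ)
    (hlen : zs.length = ts.length) (h : IsGeneric q (y :: (zs ++ ts))) :
    residueComponent q ((0, y) :: (downSites zs ++ upSites ts)) =
      zs.prod * bracketProd q zs * bracketProd q (ts ++ [y]) := by
  have hq : q ≠ 0 := by rintro rfl; norm_num at h3
  have hmap : (downSites zs ++ upSites ts).map Prod.snd = zs ++ ts := by
    rw [List.map_append, map_snd_downSites, map_snd_upSites]
  have hnd : y ∉ zs ++ ts ∧ (zs ++ ts).Nodup := List.nodup_cons.1 h.1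
  have hset : {y} ∪ (zs ++ ts).toFinset = (y :: (zs ++ ts)).toFinset := by ext; simp
  have h1 := omittedSum_eq q hq y zs ts {y} (by simp) (by simp; omega) hnd.2
    (by rw [Finset.disjoint_singleton_left, List.mem_toFinset]; exact hnd.1) (by
      intro a ha b hb
      rw [hset, List.mem_toFinset] at ha hb
      exact h.2 a ha b hb)
  rw [hset] at h1
  -- With E = {y} the sum has a single term, and its weight is the one left by an up arrow at y.
  have e1 : omittedWeight q {y} y = fun v => 1 * bracket q v y := by
    funext v; simp [omittedWeight]
  rw [omittedSum, Finset.sum_singleton, e1, Finset.erase_singleton, Finset.prod_empty, mul_one,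
    ← list_prod_map_eq_prod_toFinset hnd.2] at h1
  rw [residueComponent, List.map_cons, hmap, residueSum, if_pos rfl, bracketProd,
    bracketProd_append_singleton]
  have e2 : (zs.map fun z => (∏ m ∈ {y}, bracket q m z) / (q ^ 2 * y - z)) =
      zs.map fun _ => q⁻¹ := by
    refine List.map_congr_left fun z hz => ?_
    have hb := h.2 y (by simp) z (by simp [hz])
    have : bracket q y z = q⁻¹ * (q ^ 2 * y - z) := by unfold bracket; field_simp
    rw [Finset.prod_singleton]
    rw [this] at hb ⊢
    have := right_ne_zero_of_mul hb
    field_simp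
  -- By q³ = 1, [q²y,t] = -q⁻²[t,y]: these are the brackets of y placed after `ts`.
  have e3 : (ts.map (bracket q (q ^ 2 * y))).prod =
      (-q⁻¹ * q⁻¹) ^ ts.length * (ts.map fun t => bracket q t y).prod := by
    rw [← list_prod_map_const_mul]
    congr 1
    refine List.map_congr_left fun t _ => ?_
    have h4 : q * q⁻¹ = 1 := mul_inv_cancel₀ hq
    unfold bracket
    linear_combination y * (1 + q⁻¹ * q⁻¹ * q⁻¹) * h3 + (q⁻¹ * t - y *
      (q ^ 2 * q⁻¹ ^ 2 + q * q⁻¹ + 1)) * h4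
  rw [e2, e3] at h1
  have e4 : (-1 : ℂ) ^ zs.length * q⁻¹ ^ zs.length * (-q⁻¹ * q⁻¹) ^ ts.length = 1 := by
    rw [hlen, ← mul_pow, ← mul_pow]
    have : (-1 : ℂ) * q⁻¹ * (-q⁻¹ * q⁻¹) = 1 := by
      have h5 := inv_mul_inv_of_cube h3
      have h4 : q * q⁻¹ = 1 := mul_inv_cancel₀ hq
      linear_combination q⁻¹ * h5 + h4
    rw [this, one_pow]
  simp only [List.map_const', List.prod_replicate] at h1
  linear_combination h1 + (zs.prod * bracketProd q zs * bracketProd q ts *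
    (ts.map fun t => bracket q t y).prod) * e4

/-! ### Induction over spin configurations and cyclic invariance -/

theorem spin_move_up {Z : List (Fin 2) → Prop}
    (step : ∀ A B, Z (A ++ 1 :: 0 :: B) → Z (A ++ 0 :: 1 :: B)) (A : List (Fin 2)) (m : ℕ)
    (R : List (Fin 2)) (h : Z (A ++ (List.replicate m 1 ++ 0 :: R))) :
    Z (A ++ 0 :: (List.replicate m 1 ++ R)) := by
  induction m generalizing R with
  | zero => simpa using h
  | succ m ih =>
    rw [List.replicate_succ', List.append_assoc]
    refine ih (1 :: R) ?_
    rw [← List.append_assoc]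
    refine step _ _ ?_
    rw [List.replicate_succ'] at h
    simpa using h

/-- Every spin configuration is obtained from the one with all the down arrows to the left by moving
down arrows to the right. -/
theorem spin_induction {Z : List (Fin 2) → Prop}
    (step : ∀ A B, Z (A ++ 1 :: 0 :: B) → Z (A ++ 0 :: 1 :: B)) (A s : List (Fin 2))
    (h : Z (A ++ (List.replicate (s.count 1) 1 ++ List.replicate (s.count 0) 0))) : Z (A ++ s) := by
  induction s generalizing A with
  | nil => simpa using h
  | cons a s ih =>
    obtain rfl | rfl : a = 0 ∨ a = 1 := by omega
    · rw [List.append_cons]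
      refine ih _ ?_
      rw [← List.append_cons]
      refine spin_move_up step _ _ _ ?_
      simpa [List.replicate_succ] using h
    · rw [List.append_cons]
      refine ih _ ?_
      simpa [List.replicate_succ] using h

theorem count_zero_add_count_one (s : List (Fin 2)) : s.count 0 + s.count 1 = s.length := by
  induction s with
  | nil => rfl
  | cons a s ih =>
    obtain rfl | rfl : a = 0 ∨ a = 1 := by omega
    · simp; omega
    · simp; omega

theorem eq_map_of_map_fst_eq_replicate (L : List (Fin 2 × ℂ)) (m : ℕ) (s : Fin 2)
    (h : L.map Prod.fst = List.replicate m s) : L = (L.map Prod.snd).map fun z => (s, z) := by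
  have : ∀ p ∈ L, p.1 = s := fun p hp =>
    List.eq_of_mem_replicate (h ▸ List.mem_map_of_mem (f := Prod.fst) hp)
  rw [List.map_map]
  conv_lhs => rw [← List.map_id L]
  refine List.map_congr_left fun p hp => ?_
  simp [← this p hp]

theorem exists_sites_of_map_fst (L : List (Fin 2 × ℂ)) (m k : ℕ)
    (h : L.map Prod.fst = List.replicate m 1 ++ List.replicate k 0) :
    ∃ zs ts : List ℂ, zs.length = m ∧ ts.length = k ∧ L = downSites zs ++ upSites ts := by
  obtain ⟨L₁, L₂, rfl, h₁, h₂⟩ := List.map_eq_append_iff.1 h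
  refine ⟨L₁.map Prod.snd, L₂.map Prod.snd, ?_, ?_, ?_⟩
  · rw [List.length_map, ← List.length_map (f := Prod.fst), h₁, List.length_replicate]
  · rw [List.length_map, ← List.length_map (f := Prod.fst), h₂, List.length_replicate]
  · conv_lhs => rw [eq_map_of_map_fst_eq_replicate L₁ _ _ h₁,
      eq_map_of_map_fst_eq_replicate L₂ _ _ h₂]
    rfl

theorem exists_of_map_fst_eq_append (L : List (Fin 2 × ℂ)) (A B : List (Fin 2)) (s t : Fin 2)
    (h : L.map Prod.fst = A ++ s :: t :: B) :
    ∃ A' z y B', L = A' ++ (s, z) :: (t, y) :: B' ∧ A'.map Prod.fst = A ∧ B'.map Prod.fst = B := by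
  obtain ⟨L₁, L₂, rfl, h₁, h₂⟩ := List.map_eq_append_iff.1 h
  obtain ⟨p, L₃, rfl, h₃, h₄⟩ := List.map_eq_cons_iff.1 h₂
  obtain ⟨r, L₄, rfl, h₅, h₆⟩ := List.map_eq_cons_iff.1 h₄
  exact ⟨L₁, p.2, r.2, L₄, by rw [← h₃, ← h₅], h₁, h₆⟩

theorem map_fst_downSites (zs : List ℂ) : (downSites zs).map Prod.fst = List.replicate zs.length 1 := by
  simp [downSites, Function.comp_def]

theorem map_fst_upSites (zs : List ℂ) : (upSites zs).map Prod.fst = List.replicate zs.length 0 := by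
  simp [upSites, Function.comp_def]

/-- Cyclic invariance of the solution. -/
theorem chainComponent_rotate (q : ℂ) (h3 : q ^ 3 = 1) (p : Fin 2 × ℂ) (L : List (Fin 2 × ℂ))
    (h : IsGeneric q ((p :: L).map Prod.snd)) :
    chainComponent q (p :: L) = chainComponent q (L ++ [p]) := by
  obtain ⟨s, y⟩ := p
  -- The inhomogeneities must be quantified inside the motive, because the exchange relation
  -- permutes them.
  let Z : List (Fin 2) → Prop := fun σ => ∀ L : List (Fin 2 × ℂ), L.map Prod.fst = σ →
    IsGeneric q (y :: L.map Prod.snd) → chainComponent q ((s, y) :: L) = chainComponent q (L ++ [(s, y)])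
  suffices hZ : Z ([] ++ L.map Prod.fst) from hZ L rfl (by simpa using h)
  refine spin_induction ?_ [] _ ?_
  · intro A B hAB L hL hg
    obtain ⟨A', z, y', B', rfl, hA, hB⟩ := exists_of_map_fst_eq_append L A B 0 1 hL
    have hgen : ∀ a ∈ [z, y'], ∀ b ∈ [z, y'], bracket q a b ≠ 0 := by
      intro a ha b hb
      refine hg.2 a ?_ b ?_
      · simp at ha ⊢; tauto
      · simp at hb ⊢; tauto
    have hne : y' - z ≠ 0 := by
      refine sub_ne_zero.2 fun h => ?_
      subst h
      have := hg.1
      simp [List.nodup_cons, List.nodup_append] at this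
    have h1 := hAB (A' ++ (1, y') :: (0, z) :: B') (by simp [hA, hB]) (hg.perm (by
      simp only [List.map_append, List.map_cons]
      exact (List.Perm.append_left _ (List.Perm.swap _ _ _)).cons _))
    have h2 := hAB (A' ++ (1, z) :: (0, y') :: B') (by simp [hA, hB]) (hg.perm (by
      simp only [List.map_append, List.map_cons]
      exact List.Perm.refl _))
    -- The same exchange relation is written with the rotated site in front and at the back. Both
    -- other chains in it have the down arrow one step further left, so the induction hypothesis
    -- applies to them.
    have e1 := chainComponent_exchange_down_up q z y' ((s, y) :: A') B'
      (hgen y' (by simp) z (by simp))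
    have e2 := chainComponent_exchange_down_up q z y' A' (B' ++ [(s, y)])
      (hgen y' (by simp) z (by simp))
    simp only [List.append_assoc, List.cons_append] at h1 h2 e1 e2 ⊢
    apply mul_left_cancel₀ hne
    linear_combination e1 - e2 - (q - q⁻¹) * y' * h2 + bracket q z y' * h1
  · intro L' hL' hg
    rw [List.nil_append] at hL'
    obtain ⟨zs, ts, hz, ht, rfl⟩ := exists_sites_of_map_fst L' _ _ hL'
    have hcount : (((s, y) :: (downSites zs ++ upSites ts)).map Prod.fst).count 1 =
        ((downSites zs ++ upSites ts ++ [(s, y)]).map Prod.fst).count 1 :=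
      ((List.perm_append_singleton _ _).map _).count_eq _ |>.symm
    unfold chainComponent
    rw [← hcount]
    simp only [List.length_append, List.length_cons, List.length_nil, zero_add]
    split_ifs with hsec
    · have hmap : (downSites zs ++ upSites ts).map Prod.snd = zs ++ ts := by
        rw [List.map_append, map_snd_downSites, map_snd_upSites]
      rw [hmap] at hg
      have hl1 : (downSites zs).length = zs.length := by simp [downSites]
      have hl2 : (upSites ts).length = ts.length := by simp [upSites]
      -- In the base case the other down arrows stand on the left. A rotated up arrow compares the
      -- component with a leading up arrow to a sorted one, and a rotated down arrow compares a
      -- sorted one to the component with a final down arrow.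
      obtain rfl | rfl : s = 0 ∨ s = 1 := by omega
      · have hlen : zs.length = ts.length := by
          simp [map_fst_downSites, map_fst_upSites, hl1, hl2, List.count_replicate] at hsec
          omega
        rw [residueComponent_up_cons_sorted q h3 zs ts y hlen hg]
        have := residueComponent_sorted q zs (ts ++ [y]) (hg.perm (by
          rw [← List.append_assoc]; exact (List.perm_append_singleton _ _).symm))
        rw [← this]
        congr 1
        simp [upSites]
      · have hlen : ts.length = zs.length + 2 := by
          simp [map_fst_downSites, map_fst_upSites, hl1, hl2, List.count_replicate] at hsec
          omega
        rw [List.append_assoc, residueComponent_sorted_concat_down q h3 zs ts y hlen (hg.perm (by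
          rw [← List.append_assoc]; exact (List.perm_append_singleton _ _).symm))]
        have := residueComponent_sorted q (y :: zs) ts hg
        rw [show (1, y) :: (downSites zs ++ upSites ts) = downSites (y :: zs) ++ upSites ts from rfl,
          this, List.prod_cons]
        ring
    · rfl

/-! ### The transfer matrix acting on functions of chains -/

/-- The monodromy matrix, with the states `α` and `β` of the horizontal boundary edges, applied to
the function `G` of chains and evaluated at the chain `L`. -/
noncomputable def monodromyApply (q x : ℂ) :
    Fin 2 → Fin 2 → List (Fin 2 × ℂ) → (List (Fin 2 × ℂ) → ℂ) → ℂ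
  | α, β, [], G => if α = β then G [] else 0
  | α, β, (m, z) :: L, G => ∑ γ, ∑ ν, sixVertexR q (x / z) (α, m) (γ, ν) *
      monodromyApply q x γ β L (fun L' => G ((ν, z) :: L'))

/-- The transfer matrix applied to the function `G` of chains and evaluated at the chain `L`. -/
noncomputable def transferApply (q x : ℂ) (L : List (Fin 2 × ℂ)) (G : List (Fin 2 × ℂ) → ℂ) : ℂ :=
  ∑ α, monodromyApply q x α α L G

theorem monodromyApply_congr (q x : ℂ) (α β : Fin 2) (L : List (Fin 2 × ℂ))
    {G G' : List (Fin 2 × ℂ) → ℂ}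
    (h : ∀ L', L'.map Prod.snd = L.map Prod.snd → G L' = G' L') :
    monodromyApply q x α β L G = monodromyApply q x α β L G' := by
  induction L generalizing α G G' with
  | nil => simp only [monodromyApply]; rw [h [] rfl]
  | cons p L ih =>
    obtain ⟨m, z⟩ := p
    simp only [monodromyApply]
    refine Finset.sum_congr rfl fun γ _ => Finset.sum_congr rfl fun ν _ => ?_
    rw [ih γ fun L' hL' => h _ (by simp [hL'])]

theorem monodromyApply_sum {ι : Type*} (s : Finset ι) (c : ι → ℂ) (q x : ℂ) (α β : Fin 2)
    (L : List (Fin 2 × ℂ)) (G : ι → List (Fin 2 × ℂ) → ℂ) :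
    monodromyApply q x α β L (fun L' => ∑ i ∈ s, c i * G i L') =
      ∑ i ∈ s, c i * monodromyApply q x α β L (G i) := by
  induction L generalizing α G with
  | nil => simp only [monodromyApply]; split_ifs <;> simp
  | cons p L ih =>
    obtain ⟨m, z⟩ := p
    simp only [monodromyApply]
    simp_rw [ih, Finset.mul_sum]
    calc _ = ∑ γ, ∑ i ∈ s, ∑ ν, sixVertexR q (x / z) (α, m) (γ, ν) *
          (c i * monodromyApply q x γ β L fun L' => G i ((ν, z) :: L')) :=
        Finset.sum_congr rfl fun γ _ => Finset.sum_comm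
      _ = _ := by
        rw [Finset.sum_comm]
        refine Finset.sum_congr rfl fun i _ => Finset.sum_congr rfl fun γ _ =>
          Finset.sum_congr rfl fun ν _ => ?_
        ring

theorem monodromyApply_append (q x : ℂ) (α β : Fin 2) (L₁ L₂ : List (Fin 2 × ℂ))
    (G : List (Fin 2 × ℂ) → ℂ) :
    monodromyApply q x α β (L₁ ++ L₂) G = ∑ γ, monodromyApply q x α γ L₁ fun L₁' =>
      monodromyApply q x γ β L₂ fun L₂' => G (L₁' ++ L₂') := by
  induction L₁ generalizing α G with
  | nil => simp [monodromyApply]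
  | cons p L ih =>
    obtain ⟨m, z⟩ := p
    simp only [List.cons_append, monodromyApply]
    simp_rw [ih, Finset.mul_sum]
    calc _ = ∑ γ, ∑ i, ∑ ν, sixVertexR q (x / z) (α, m) (γ, ν) *
          (monodromyApply q x γ i L fun L₁' => monodromyApply q x i β L₂ fun L₂' =>
            G ((ν, z) :: (L₁' ++ L₂'))) :=
        Finset.sum_congr rfl fun γ _ => Finset.sum_comm
      _ = _ := Finset.sum_comm

/-- Cyclicity of the trace. -/
theorem transferApply_rotate (q x : ℂ) (p : Fin 2 × ℂ) (L : List (Fin 2 × ℂ))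
    (G : List (Fin 2 × ℂ) → ℂ)
    (hG : ∀ r L', (r :: L').map Prod.snd = (p :: L).map Prod.snd → G (r :: L') = G (L' ++ [r])) :
    transferApply q x (p :: L) G = transferApply q x (L ++ [p]) G := by
  obtain ⟨m, z⟩ := p
  unfold transferApply
  have key : ∀ α γ, monodromyApply q x α γ L (fun L' => monodromyApply q x γ α [(m, z)]
      fun L₂ => G (L' ++ L₂)) = ∑ ν, sixVertexR q (x / z) (γ, m) (α, ν) *
        monodromyApply q x α γ L fun L' => G ((ν, z) :: L') := by
    intro α γ
    rw [← monodromyApply_sum]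
    refine monodromyApply_congr _ _ _ _ _ fun L' hL' => ?_
    simp only [monodromyApply, mul_ite, mul_zero]
    rw [Finset.sum_eq_single α]
    · simp only [if_true]
      exact Finset.sum_congr rfl fun ν _ => by rw [hG (ν, z) L' (by simp [hL'])]
    · intro b _ hb; simp [hb]
    · simp
  simp only [monodromyApply_append, key]
  simp only [monodromyApply]
  rw [Finset.sum_comm]

/-- With the spectral parameter equal to y, the auxiliary line behaves like a site of inhomogeneity
y. Each R-matrix is one exchange relation, and together they carry that site through `L`. -/
theorem monodromyApply_chainComponent (q : ℂ) (hq : q ≠ 0) (y : ℂ) (A : List (Fin 2 × ℂ))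
    (α : Fin 2) (L : List (Fin 2 × ℂ)) (h : IsGeneric q (y :: L.map Prod.snd)) :
    ∑ β, monodromyApply q y α β L (fun L' => chainComponent q (A ++ (L' ++ [(β, y)]))) =
      chainComponent q (A ++ (α, y) :: L) := by
  induction L generalizing A α with
  | nil => simp [monodromyApply]
  | cons p L ih =>
    obtain ⟨m, z⟩ := p
    simp only [monodromyApply]
    have hb : ∀ a ∈ [y, z], ∀ b ∈ [y, z], bracket q a b ≠ 0 := fun a ha b hb =>
      h.2 a (by simp at ha ⊢; tauto) b (by simp at hb ⊢; tauto)
    have hz : z ≠ 0 := by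
      rintro rfl
      exact hb 0 (by simp) 0 (by simp) (by simp [bracket])
    rw [← chainComponent_exchange q hq z y A L hz (hb y (by simp) z (by simp))
      (hb z (by simp) y (by simp))]
    rw [Finset.sum_comm]
    refine Finset.sum_congr rfl fun γ _ => ?_
    rw [Finset.sum_comm]
    refine Finset.sum_congr rfl fun ν _ => ?_
    rw [← Finset.mul_sum]
    have := ih (A ++ [(ν, z)]) γ ⟨(List.nodup_cons.1 (h.1.perm (List.Perm.swap _ _ _))).2,
      fun u hu v hv => h.2 u (by simp at hu ⊢; tauto) v (by simp at hv ⊢; tauto)⟩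
    simp only [List.append_assoc, List.cons_append, List.nil_append] at this
    rw [← this]
    simp only [List.cons_append]

theorem sixVertexR_one (q : ℂ) (hq : q - q⁻¹ ≠ 0) (s t : Fin 2 × Fin 2) :
    sixVertexR q 1 s t = if t = (s.2, s.1) then 1 else 0 := by
  have ha : weightA q 1 = 1 := by simp [weightA, div_self hq]
  have hb : weightB q 1 = 0 := by simp [weightB]
  have hc : weightC q 1 = 1 := by simp [weightC, div_self hq]
  have hc' : weightC' q 1 = 1 := by simp [weightC', div_self hq]
  obtain ⟨a, b⟩ := s
  obtain ⟨c, d⟩ := t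
  fin_cases a <;> fin_cases b <;> fin_cases c <;> fin_cases d <;>
    simp [sixVertexR, ha, hb, hc, hc']

/-- The transfer matrix at the first spectral parameter fixes the solution. -/
theorem transferApply_head (q : ℂ) (h3 : q ^ 3 = 1) (y : ℂ) (m : Fin 2) (L : List (Fin 2 × ℂ))
    (h : IsGeneric q (y :: L.map Prod.snd)) :
    transferApply q y ((m, y) :: L) (chainComponent q) = chainComponent q ((m, y) :: L) := by
  have hq : q ≠ 0 := by rintro rfl; norm_num at h3
  have hy : (q - q⁻¹) * y ≠ 0 := by rw [← bracket_self]; exact h.2 y (by simp) y (by simp)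
  have hd := left_ne_zero_of_mul hy
  have hy0 := right_ne_zero_of_mul hy
  unfold transferApply
  simp only [monodromyApply, div_self hy0, sixVertexR_one q hd, Prod.mk.injEq, ite_mul, one_mul,
    zero_mul]
  have : ∀ α : Fin 2, (∑ γ, ∑ ν, if γ = m ∧ ν = α then monodromyApply q y γ α L
      (fun L' => chainComponent q ((ν, y) :: L')) else 0) =
      monodromyApply q y m α L (fun L' => chainComponent q ([] ++ (L' ++ [(α, y)]))) := by
    intro α
    rw [Finset.sum_eq_single m, Finset.sum_eq_single α]
    · simp only [and_self, if_true]
      refine monodromyApply_congr _ _ _ _ _ fun L' hL' => ?_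
      -- Cyclicity puts the site y at the right end, where the exchanges through `L` take it back to
      -- the front.
      exact chainComponent_rotate q h3 _ _ (by simpa [hL'] using h)
    · intro b _ hb; simp [hb]
    · simp
    · intro b _ hb; simp [hb]
    · simp
  simp_rw [this]
  exact monodromyApply_chainComponent q hq y [] m L h

-- Multiplying by [z,x] clears the denominator of R(x/z) and leaves entries of degree at most one in
-- x, so each site adds at most one to the degree.
open Polynomial in
theorem monodromyApply_eq_eval (q : ℂ) (α β : Fin 2) (L : List (Fin 2 × ℂ))
    (hL : ∀ p ∈ L, p.2 ≠ 0) (G : List (Fin 2 × ℂ) → ℂ) :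
    ∃ P : ℂ[X], P.natDegree ≤ L.length ∧ ∀ x, (∀ p ∈ L, bracket q p.2 x ≠ 0) →
      P.eval x = (L.map fun p => bracket q p.2 x).prod * monodromyApply q x α β L G := by
  induction L generalizing α G with
  | nil => exact ⟨C (if α = β then G [] else 0), by simp, fun x _ => by simp [monodromyApply]⟩
  | cons p L ih =>
    obtain ⟨m, z⟩ := p
    have hz : z ≠ 0 := hL (m, z) (by simp)
    choose P hP hPe using fun (γ ν : Fin 2) =>
      ih γ (fun p hp => hL p (List.mem_cons_of_mem _ hp)) (fun L' => G ((ν, z) :: L'))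
    have hR : ∀ s t, ∃ Q : ℂ[X], Q.natDegree ≤ 1 ∧ ∀ x, bracket q z x ≠ 0 →
        Q.eval x = bracket q z x * sixVertexR q (x / z) s t := by
      intro s t
      have hd : ∀ x, q - q⁻¹ * (x / z) = bracket q z x / z := by
        intro x; unfold bracket; field_simp
      unfold sixVertexR weightA weightB weightC weightC'
      simp only [hd]
      split_ifs
      · refine ⟨C q * X - C (q⁻¹ * z), by compute_degree, fun x hx => ?_⟩
        simp only [eval_sub, eval_mul, eval_C, eval_X]
        field_simp
      · refine ⟨X - C z, by compute_degree, fun x hx => ?_⟩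
        simp only [eval_sub, eval_C, eval_X]
        field_simp
      · refine ⟨C (q - q⁻¹) * X, by compute_degree, fun x hx => ?_⟩
        simp only [eval_mul, eval_C, eval_X]
        field_simp
      · refine ⟨C ((q - q⁻¹) * z), by rw [natDegree_C]; exact zero_le_one, fun x hx => ?_⟩
        simp only [eval_C]
        field_simp
      · exact ⟨0, by simp, fun x hx => by simp⟩
    choose Q hQ hQe using hR
    refine ⟨∑ γ, ∑ ν, Q (α, m) (γ, ν) * P γ ν, ?_, ?_⟩
    · refine natDegree_sum_le_of_forall_le _ _ fun γ _ => natDegree_sum_le_of_forall_le _ _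
        fun ν _ => natDegree_mul_le.trans ?_
      have h1 := hQ (α, m) (γ, ν)
      have h2 := hP γ ν
      simp; omega
    · intro x hx
      simp only [eval_finsetSum, eval_mul, monodromyApply, List.map_cons, List.prod_cons,
        Finset.mul_sum]
      refine Finset.sum_congr rfl fun γ _ => Finset.sum_congr rfl fun ν _ => ?_
      rw [hQe _ _ _ (hx (m, z) (by simp)), hPe _ _ _ fun p hp => hx p (by simp [hp])]
      ring

theorem sixVertexR_zero (q : ℂ) (α m γ ν : Fin 2) :
    sixVertexR q 0 (α, m) (γ, ν) = if α = γ ∧ m = ν then (if α = m then -q⁻¹ * q⁻¹ else -q⁻¹)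
      else if α = 0 ∧ m = 1 ∧ γ = 1 ∧ ν = 0 then (q - q⁻¹) * q⁻¹ else 0 := by
  have ha : weightA q 0 = -q⁻¹ * q⁻¹ := by simp [weightA, div_eq_mul_inv]
  have hb : weightB q 0 = -q⁻¹ := by simp [weightB, neg_div]
  have hc : weightC q 0 = 0 := by simp [weightC]
  have hc' : weightC' q 0 = (q - q⁻¹) * q⁻¹ := by simp [weightC', div_eq_mul_inv]
  fin_cases α <;> fin_cases m <;> fin_cases γ <;> fin_cases ν <;>
    simp [sixVertexR, ha, hb, hc, hc']

/-- Since c(0) = 0, along the chain the auxiliary state can pass from ↑ to ↓ but never back. A path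
with equal ends is therefore constant, and the diagonal entries are scalars depending only on the
numbers of arrows. -/
theorem monodromyApply_zero (q : ℂ) (L : List (Fin 2 × ℂ))
    (G : List (Fin 2 × ℂ) → ℂ) :
    monodromyApply q 0 1 0 L G = 0 ∧ ∀ α, monodromyApply q 0 α α L G =
      (-q⁻¹) ^ L.length * q⁻¹ ^ (L.map Prod.fst).count α * G L := by
  induction L generalizing G with
  | nil => simp [monodromyApply]
  | cons p L ih =>
    obtain ⟨m, z⟩ := p
    simp only [monodromyApply, zero_div, Fin.sum_univ_two, sixVertexR_zero q]
    refine ⟨?_, fun α => ?_⟩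
    · obtain rfl | rfl : m = 0 ∨ m = 1 := by omega
      · simp [(ih _).1]
      · simp [(ih _).1]
    · obtain rfl | rfl : α = 0 ∨ α = 1 := by omega
      all_goals
        obtain rfl | rfl : m = 0 ∨ m = 1 := by omega
      all_goals
        simp [(ih _).1, (ih _).2, pow_succ]
        try ring

/-- In the sector with n down and n+1 up arrows the trace is (-q⁻¹)^(2n+1)(q^(-n-1) + q^(-n)) =
-(q⁻² + q⁻¹) = 1. Outside it the component is zero. -/
theorem transferApply_zero (q : ℂ) (h3 : q ^ 3 = 1) (hs : 1 + q + q ^ 2 = 0)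
    (L : List (Fin 2 × ℂ)) :
    transferApply q 0 L (chainComponent q) = chainComponent q L := by
  have hq : q ≠ 0 := by rintro rfl; norm_num at h3
  unfold transferApply
  simp only [(monodromyApply_zero q L _).2, Fin.sum_univ_two]
  by_cases hsec : 2 * (L.map Prod.fst).count 1 + 1 = L.length
  · have h0 := count_zero_add_count_one (L.map Prod.fst)
    rw [List.length_map] at h0
    rw [← hsec, show (L.map Prod.fst).count 0 = (L.map Prod.fst).count 1 + 1 by omega]
    generalize (L.map Prod.fst).count 1 = n
    have e : (-q⁻¹) ^ (2 * n + 1) * q⁻¹ ^ (n + 1) + (-q⁻¹) ^ (2 * n + 1) * q⁻¹ ^ n = 1 := by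
      have h3' : q⁻¹ ^ 3 = 1 := by rw [inv_pow, h3, inv_one]
      have : (-q⁻¹) ^ (2 * n + 1) * q⁻¹ ^ n = -q⁻¹ := by
        rw [pow_succ, pow_mul, neg_sq]
        have h4 : (q⁻¹ ^ 2) ^ n * q⁻¹ ^ n = 1 := by
          rw [← mul_pow, ← pow_succ, h3', one_pow]
        linear_combination -q⁻¹ * h4
      rw [pow_succ q⁻¹ n, ← mul_assoc, this]
      have h5 : q⁻¹ = q ^ 2 := by field_simp; exact h3.symm
      rw [h5]
      linear_combination -q * h3 - hs
    linear_combination chainComponent q L * e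
  · simp [chainComponent, hsec]

/-- Rotating a chain to bring a given site to the front. -/
theorem transferApply_append (q : ℂ) (h3 : q ^ 3 = 1) (x : ℂ) (A B : List (Fin 2 × ℂ))
    (h : IsGeneric q ((A ++ B).map Prod.snd)) :
    transferApply q x (A ++ B) (chainComponent q) = transferApply q x (B ++ A) (chainComponent q) ∧
      chainComponent q (A ++ B) = chainComponent q (B ++ A) := by
  induction A generalizing B with
  | nil => simp
  | cons p A ih =>
    have h' : IsGeneric q ((A ++ (B ++ [p])).map Prod.snd) := h.perm (by
      refine List.Perm.map _ ?_
      rw [← List.append_assoc]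
      exact (List.perm_append_singleton _ _).symm)
    have h1 := ih (B ++ [p]) h'
    have h2 := transferApply_rotate q x p (A ++ B) (chainComponent q) fun r L' hr =>
      chainComponent_rotate q h3 r L' (by rw [hr]; exact h)
    have h3 := chainComponent_rotate q h3 p (A ++ B) h
    simp only [List.append_assoc, List.cons_append, List.nil_append] at h1 h2 h3 ⊢
    exact ⟨h2.trans h1.1, h3.trans h1.2⟩

open Polynomial in
/-- The solution is fixed by the transfer matrix, for generic inhomogeneities. -/
theorem transferApply_chainComponent (q : ℂ) (h3 : q ^ 3 = 1) (hs : 1 + q + q ^ 2 = 0)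
    (L : List (Fin 2 × ℂ)) (h : IsGeneric q (L.map Prod.snd)) (x : ℂ)
    (hx : ∀ p ∈ L, bracket q p.2 x ≠ 0) :
    transferApply q x L (chainComponent q) = chainComponent q L := by
  have h0 : ∀ p ∈ L, p.2 ≠ 0 := by
    intro p hp hp0
    have hm := List.mem_map_of_mem (f := Prod.snd) hp
    exact h.2 _ hm _ hm (by simp [hp0, bracket])
  choose P hP hPe using fun α => monodromyApply_eq_eval q α α L h0 (chainComponent q)
  have hD : ∀ x, ((L.map fun p => C (q * p.2) - C q⁻¹ * X).prod : ℂ[X]).eval x =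
      (L.map fun p => bracket q p.2 x).prod := by
    intro x
    rw [eval_list_prod, List.map_map]
    congr 1
    refine List.map_congr_left fun p _ => ?_
    simp [bracket]
  have hDd : ((L.map fun p => C (q * p.2) - C q⁻¹ * X).prod : ℂ[X]).natDegree ≤ L.length := by
    refine (natDegree_list_prod_le _).trans ?_
    refine (List.sum_le_card_nsmul _ 1 ?_).trans (by simp)
    intro n hn
    simp only [List.map_map, List.mem_map, Function.comp] at hn
    obtain ⟨p, _, rfl⟩ := hn
    compute_degree
  set D : ℂ[X] := (L.map fun p => C (q * p.2) - C q⁻¹ * X).prod with hDdef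
  -- F is (T(x)Ψ - Ψ) ∏ [z_i,x]. Its degree is at most N and it vanishes at the N+1 points 0, z_1,
  -- …, z_N, which are distinct because [z_i,z_i] ≠ 0 forces z_i ≠ 0.
  let F : ℂ[X] := ∑ α, P α - C (chainComponent q L) * D
  have hF : ∀ x, (∀ p ∈ L, bracket q p.2 x ≠ 0) → F.eval x = (L.map fun p => bracket q p.2 x).prod *
      (transferApply q x L (chainComponent q) - chainComponent q L) := by
    intro x hx
    simp only [F, eval_sub, eval_finsetSum, eval_mul, eval_C, hD, hPe _ x hx, transferApply,
      ← Finset.mul_sum]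
    ring
  have hroot : ∀ x, (∀ p ∈ L, bracket q p.2 x ≠ 0) →
      transferApply q x L (chainComponent q) = chainComponent q L → F.eval x = 0 := by
    intro x hx he
    rw [hF x hx, he, sub_self, mul_zero]
  have hq : q ≠ 0 := by rintro rfl; norm_num at h3
  have hFzero : F = 0 := by
    refine eq_zero_of_natDegree_lt_card_of_eval_eq_zero' F
      (insert 0 (L.map Prod.snd).toFinset) ?_ ?_
    · intro x hx'
      rw [Finset.mem_insert, List.mem_toFinset] at hx'
      rcases hx' with rfl | hx'
      · refine hroot 0 (fun p hp => ?_) (transferApply_zero q h3 hs L)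
        simpa [bracket, hq] using h0 p hp
      · refine hroot x (fun p hp => h.2 _ (List.mem_map_of_mem (f := Prod.snd) hp) _ hx') ?_
        obtain ⟨p, hp, rfl⟩ := List.mem_map.1 hx'
        obtain ⟨A, B, rfl⟩ := List.append_of_mem hp
        -- Cyclicity brings the site with z_i = x to the front, where `transferApply_head` applies.
        have h4 := transferApply_append q h3 p.2 A (p :: B) h
        rw [h4.1, h4.2]
        have hg : IsGeneric q ((p :: B ++ A).map Prod.snd) := h.perm (by
          exact (List.perm_append_comm).map _)
        exact transferApply_head q h3 p.2 p.1 (B ++ A) hg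
    · rw [Finset.card_insert_of_notMem, List.toFinset_card_of_nodup h.1, List.length_map]
      · refine Nat.lt_succ_of_le ((natDegree_sub_le _ _).trans (max_le ?_ ?_))
        · exact natDegree_sum_le_of_forall_le _ _ fun α _ => hP α
        · exact (natDegree_C_mul_le _ _).trans hDd
      · rw [List.mem_toFinset]
        intro h'
        obtain ⟨p, hp, hp0⟩ := List.mem_map.1 h'
        exact h0 p hp hp0
  have hfin := hF x hx
  rw [hFzero, eval_zero] at hfin
  have hne : (L.map fun p => bracket q p.2 x).prod ≠ 0 := by
    refine List.prod_ne_zero fun h' => ?_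
    obtain ⟨p, hp, hp0⟩ := List.mem_map.1 h'
    exact hx p hp hp0
  exact sub_eq_zero.1 ((mul_eq_zero.1 hfin.symm).resolve_left hne)

/-! ### From the transfer matrix to chains -/

/-- The matrix in the auxiliary space which a site with states `m` and `n` of its vertical edges
contributes. -/
def auxiliaryMatrix (R : Matrix (Fin 2 × Fin 2) (Fin 2 × Fin 2) ℂ) (m n : Fin 2) :
    Matrix (Fin 2) (Fin 2) ℂ := fun α γ => R (α, m) (γ, n)

theorem sum_fin_cons {N : ℕ} (f : (Fin (N + 1) → Fin 2) → ℂ) :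
    ∑ κ, f κ = ∑ γ, ∑ κ' : Fin N → Fin 2, f (Fin.cons γ κ') := by
  rw [← Fintype.sum_prod_type']
  exact (Fintype.sum_equiv (Fin.consEquiv fun _ => Fin 2) _ _ fun _ => rfl).symm

theorem twoSiteOp_cons {N : ℕ} (i : Fin N) (R : Matrix (Fin 2 × Fin 2) (Fin 2 × Fin 2) ℂ)
    (α γ : Fin 2) (μ κ : Fin N → Fin 2) :
    twoSiteOp (0 : Fin (N + 1)) i.succ R (Fin.cons α μ) (Fin.cons γ κ) =
      if ∀ j, j ≠ i → μ j = κ j then R (α, μ i) (γ, κ i) else 0 := by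
  unfold twoSiteOp
  simp [Fin.forall_fin_succ]

/-- Each site is touched by one factor only, so the intermediate spin configuration is forced at
every step and only the auxiliary index is summed. What remains is a product of 2×2 matrices. -/
theorem prod_twoSiteOp_apply {N : ℕ} (R : Fin N → Matrix (Fin 2 × Fin 2) (Fin 2 × Fin 2) ℂ)
    (l : List (Fin N)) (hl : l.Nodup) (α β : Fin 2) (μ ν : Fin N → Fin 2) :
    (l.map fun i => twoSiteOp (0 : Fin (N + 1)) i.succ (R i)).prod (Fin.cons α μ) (Fin.cons β ν) =
      if ∀ j, j ∉ l → μ j = ν j then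
        (l.map fun i => auxiliaryMatrix (R i) (μ i) (ν i)).prod α β else 0 := by
  induction l generalizing α μ with
  | nil =>
    have h : (∀ j, j ∉ ([] : List (Fin N)) → μ j = ν j) ↔ μ = ν := by simp [funext_iff]
    simp only [List.map_nil, List.prod_nil, Matrix.one_apply, Fin.cons_inj, h]
    by_cases h1 : α = β <;> by_cases h2 : μ = ν <;> simp [h1, h2]
  | cons i l ih =>
    obtain ⟨hi, hl⟩ := List.nodup_cons.1 hl
    rw [List.map_cons, List.prod_cons, Matrix.mul_apply, sum_fin_cons]
    simp only [twoSiteOp_cons, ih hl, List.map_cons, List.prod_cons, Matrix.mul_apply]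
    have key : ∀ γ, (∑ κ : Fin N → Fin 2, (if ∀ j, j ≠ i → μ j = κ j then R i (α, μ i) (γ, κ i) else 0) *
        if ∀ j, j ∉ l → κ j = ν j then
          (l.map fun i => auxiliaryMatrix (R i) (κ i) (ν i)).prod γ β else 0) =
        if ∀ j, j ∉ i :: l → μ j = ν j then auxiliaryMatrix (R i) (μ i) (ν i) α γ *
          (l.map fun i => auxiliaryMatrix (R i) (μ i) (ν i)).prod γ β else 0 := by
      intro γ
      rw [Finset.sum_eq_single (Function.update μ i (ν i))]
      · have h1 : ∀ j, j ≠ i → μ j = Function.update μ i (ν i) j := fun j hj => by simp [hj]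
        have h2 : (∀ j, j ∉ l → Function.update μ i (ν i) j = ν j) ↔
            ∀ j, j ∉ i :: l → μ j = ν j := by
          constructor
          · intro h j hj
            rw [List.mem_cons, not_or] at hj
            rw [h1 j hj.1, h j hj.2]
          · intro h j hj
            by_cases hji : j = i
            · subst hji; simp
            · rw [← h1 j hji, h j (by simp [hji, hj])]
        have h3 : (l.map fun i_1 => auxiliaryMatrix (R i_1) (Function.update μ i (ν i) i_1) (ν i_1)) =
            l.map fun i => auxiliaryMatrix (R i) (μ i) (ν i) := by
          refine List.map_congr_left fun j hj => ?_
          rw [← h1 j (fun h => hi (h ▸ hj))]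
        rw [if_pos h1, h3]
        simp only [h2, Function.update_self, mul_ite, mul_zero]
        rfl
      · intro κ _ hκ
        by_contra hne
        have h1 : ∀ j, j ≠ i → μ j = κ j := by
          by_contra h; exact hne (by rw [if_neg h, zero_mul])
        have h2 : ∀ j, j ∉ l → κ j = ν j := by
          by_contra h; exact hne (by rw [if_neg h, mul_zero])
        refine hκ (funext fun j => ?_)
        by_cases hji : j = i
        · subst hji; simp [h2 j hi]
        · simp [hji, h1 j hji]
      · simp
    rw [Finset.sum_congr rfl fun γ _ => key γ]
    split_ifs <;> simp

theorem transferMatrix_apply {N : ℕ} (q x : ℂ) (z : Fin N → ℂ) (μ ν : Fin N → Fin 2) :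
    transferMatrix q x z μ ν = ∑ α, (List.ofFn fun i =>
      auxiliaryMatrix (sixVertexR q (x / z i)) (μ i) (ν i)).prod α α := by
  unfold transferMatrix partialTrace
  refine Finset.sum_congr rfl fun α _ => ?_
  rw [List.ofFn_eq_map, List.ofFn_eq_map,
    prod_twoSiteOp_apply (fun i => sixVertexR q (x / z i)) _ (List.nodup_finRange N)]
  simp

/-- The sites of a chain with spins `μ` and inhomogeneities `z`. -/
def chainSites {N : ℕ} (μ : Fin N → Fin 2) (z : Fin N → ℂ) : List (Fin 2 × ℂ) :=
  List.ofFn fun i => (μ i, z i)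

theorem map_snd_chainSites {N : ℕ} (μ : Fin N → Fin 2) (z : Fin N → ℂ) :
    (chainSites μ z).map Prod.snd = List.ofFn z := by
  simp [chainSites, List.map_ofFn, Function.comp_def]

theorem map_fst_chainSites {N : ℕ} (μ : Fin N → Fin 2) (z : Fin N → ℂ) :
    (chainSites μ z).map Prod.fst = List.ofFn μ := by
  simp [chainSites, List.map_ofFn, Function.comp_def]

theorem sum_prod_auxiliaryMatrix {N : ℕ} (q x : ℂ) (z : Fin N → ℂ) (μ : Fin N → Fin 2)
    (α β : Fin 2) (G : List (Fin 2 × ℂ) → ℂ) :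
    ∑ ν : Fin N → Fin 2, (List.ofFn fun i =>
      auxiliaryMatrix (sixVertexR q (x / z i)) (μ i) (ν i)).prod α β * G (chainSites ν z) =
      monodromyApply q x α β (chainSites μ z) G := by
  induction N generalizing α G with
  | zero => simp [chainSites, monodromyApply, Matrix.one_apply]
  | succ N ih =>
    rw [sum_fin_cons]
    simp only [chainSites, List.ofFn_succ, monodromyApply, List.prod_cons, Fin.cons_zero,
      Fin.cons_succ, Matrix.mul_apply, Finset.sum_mul] at ih ⊢
    simp_rw [← ih (fun i => z i.succ) (fun i => μ i.succ), Finset.mul_sum]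
    calc _ = ∑ ν₀, ∑ γ, ∑ ν : Fin N → Fin 2, auxiliaryMatrix (sixVertexR q (x / z 0)) (μ 0) ν₀ α γ *
          (List.ofFn fun i => auxiliaryMatrix (sixVertexR q (x / z i.succ)) (μ i.succ) (ν i)).prod γ β *
            G ((ν₀, z 0) :: List.ofFn fun i => (ν i, z i.succ)) :=
        Finset.sum_congr rfl fun ν₀ _ => Finset.sum_comm
      _ = _ := by
        rw [Finset.sum_comm]
        refine Finset.sum_congr rfl fun γ _ => Finset.sum_congr rfl fun ν₀ _ =>
          Finset.sum_congr rfl fun ν _ => ?_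
        rw [mul_assoc]
        rfl

theorem transferMatrix_mulVec {N : ℕ} (q x : ℂ) (z : Fin N → ℂ) (μ : Fin N → Fin 2)
    (G : List (Fin 2 × ℂ) → ℂ) :
    (transferMatrix q x z).mulVec (fun ν => G (chainSites ν z)) μ =
      transferApply q x (chainSites μ z) G := by
  simp only [Matrix.mulVec, dotProduct, transferMatrix_apply, transferApply, Finset.sum_mul,
    ← sum_prod_auxiliaryMatrix]
  exact Finset.sum_comm

/-! ### Polynomiality of the components -/

/-- The same `A` and `B` serve every function agreeing with `g` away from i and j, so all terms of
an exchange relation are split alike. -/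
theorem exists_ofFn_eq_append {β : Type*} {N : ℕ} (i j : Fin N) (hij : (i : ℕ) + 1 = j) (g : Fin N → β) :
    ∃ A B : List β, A.length = i ∧ ∀ g' : Fin N → β, (∀ k, k ≠ i → k ≠ j → g' k = g k) →
      List.ofFn g' = A ++ g' i :: g' j :: B := by
  refine ⟨(List.ofFn g).take i, (List.ofFn g).drop (j + 1), by simp, fun g' hg' => ?_⟩
  have h1 : (List.ofFn g).take i = (List.ofFn g').take i := by
    refine List.ext_getElem (by simp) fun n h1 h2 => ?_
    simp only [List.getElem_take, List.getElem_ofFn]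
    refine (hg' _ ?_ ?_).symm <;> rw [ne_eq, Fin.ext_iff] <;> simp at h1 h2 ⊢ <;> omega
  have h2 : (List.ofFn g).drop (j + 1) = (List.ofFn g').drop (j + 1) := by
    refine List.ext_getElem (by simp) fun n h1 h2 => ?_
    simp only [List.getElem_drop, List.getElem_ofFn]
    refine (hg' _ ?_ ?_).symm <;> rw [ne_eq, Fin.ext_iff] <;> simp at h1 h2 ⊢ <;> omega
  rw [h1, h2]
  conv_lhs => rw [← List.take_append_drop i (List.ofFn g'),
    List.drop_eq_getElem_cons (by simp), List.drop_eq_getElem_cons (by simp; omega)]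
  simp [hij]

theorem exists_chainSites_eq_append {N : ℕ} (i j : Fin N) (hij : (i : ℕ) + 1 = j)
    (μ : Fin N → Fin 2) (z : Fin N → ℂ) :
    ∃ A B, chainSites μ z = A ++ (μ i, z i) :: (μ j, z j) :: B ∧
      chainSites (μ ∘ Equiv.swap i j) z = A ++ (μ j, z i) :: (μ i, z j) :: B ∧
      chainSites (μ ∘ Equiv.swap i j) (z ∘ Equiv.swap i j) =
        A ++ (μ j, z j) :: (μ i, z i) :: B := by
  obtain ⟨A, B, -, h⟩ := exists_ofFn_eq_append i j hij (fun k => (μ k, z k))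
  refine ⟨A, B, h _ fun _ _ _ => rfl, ?_, ?_⟩
  · have := h (fun k => ((μ ∘ Equiv.swap i j) k, z k)) fun k h1 h2 => by
      simp [Equiv.swap_apply_of_ne_of_ne h1 h2]
    simpa [chainSites] using this
  · have := h (fun k => ((μ ∘ Equiv.swap i j) k, (z ∘ Equiv.swap i j) k)) fun k h1 h2 => by
      simp [Equiv.swap_apply_of_ne_of_ne h1 h2]
    simpa [chainSites] using this

theorem chainSites_exchange_down_up {N : ℕ} (q : ℂ) (i j : Fin N) (hij : (i : ℕ) + 1 = j)
    (μ : Fin N → Fin 2) (z : Fin N → ℂ) (hi : μ i = 0) (hj : μ j = 1)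
    (hb : bracket q (z j) (z i) ≠ 0) :
    (z j - z i) * chainComponent q (chainSites μ z) +
      (q - q⁻¹) * z j * chainComponent q (chainSites (μ ∘ Equiv.swap i j) z) =
      bracket q (z i) (z j) *
        chainComponent q (chainSites (μ ∘ Equiv.swap i j) (z ∘ Equiv.swap i j)) := by
  obtain ⟨A, B, h1, h2, h3⟩ := exists_chainSites_eq_append i j hij μ z
  rw [h1, h2, h3, hi, hj]
  exact chainComponent_exchange_down_up q _ _ A B hb

theorem chainSites_exchange_up_down {N : ℕ} (q : ℂ) (hq : q ≠ 0) (i j : Fin N)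
    (hij : (i : ℕ) + 1 = j) (μ : Fin N → Fin 2) (z : Fin N → ℂ) (hi : μ i = 1) (hj : μ j = 0)
    (hb : bracket q (z j) (z i) ≠ 0) :
    (z j - z i) * chainComponent q (chainSites μ z) +
      (q - q⁻¹) * z i * chainComponent q (chainSites (μ ∘ Equiv.swap i j) z) =
      bracket q (z i) (z j) *
        chainComponent q (chainSites (μ ∘ Equiv.swap i j) (z ∘ Equiv.swap i j)) := by
  obtain ⟨A, B, h1, h2, h3⟩ := exists_chainSites_eq_append i j hij μ z
  rw [h1, h2, h3, hi, hj]
  exact chainComponent_exchange_up_down q hq _ _ A B hb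

theorem chainSites_swap_same {N : ℕ} (q : ℂ) (i j : Fin N) (hij : (i : ℕ) + 1 = j)
    (μ : Fin N → Fin 2) (z : Fin N → ℂ) (h : μ i = μ j) :
    bracket q (z j) (z i) * chainComponent q (chainSites μ z) =
      bracket q (z i) (z j) *
        chainComponent q (chainSites (μ ∘ Equiv.swap i j) (z ∘ Equiv.swap i j)) := by
  obtain ⟨A, B, h1, h2, h3⟩ := exists_chainSites_eq_append i j hij μ z
  rw [h1, h3, h]
  exact chainComponent_swap_same q _ _ _ A B

theorem isGeneric_ofFn {N : ℕ} (q : ℂ) (z : Fin N → ℂ) :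
    IsGeneric q (List.ofFn z) ↔ Function.Injective z ∧ ∀ i j, bracket q (z i) (z j) ≠ 0 := by
  simp [IsGeneric, List.nodup_ofFn, List.mem_ofFn]

theorem IsGeneric.comp_equiv {N : ℕ} {q : ℂ} {z : Fin N → ℂ} (h : IsGeneric q (List.ofFn z))
    (σ : Equiv.Perm (Fin N)) : IsGeneric q (List.ofFn (z ∘ σ)) := by
  rw [isGeneric_ofFn] at h ⊢
  exact ⟨h.1.comp σ.injective, fun i j => h.2 _ _⟩

/-- Ensures that the divided difference in the exchange relation is again a polynomial. -/
theorem MvPolynomial.X_sub_X_dvd_rename_swap_sub {σ : Type*} [DecidableEq σ] (i j : σ)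
    (p : MvPolynomial σ ℂ) :
    (MvPolynomial.X j - MvPolynomial.X i : MvPolynomial σ ℂ) ∣
      MvPolynomial.rename (Equiv.swap i j) p - p := by
  induction p using MvPolynomial.induction_on with
  | C a => simp
  | add p r hp hr =>
    rw [map_add, add_sub_add_comm]
    exact dvd_add hp hr
  | mul_X p k hp =>
    have h : (MvPolynomial.X j - MvPolynomial.X i : MvPolynomial σ ℂ) ∣
        MvPolynomial.X (Equiv.swap i j k) - MvPolynomial.X k := by
      by_cases hi : k = i
      · subst hi; simp
      · by_cases hj : k = j
        · subst hj
          rw [Equiv.swap_apply_right]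
          exact ⟨-1, by ring⟩
        · simp [Equiv.swap_apply_of_ne_of_ne hi hj]
    rw [map_mul, MvPolynomial.rename_X]
    have e : MvPolynomial.rename (Equiv.swap i j) p * MvPolynomial.X (Equiv.swap i j k) -
        p * MvPolynomial.X k = (MvPolynomial.rename (Equiv.swap i j) p - p) *
          MvPolynomial.X (Equiv.swap i j k) +
          p * (MvPolynomial.X (Equiv.swap i j k) - MvPolynomial.X k) := by ring
    rw [e]
    exact dvd_add (hp.mul_right _) (h.mul_left _)

theorem exists_eval_eq_bracketProd {σ : Type*} (q : ℂ) (l : List σ) :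
    ∃ p : MvPolynomial σ ℂ, ∀ z, MvPolynomial.eval z p = bracketProd q (l.map z) := by
  induction l with
  | nil => exact ⟨1, fun z => by simp [bracketProd]⟩
  | cons i l ih =>
    obtain ⟨p, hp⟩ := ih
    refine ⟨(l.map fun j => MvPolynomial.C q * MvPolynomial.X i -
      MvPolynomial.C q⁻¹ * MvPolynomial.X j).prod * p, fun z => ?_⟩
    simp only [map_mul, hp, List.map_cons, bracketProd]
    congr 1
    rw [map_list_prod, List.map_map, List.map_map]
    congr 1
    refine List.map_congr_left fun j _ => ?_
    simp [bracket]

theorem exists_eval_eq_prod {σ : Type*} (l : List σ) :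
    ∃ p : MvPolynomial σ ℂ, ∀ z, MvPolynomial.eval z p = (l.map z).prod := by
  refine ⟨(l.map MvPolynomial.X).prod, fun z => ?_⟩
  rw [map_list_prod, List.map_map]
  congr 1
  exact List.map_congr_left fun j _ => by simp

theorem chainComponent_chainSites_sorted {N : ℕ} (q : ℂ) (m k : ℕ) (μ : Fin N → Fin 2)
    (hμ : List.ofFn μ = List.replicate m 1 ++ List.replicate k 0) (z : Fin N → ℂ)
    (hz : IsGeneric q (List.ofFn z)) :
    chainComponent q (chainSites μ z) = if 2 * m + 1 = N then
      ((List.ofFn z).take m).prod * bracketProd q ((List.ofFn z).take m) *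
        bracketProd q ((List.ofFn z).drop m) else 0 := by
  obtain ⟨zs, ts, hzs, hts, he⟩ := exists_sites_of_map_fst (chainSites μ z) m k
    (by rw [map_fst_chainSites, hμ])
  have hz' : List.ofFn z = zs ++ ts := by
    rw [← map_snd_chainSites μ z, he, List.map_append, map_snd_downSites, map_snd_upSites]
  have hc : ((chainSites μ z).map Prod.fst).count 1 = m := by
    rw [map_fst_chainSites, hμ]; simp [List.count_replicate]
  have hl : (chainSites μ z).length = N := by simp [chainSites]
  unfold chainComponent
  rw [hc, hl, he, hz', List.take_left' hzs, List.drop_left' hzs]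
  split_ifs
  · exact residueComponent_sorted q zs ts (hz' ▸ hz)
  · rfl

/-- The components of the solution are polynomials. -/
theorem exists_eval_eq_chainComponent {N : ℕ} (q : ℂ) (μ : Fin N → Fin 2) :
    ∃ p : MvPolynomial (Fin N) ℂ, ∀ z, IsGeneric q (List.ofFn z) →
      MvPolynomial.eval z p = chainComponent q (chainSites μ z) := by
  let Z : List (Fin 2) → Prop := fun s => ∀ μ : Fin N → Fin 2, List.ofFn μ = s →
    ∃ p : MvPolynomial (Fin N) ℂ, ∀ z, IsGeneric q (List.ofFn z) →
      MvPolynomial.eval z p = chainComponent q (chainSites μ z)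
  suffices hZ : Z ([] ++ List.ofFn μ) from hZ μ rfl
  refine spin_induction ?_ [] _ ?_
  · intro A B hAB μ hμ
    have hlen : A.length + 1 < N := by
      have := congrArg List.length hμ
      simp at this
      omega
    set i : Fin N := ⟨A.length, by omega⟩ with hi
    set j : Fin N := ⟨A.length + 1, hlen⟩ with hj
    have hμi : μ i = 0 := by
      have h1 : (List.ofFn μ)[A.length]'(by simp; omega) = μ i := by simp [hi]
      rw [← h1]; simp [hμ]
    have hμj : μ j = 1 := by
      have h1 : (List.ofFn μ)[A.length + 1]'(by simp; omega) = μ j := by simp [hj]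
      rw [← h1]; simp [hμ]
    have hswap : List.ofFn (μ ∘ Equiv.swap i j) = A ++ 1 :: 0 :: B := by
      obtain ⟨A', B', hA', h⟩ := exists_ofFn_eq_append i j rfl μ
      have h1 := h μ fun _ _ _ => rfl
      have h2 := h (μ ∘ Equiv.swap i j) fun k h1 h2 => by
        simp [Equiv.swap_apply_of_ne_of_ne h1 h2]
      rw [hμ] at h1
      obtain ⟨rfl, hB⟩ := List.append_inj h1 hA'.symm
      simp only [List.cons.injEq] at hB
      rw [h2, hB.2.2]
      simp [hμi, hμj]
    obtain ⟨p, hp⟩ := hAB _ hswap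
    obtain ⟨r, hr⟩ := MvPolynomial.X_sub_X_dvd_rename_swap_sub i j p
    -- Solving the exchange relation for the new component and using [z_i,z_j] - (q-q⁻¹)z_j =
    -- -q(z_j-z_i) gives [z_i,z_j] times the divided difference `r`, minus q times `p`.
    refine ⟨(MvPolynomial.C q * MvPolynomial.X i - MvPolynomial.C q⁻¹ * MvPolynomial.X j) * r -
      MvPolynomial.C q * p, fun z hz => ?_⟩
    have hz' := (isGeneric_ofFn q z).1 hz
    have hne : z j - z i ≠ 0 := sub_ne_zero.2 fun h => by
      have := hz'.1 h
      rw [hi, hj, Fin.mk.injEq] at this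
      omega
    have hex := chainSites_exchange_down_up q i j rfl μ z hμi hμj (hz'.2 j i)
    rw [← hp z hz, ← hp _ (hz.comp_equiv _)] at hex
    have hr' := congrArg (MvPolynomial.eval z) hr
    rw [map_sub, MvPolynomial.eval_rename, map_mul, map_sub, MvPolynomial.eval_X,
      MvPolynomial.eval_X] at hr'
    apply mul_left_cancel₀ hne
    simp only [map_sub, map_mul, MvPolynomial.eval_C, MvPolynomial.eval_X]
    unfold bracket at hex
    linear_combination -hex - (q * z i - q⁻¹ * z j) * hr'
  · intro μ' hμ'
    rw [List.nil_append] at hμ'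
    set m := (List.ofFn μ).count 1
    obtain ⟨p₁, h₁⟩ := exists_eval_eq_prod ((List.finRange N).take m)
    obtain ⟨p₂, h₂⟩ := exists_eval_eq_bracketProd q ((List.finRange N).take m)
    obtain ⟨p₃, h₃⟩ := exists_eval_eq_bracketProd q ((List.finRange N).drop m)
    refine ⟨if 2 * m + 1 = N then p₁ * p₂ * p₃ else 0, fun z hz => ?_⟩
    rw [chainComponent_chainSites_sorted q m _ μ' hμ' z hz, apply_ite (MvPolynomial.eval z), map_mul,
      map_mul, h₁, h₂, h₃, map_zero, List.map_take, List.map_drop, ← List.ofFn_eq_map]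

/-! ### Density of generic inhomogeneities -/

theorem eventually_add_mul_ne_zero (a b : ℂ) (h : a ≠ 0 ∨ b ≠ 0) :
    ∀ᶠ t : ℂ in nhdsWithin 0 {0}ᶜ, a + t * b ≠ 0 := by
  by_cases hb : b = 0
  · subst hb
    simpa using h
  · by_cases ha : a = 0
    · subst ha
      filter_upwards [self_mem_nhdsWithin] with t ht
      simpa [hb] using ht
    · refine eventually_nhdsWithin_of_eventually_nhds ?_
      have hc : ContinuousAt (fun t : ℂ => a + t * b) 0 := by fun_prop
      exact hc.eventually_ne (by simpa using ha)

/-- Every z is approached along the line z_i + t(i+1). Each genericity condition is affine in t with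
nonzero slope: q(i+1) and q⁻¹(j+1) have different absolute values for i ≠ j, and for i = j the slope
is (q-q⁻¹)(i+1). -/
theorem dense_isGeneric {N : ℕ} (q : ℂ) (hq : ‖q‖ = 1) (hq2 : q - q⁻¹ ≠ 0) :
    Dense {z : Fin N → ℂ | IsGeneric q (List.ofFn z)} := by
  intro z
  let φ : ℂ → Fin N → ℂ := fun t i => z i + t * ((i : ℕ) + 1)
  have hφ : Filter.Tendsto φ (nhdsWithin 0 {0}ᶜ) (nhds z) := by
    have hc : Continuous φ := by fun_prop
    have := hc.tendsto 0
    have h0 : φ 0 = z := by funext i; simp [φ]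
    rw [h0] at this
    exact this.mono_left nhdsWithin_le_nhds
  refine mem_closure_of_tendsto hφ ?_
  have h1 : ∀ᶠ t : ℂ in nhdsWithin 0 {0}ᶜ, ∀ i j, i ≠ j → φ t i - φ t j ≠ 0 := by
    simp only [Filter.eventually_all]
    intro i j hij
    have := eventually_add_mul_ne_zero (z i - z j) (((i : ℕ) : ℂ) - (j : ℕ)) (Or.inr (by
      rw [sub_ne_zero]
      exact_mod_cast fun h => hij (Fin.ext h)))
    filter_upwards [this] with t ht
    convert ht using 1
    simp only [φ]
    ring
  have h2 : ∀ᶠ t : ℂ in nhdsWithin 0 {0}ᶜ, ∀ i j, bracket q (φ t i) (φ t j) ≠ 0 := by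
    simp only [Filter.eventually_all]
    intro i j
    have := eventually_add_mul_ne_zero (bracket q (z i) (z j))
      (bracket q ((i : ℕ) + 1) ((j : ℕ) + 1)) (Or.inr fun h => by
        have h' : q * ((i : ℕ) + 1) = q⁻¹ * ((j : ℕ) + 1) := sub_eq_zero.1 h
        have hn := congrArg norm h'
        rw [norm_mul, norm_mul, norm_inv, hq, inv_one, one_mul, one_mul] at hn
        have e : ∀ n : ℕ, ‖(n : ℂ) + 1‖ = n + 1 := fun n => by
          rw [← Nat.cast_succ, Complex.norm_natCast, Nat.cast_succ]
        rw [e, e] at hn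
        have hij : (i : ℕ) = j := by exact_mod_cast add_right_cancel hn
        rw [hij, bracket_self] at h
        exact mul_ne_zero hq2 (Nat.cast_add_one_ne_zero _) h)
    filter_upwards [this] with t ht
    convert ht using 1
    simp only [φ, bracket]
    ring
  filter_upwards [h1, h2] with t ht1 ht2
  refine (isGeneric_ofFn q _).2 ⟨fun i j hij => ?_, ht2⟩
  by_contra hne
  exact ht1 i j hne (sub_eq_zero.2 hij)

/-- Two functions which are continuous at a point and agree at generic points agree at that point. -/
theorem eq_of_eq_on_isGeneric {E : Type*} [TopologicalSpace E] [T2Space E] {N : ℕ} {q : ℂ}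
    (hq : ‖q‖ = 1) (hq2 : q - q⁻¹ ≠ 0) {f g : (Fin N → ℂ) → E} (z : Fin N → ℂ)
    (hf : ContinuousAt f z) (hg : ContinuousAt g z)
    (h : ∀ᶠ w in nhds z, IsGeneric q (List.ofFn w) → f w = g w) : f z = g z := by
  have : (nhdsWithin z {z : Fin N → ℂ | IsGeneric q (List.ofFn z)}).NeBot :=
    mem_closure_iff_nhdsWithin_neBot.1 (dense_isGeneric q hq hq2 z)
  refine tendsto_nhds_unique_of_eventuallyEq
    (l := nhdsWithin z {z : Fin N → ℂ | IsGeneric q (List.ofFn z)}) (hf.tendsto.mono_left nhdsWithin_le_nhds)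
    (hg.tendsto.mono_left nhdsWithin_le_nhds) ?_
  filter_upwards [self_mem_nhdsWithin, h.filter_mono nhdsWithin_le_nhds] with w hw h' using h' hw

theorem MvPolynomial.eq_of_eval_eq_on_isGeneric {N : ℕ} {q : ℂ} (hq : ‖q‖ = 1) (hq2 : q - q⁻¹ ≠ 0)
    (p r : MvPolynomial (Fin N) ℂ)
    (h : ∀ z, IsGeneric q (List.ofFn z) → MvPolynomial.eval z p = MvPolynomial.eval z r) :
    p = r :=
  MvPolynomial.funext fun z => eq_of_eq_on_isGeneric hq hq2 z
    (MvPolynomial.continuous_eval p).continuousAt (MvPolynomial.continuous_eval r).continuousAt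
    (Filter.Eventually.of_forall h)

/-! ### The residue theorem on products of circles -/

/-- The residue theorem for a quotient by a product of distinct linear factors. -/
theorem circleIntegral_div_prod_sub (T : Finset ℂ) (c : ℂ) (r : ℝ) (hr : 0 < r)
    (hT : ∀ k ∈ T, dist k c ≠ r) (h : ℂ → ℂ)
    (hh : ∀ w ∈ Metric.closedBall c r, DifferentiableAt ℂ h w) :
    circleIntegral (fun w => h w / ∏ s ∈ T, (w - s)) c r =
      2 * Real.pi * Complex.I *
        ∑ k ∈ T.filter (dist · c < r), h k / ∏ s ∈ T.erase k, (k - s) := by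
  have hcont : ContinuousOn h (Metric.closedBall c r) := fun w hw =>
    (hh w hw).continuousAt.continuousWithinAt
  rcases T.eq_empty_or_nonempty with rfl | hne
  · simp only [Finset.prod_empty, div_one, Finset.filter_empty, Finset.sum_empty, mul_zero]
    exact Complex.circleIntegral_eq_zero_of_differentiable_on_off_countable hr.le
      Set.countable_empty hcont fun w hw => hh w (Metric.ball_subset_closedBall hw.1)
  have hns : ∀ w ∈ Metric.sphere c r, ∀ k ∈ T, w - k ≠ 0 := fun w hw k hk h0 =>
    hT k hk (by rw [← sub_eq_zero.1 h0]; exact hw)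
  -- Partial fractions, obtained from Lagrange interpolation of the constant 1. Each simple pole is
  -- then handled by Cauchy's formula or Cauchy's theorem, according to its side of the circle.
  have hpf : ∀ w ∈ Metric.sphere c r, h w / ∏ s ∈ T, (w - s) =
      ∑ k ∈ T, (∏ s ∈ T.erase k, (k - s))⁻¹ * ((w - k)⁻¹ • h w) := by
    intro w hw
    have h1 := sum_eval_mul_prod_div_eq_eval T 1 (by simpa using hne.card_pos) w
    simp only [Polynomial.eval_one, one_mul] at h1
    rw [div_eq_mul_inv, ← one_mul (∏ s ∈ T, (w - s))⁻¹, ← h1, Finset.sum_mul, Finset.mul_sum]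
    refine Finset.sum_congr rfl fun k hk => ?_
    rw [Finset.prod_div_distrib, ← Finset.mul_prod_erase T _ hk, smul_eq_mul]
    have n1 : ∏ s ∈ T.erase k, (w - s) ≠ 0 := Finset.prod_ne_zero_iff.2 fun s hs =>
      hns w hw s (Finset.mem_of_mem_erase hs)
    have n2 := hns w hw k hk
    field_simp
  rw [circleIntegral.integral_congr hr.le hpf, circleIntegral.integral_fun_sum]
  · rw [Finset.sum_filter, Finset.mul_sum]
    refine Finset.sum_congr rfl fun k hk => ?_
    rw [circleIntegral.integral_const_mul]
    split_ifs with hkb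
    · have hd : DiffContOnCl ℂ h (Metric.ball c r) := by
        refine ⟨fun w hw =>
          (hh w (Metric.ball_subset_closedBall hw)).differentiableWithinAt, ?_⟩
        rwa [closure_ball c hr.ne']
      rw [hd.circleIntegral_sub_inv_smul hkb, smul_eq_mul]
      ring
    · have hz : ∀ w ∈ Metric.closedBall c r, DifferentiableAt ℂ (fun w => (w - k)⁻¹ • h w) w := by
        intro w hw
        have : w - k ≠ 0 := by
          rw [sub_ne_zero]
          rintro rfl
          exact hkb (lt_of_le_of_ne hw (hT w hk))
        exact ((differentiableAt_id.sub_const k).inv this).smul (hh w hw)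
      rw [Complex.circleIntegral_eq_zero_of_differentiable_on_off_countable hr.le
        Set.countable_empty (fun w hw => (hz w hw).continuousAt.continuousWithinAt)
        fun w hw => hz w (Metric.ball_subset_closedBall hw.1)]
      ring
  · intro k hk
    refine ContinuousOn.circleIntegrable hr.le ?_
    have h1 : ContinuousOn (fun w : ℂ => (w - k)⁻¹) (Metric.sphere c r) :=
      (continuousOn_id.sub continuousOn_const).inv₀ fun w hw => hns w hw k hk
    exact continuousOn_const.mul (h1.smul (hcont.mono Metric.sphere_subset_closedBall))

theorem torusMap_mem_sphere {n : ℕ} (s : Fin n → ℂ) (r : ℝ) (hr : 0 ≤ r) (θ : Fin n → ℝ)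
    (l : Fin n) : torusMap s (fun _ => r) θ l ∈ Metric.sphere (s l) r := by
  simp only [torusMap, mem_sphere_iff_norm, add_sub_cancel_left, norm_mul,
    Complex.norm_exp_ofReal_mul_I, mul_one, Complex.norm_real, Real.norm_eq_abs, abs_of_nonneg hr]

theorem continuous_torusMap {n : ℕ} (s : Fin n → ℂ) (R : Fin n → ℝ) : Continuous (torusMap s R) := by
  unfold torusMap; fun_prop

theorem torusIntegral_congr {n : ℕ} {f g : (Fin n → ℂ) → ℂ} {s : Fin n → ℂ} {r : ℝ} (hr : 0 ≤ r)
    (h : ∀ w, (∀ l, w l ∈ Metric.sphere (s l) r) → f w = g w) :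
    torusIntegral f s (fun _ => r) = torusIntegral g s (fun _ => r) := by
  unfold torusIntegral
  congr 1
  funext θ
  rw [h _ (torusMap_mem_sphere s r hr θ)]

theorem torusIntegrable_of_continuousOn {n : ℕ} {f : (Fin n → ℂ) → ℂ} {s : Fin n → ℂ} {r : ℝ}
    (hr : 0 ≤ r) (hf : ContinuousOn f {w | ∀ l, w l ∈ Metric.sphere (s l) r}) :
    TorusIntegrable f s (fun _ => r) := by
  refine ContinuousOn.integrableOn_compact isCompact_Icc ?_
  exact hf.comp (continuous_torusMap s _).continuousOn fun θ _ => torusMap_mem_sphere s r hr θ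

theorem sum_piFinset_fin_succ {α M : Type*} [AddCommMonoid M] {n : ℕ} (A : Fin (n + 1) → Finset α)
    (F : (Fin (n + 1) → α) → M) :
    ∑ s ∈ Fintype.piFinset A, F s =
      ∑ a ∈ A 0, ∑ s ∈ Fintype.piFinset (fun l => A (Fin.succ l)), F (Fin.cons a s) := by
  rw [← Finset.sum_product']
  refine Finset.sum_nbij' (fun s => (s 0, fun l => s l.succ)) (fun p => Fin.cons p.1 p.2) ?_ ?_ ?_ ?_ ?_
  · intro s hs
    rw [Fintype.mem_piFinset] at hs
    simp only [Finset.mem_product, Fintype.mem_piFinset]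
    exact ⟨hs 0, fun l => hs _⟩
  · intro p hp
    simp only [Finset.mem_product, Fintype.mem_piFinset] at hp
    rw [Fintype.mem_piFinset]
    exact Fin.cases (by simpa using hp.1) (by simpa using hp.2)
  · intro s _
    exact Fin.cons_self_tail s
  · intro p _
    simp
  · intro s _
    exact congrArg F (Fin.cons_self_tail s).symm

theorem differentiable_fin_cons_left {n : ℕ} (k : Fin n → ℂ) :
    Differentiable ℂ (fun x : ℂ => (Fin.cons x k : Fin (n + 1) → ℂ)) :=
  differentiable_pi.2 (Fin.cases (by simp) (by simp))

theorem differentiable_fin_cons_right {n : ℕ} (x : ℂ) :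
    Differentiable ℂ (fun k : Fin n → ℂ => (Fin.cons x k : Fin (n + 1) → ℂ)) :=
  differentiable_pi.2 (Fin.cases (by simp) (by simpa using fun i => differentiable_apply i))

/-- The residue theorem for an integral over a product of circles. -/
theorem torusIntegral_mul_prod (T : Finset ℂ) (r : ℝ) (hr : 0 < r) (e : ℂ → ℂ) {n : ℕ}
    (s : Fin n → ℂ) (hs : ∀ l, ∀ k ∈ T, dist k (s l) ≠ r)
    (he : ∀ l, ∀ w ∈ Metric.closedBall (s l) r, DifferentiableAt ℂ e w)
    (f : (Fin n → ℂ) → ℂ) (hf : Differentiable ℂ f) :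
    torusIntegral (fun w => f w * ∏ l, (e (w l) / ∏ t ∈ T, (w l - t))) s (fun _ => r) =
      (2 * Real.pi * Complex.I) ^ n *
        ∑ k ∈ Fintype.piFinset (fun l => T.filter (dist · (s l) < r)),
          f k * ∏ l, (e (k l) / ∏ t ∈ T.erase (k l), (k l - t)) := by
  induction n with
  | zero => simp; congr 1; exact Subsingleton.elim _ _
  | succ n ih =>
    rw [torusIntegral_succ]
    · have h1 : ∀ x, torusIntegral (fun y : Fin n → ℂ => f (Fin.cons x y) * ∏ l : Fin (n + 1),
          (e ((Fin.cons x y : Fin (n + 1) → ℂ) l) /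
            ∏ t ∈ T, ((Fin.cons x y : Fin (n + 1) → ℂ) l - t))) (s ∘ Fin.succ) (fun _ => r) =
          (e x * ((2 * Real.pi * Complex.I) ^ n *
          ∑ k ∈ Fintype.piFinset (fun l : Fin n => T.filter (dist · (s l.succ) < r)),
            f (Fin.cons x k) * ∏ l, (e (k l) / ∏ t ∈ T.erase (k l), (k l - t)))) /
              ∏ t ∈ T, (x - t) := by
        intro x
        have := ih (s ∘ Fin.succ) (fun l => hs l.succ) (fun l => he l.succ)
          (fun y => f (Fin.cons x y)) (hf.comp (differentiable_fin_cons_right x))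
        simp only [Function.comp_apply] at this
        rw [← this, mul_div_right_comm, ← torusIntegral_const_mul]
        congr 1
        funext y
        rw [Fin.prod_univ_succ]
        simp only [Fin.cons_zero, Fin.cons_succ]
        ring
      have h2 : (fun x => torusIntegral (fun y : Fin n → ℂ => f (Fin.cons x y) * ∏ l : Fin (n + 1),
          (e ((Fin.cons x y : Fin (n + 1) → ℂ) l) /
            ∏ t ∈ T, ((Fin.cons x y : Fin (n + 1) → ℂ) l - t))) (s ∘ Fin.succ)
              ((fun _ => r) ∘ Fin.succ)) = _ := funext h1
      rw [h2, circleIntegral_div_prod_sub T (s 0) r hr (hs 0), sum_piFinset_fin_succ, pow_succ',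
        mul_assoc (2 * Real.pi * Complex.I : ℂ) (_ ^ n), Finset.mul_sum (a := (2 * Real.pi * Complex.I : ℂ) ^ n)]
      · congr 1
        refine Finset.sum_congr rfl fun x _ => ?_
        rw [mul_div_right_comm, mul_left_comm]
        congr 1
        rw [Finset.mul_sum]
        refine Finset.sum_congr rfl fun k _ => ?_
        rw [Fin.prod_univ_succ]
        simp only [Fin.cons_zero, Fin.cons_succ]
        ring
      · intro w hw
        refine (he 0 w hw).mul (DifferentiableAt.const_mul ?_ _)
        refine DifferentiableAt.fun_sum fun k _ => DifferentiableAt.mul_const ?_ _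
        exact (hf.comp (differentiable_fin_cons_left k)) w
    · refine torusIntegrable_of_continuousOn hr.le ?_
      refine hf.continuous.continuousOn.mul (continuousOn_finsetProd _ fun l _ => ?_)
      intro w hw
      refine ContinuousAt.continuousWithinAt ?_
      refine ContinuousAt.div ?_ ?_ ?_
      · exact ContinuousAt.comp (f := fun w : Fin (n + 1) → ℂ => w l)
          (he l (w l) (Metric.sphere_subset_closedBall (hw l))).continuousAt
          (continuous_apply l).continuousAt
      · exact (continuous_finsetProd _ fun t _ => by fun_prop).continuousAt
      · refine Finset.prod_ne_zero_iff.2 fun t ht h0 => hs l t ht ?_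
        rw [← sub_eq_zero.1 h0]
        exact hw l

/-- The residue theorem for an integral over the product of several copies of a union of circles,
each pole lying in exactly one of the discs. -/
theorem sum_torusIntegral_mul_prod (T D : Finset ℂ) (r : ℝ) (hr : 0 < r) (e : ℂ → ℂ)
    (hT : ∀ k ∈ T, ∃ c ∈ D, dist k c < r ∧ ∀ c' ∈ D, c' ≠ c → r < dist k c')
    (he : ∀ c ∈ D, ∀ w ∈ Metric.closedBall c r, DifferentiableAt ℂ e w) {n : ℕ}
    (f : (Fin n → ℂ) → ℂ) (hf : Differentiable ℂ f) :
    ∑ s ∈ Fintype.piFinset (fun _ : Fin n => D),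
      torusIntegral (fun w => f w * ∏ l, (e (w l) / ∏ t ∈ T, (w l - t))) s (fun _ => r) =
      (2 * Real.pi * Complex.I) ^ n * ∑ k ∈ Fintype.piFinset (fun _ : Fin n => T),
          f k * ∏ l, (e (k l) / ∏ t ∈ T.erase (k l), (k l - t)) := by
  choose! c hcD hc1 hc2 using hT
  have h1 : ∀ s ∈ Fintype.piFinset (fun _ : Fin n => D),
      torusIntegral (fun w => f w * ∏ l, (e (w l) / ∏ t ∈ T, (w l - t))) s (fun _ => r) =
      (2 * Real.pi * Complex.I) ^ n *
        ∑ k ∈ Fintype.piFinset (fun l => T.filter (dist · (s l) < r)),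
          f k * ∏ l, (e (k l) / ∏ t ∈ T.erase (k l), (k l - t)) := by
    intro s hs
    rw [Fintype.mem_piFinset] at hs
    refine torusIntegral_mul_prod T r hr e s (fun l k hk => ?_) (fun l => he _ (hs l)) f hf
    by_cases h : s l = c k
    · rw [h]; exact (hc1 k hk).ne
    · exact (hc2 k hk _ (hs l) h).ne'
  rw [Finset.sum_congr rfl h1, ← Finset.mul_sum]
  congr 1
  -- A tuple of poles determines the only tuple of circles enclosing it, so the double sum collapses
  -- to a sum over tuples of poles.
  rw [Finset.sum_comm' (t' := Fintype.piFinset (fun _ : Fin n => T))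
    (s' := fun k => {fun l => c (k l)})]
  · exact Finset.sum_congr rfl fun k _ => Finset.sum_singleton _ _
  · intro s k
    simp only [Fintype.mem_piFinset, Finset.mem_filter, Finset.mem_singleton]
    constructor
    · rintro ⟨h1, h2⟩
      refine ⟨funext fun l => ?_, fun l => (h2 l).1⟩
      by_contra hne
      exact lt_asymm (h2 l).2 (hc2 _ (h2 l).1 _ (h1 l) hne)
    · rintro ⟨rfl, h2⟩
      exact ⟨fun l => hcD _ (h2 l), fun l => ⟨h2 l, hc1 _ (h2 l)⟩⟩

/-! ### The integral as a residue sum, and its continuity -/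

/-- The weight attached to the variable `w` of the down arrow at the site `a`, relative to the
denominator common to all the positions of the arrow. -/
noncomputable def arrowWeight {N : ℕ} (q : ℂ) (z : Fin N → ℂ) (a : Fin N) (w : ℂ) : ℂ :=
  ∏ i, if i < a then bracket q w (z i) else if i = a then z a else w - z i

theorem arrowWeight_zero {N : ℕ} (q : ℂ) (z : Fin (N + 1) → ℂ) (w : ℂ) :
    arrowWeight q z 0 w = z 0 * ∏ i : Fin N, (w - z i.succ) := by
  simp [arrowWeight, Fin.prod_univ_succ, Fin.succ_ne_zero]

theorem arrowWeight_succ {N : ℕ} (q : ℂ) (z : Fin (N + 1) → ℂ) (a : Fin N) (w : ℂ) :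
    arrowWeight q z a.succ w = bracket q w (z 0) * arrowWeight q (fun i => z i.succ) a w := by
  simp [arrowWeight, Fin.prod_univ_succ]

/-- Unrolls the recursion into one sum over tuples of nodes, the shape delivered by the multiple
residue theorem. -/
theorem residueSum_chainSites {N : ℕ} (q : ℂ) (S : Finset ℂ) (C : ℂ → ℂ) (μ : Fin N → Fin 2)
    (z : Fin N → ℂ) {n : ℕ} (a : Fin n → Fin N) (ha : StrictMono a)
    (hμ : ∀ i, μ i = 1 ↔ i ∈ Set.range a) :
    residueSum q S C (chainSites μ z) = ∑ k ∈ Fintype.piFinset (fun _ : Fin n => S),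
      (∏ l, (nodeWeight q S (k l) * C (k l) * arrowWeight q z (a l) (k l))) *
        ∏ l, ∏ m ∈ Finset.Ioi l, pairWeight q (k l) (k m) := by
  induction N generalizing n C with
  | zero =>
    obtain rfl : n = 0 := by
      rcases n with _ | n
      · rfl
      · exact (a 0).elim0
    simp [chainSites, residueSum]
  | succ N ih =>
    have hcons : chainSites μ z =
        (μ 0, z 0) :: chainSites (fun i => μ i.succ) (fun i => z i.succ) := by
      simp [chainSites, List.ofFn_succ]
    rw [hcons]
    by_cases h0 : μ 0 = 0
    · have hne : ∀ l, a l ≠ 0 := fun l hl => by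
        have := (hμ 0).2 ⟨l, hl⟩
        rw [h0] at this
        exact zero_ne_one this
      choose b hb using fun l => Fin.exists_succ_eq.2 (hne l)
      have hb' : StrictMono b := fun l m hlm => by
        have := ha hlm
        rw [← hb l, ← hb m] at this
        exact Fin.succ_lt_succ_iff.1 this
      have hμ' : ∀ i, μ i.succ = 1 ↔ i ∈ Set.range b := fun i => by
        rw [hμ]
        simp only [Set.mem_range, ← hb, Fin.succ_inj]
      rw [residueSum, if_pos h0, ih _ _ _ b hb' hμ']
      refine Finset.sum_congr rfl fun k _ => ?_
      congr 1
      refine Finset.prod_congr rfl fun l _ => ?_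
      rw [← hb l, arrowWeight_succ]
      ring
    · have h1 : μ 0 = 1 := by omega
      obtain ⟨l₀, hl₀⟩ := (hμ 0).1 h1
      rcases n with _ | n
      · exact l₀.elim0
      have ha0 : a 0 = 0 := Fin.le_zero_iff.1 (hl₀ ▸ ha.monotone (Fin.zero_le l₀))
      have hne : ∀ l : Fin n, a l.succ ≠ 0 := fun l hl => by
        rw [← ha0] at hl
        exact Fin.succ_ne_zero l (ha.injective hl)
      choose b hb using fun l => Fin.exists_succ_eq.2 (hne l)
      have hb' : StrictMono b := fun l m hlm => by
        have := ha (Fin.succ_lt_succ_iff.2 hlm)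
        rw [← hb l, ← hb m] at this
        exact Fin.succ_lt_succ_iff.1 this
      have hμ' : ∀ i, μ i.succ = 1 ↔ i ∈ Set.range b := fun i => by
        rw [hμ, Set.mem_range, Fin.exists_fin_succ]
        simp only [Set.mem_range, ← hb, Fin.succ_inj, ha0]
        simp [(Fin.succ_ne_zero i).symm]
      rw [residueSum, if_neg h0, sum_piFinset_fin_succ]
      refine Finset.sum_congr rfl fun w _ => ?_
      rw [ih _ _ _ b hb' hμ', Finset.mul_sum]
      refine Finset.sum_congr rfl fun k _ => ?_
      have hp : ((chainSites (fun i => μ i.succ) (fun i => z i.succ)).map fun p => w - p.2).prod =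
          ∏ i : Fin N, (w - z i.succ) := by
        simp [chainSites, List.map_ofFn, List.prod_ofFn]
      simp only [Fin.prod_univ_succ, Fin.cons_zero, Fin.cons_succ, Fin.prod_Ioi_zero,
        Fin.prod_Ioi_succ, ha0, arrowWeight_zero, hp, ← hb, arrowWeight_succ]
      have e : ∏ l, (nodeWeight q S (k l) * (C (k l) * bracket q (k l) (z 0) *
          pairWeight q w (k l)) * arrowWeight q (fun i => z i.succ) (b l) (k l)) =
          (∏ l, (nodeWeight q S (k l) * C (k l) * (bracket q (k l) (z 0) *
            arrowWeight q (fun i => z i.succ) (b l) (k l)))) * ∏ l, pairWeight q w (k l) := by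
        rw [← Finset.prod_mul_distrib]
        exact Finset.prod_congr rfl fun l _ => by ring
      rw [e]
      ring

theorem bracketProd_ofFn {N : ℕ} (q : ℂ) (z : Fin N → ℂ) :
    bracketProd q (List.ofFn z) = ∏ i, ∏ j ∈ Finset.Ioi i, bracket q (z i) (z j) := by
  induction N with
  | zero => simp [bracketProd]
  | succ N ih =>
    rw [List.ofFn_succ, bracketProd, ih]
    simp only [Fin.prod_univ_succ, Fin.prod_Ioi_zero, Fin.prod_Ioi_succ, List.map_ofFn,
      List.prod_ofFn, Function.comp_apply]

theorem arrowWeight_mul {N : ℕ} (q : ℂ) (z : Fin N → ℂ) (a : Fin N) (w : ℂ) :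
    arrowWeight q z a w * ((∏ i ∈ Finset.Iic a, (w - z i)) * ∏ i ∈ Finset.Ici a, bracket q w (z i)) =
      z a * ((∏ i, bracket q w (z i)) * ∏ i, (w - z i)) := by
  have h1 : ∏ i ∈ Finset.Iic a, (w - z i) = ∏ i, if i ≤ a then w - z i else 1 := by
    rw [← Finset.prod_filter]; congr 1; ext; simp
  have h2 : ∏ i ∈ Finset.Ici a, bracket q w (z i) = ∏ i, if a ≤ i then bracket q w (z i) else 1 := by
    rw [← Finset.prod_filter]; congr 1; ext; simp
  have h3 : z a = ∏ i, if i = a then z a else 1 := by simp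
  rw [h1, h2, arrowWeight]
  conv_rhs => rw [h3]
  simp only [← Finset.prod_mul_distrib]
  refine Finset.prod_congr rfl fun i _ => ?_
  rcases lt_trichotomy i a with h | rfl | h
  · simp [h, h.le, h.ne, not_le.2 h, mul_comm]
  · simp [mul_comm]
  · simp [h.le, h.ne', not_le.2 h, not_lt.2 h.le, mul_comm]

/-- Over the common denominator the integrand is an entire function times identical one-variable
factors, as `sum_torusIntegral_mul_prod` requires. -/
theorem integrandPhi_eq {n : ℕ} (q : ℂ) (z : Fin (2 * n + 1) → ℂ) (hz : Function.Injective z)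
    (a : Fin n ↪o Fin (2 * n + 1)) (w : Fin n → ℂ) (hw : ∀ l i, w l - z i ≠ 0)
    (hb : ∀ l i, bracket q (w l) (z i) ≠ 0) :
    integrandPhi q z a w = ((∏ l, arrowWeight q z (a l) (w l)) *
      ∏ l, ∏ m ∈ Finset.Ioi l, pairWeight q (w l) (w m)) *
        ∏ l, ((q - q⁻¹) * w l / (∏ s ∈ Finset.univ.image z, bracket q (w l) s) /
          ∏ s ∈ Finset.univ.image z, (w l - s)) := by
  have e : ∀ l, (q - q⁻¹) * z (a l) * w l / ((∏ i ∈ Finset.Iic (a l), (w l - z i)) *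
      ∏ i ∈ Finset.Ici (a l), (q * w l - q⁻¹ * z i)) = arrowWeight q z (a l) (w l) *
      ((q - q⁻¹) * w l / (∏ s ∈ Finset.univ.image z, bracket q (w l) s) /
          ∏ s ∈ Finset.univ.image z, (w l - s)) := by
    intro l
    rw [Finset.prod_image hz.injOn, Finset.prod_image hz.injOn, div_div, mul_div_assoc',
      div_eq_div_iff]
    · have := arrowWeight_mul q z (a l) (w l)
      unfold bracket at this ⊢
      linear_combination -(q - q⁻¹) * w l * this
    · exact mul_ne_zero (Finset.prod_ne_zero_iff.2 fun i _ => hw l i)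
        (Finset.prod_ne_zero_iff.2 fun i _ => hb l i)
    · exact mul_ne_zero (Finset.prod_ne_zero_iff.2 fun i _ => hb l i)
        (Finset.prod_ne_zero_iff.2 fun i _ => hw l i)
  have hK : ∏ l, ∏ m ∈ Finset.Ioi l, ((w m - w l) * (q * w l - q⁻¹ * w m)) =
      ∏ l, ∏ m ∈ Finset.Ioi l, pairWeight q (w l) (w m) := rfl
  have hc : (q - q⁻¹) ^ n = ∏ _l : Fin n, (q - q⁻¹) := by simp
  unfold integrandPhi
  have e' := Finset.prod_congr rfl fun l (_ : l ∈ Finset.univ) => e l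
  rw [Finset.prod_mul_distrib, Finset.prod_div_distrib] at e'
  rw [hK, hc, mul_right_comm (∏ l, arrowWeight q z (a l) (w l)), ← e']
  simp only [Finset.prod_mul_distrib]
  ring

/-- The set of the inhomogeneities which remain inside the discs of radius `r` about the original
ones, with the poles `q⁻² z_j` remaining outside. -/
def IsInsideContours {N : ℕ} (q : ℂ) (z : Fin N → ℂ) (r : ℝ) (z' : Fin N → ℂ) : Prop :=
  (∀ i, dist (z' i) (z i) < r) ∧ (∀ i j, z i ≠ z j → r < dist (z' i) (z j)) ∧
    ∀ i j, r < dist (z i) ((q ^ 2)⁻¹ * z' j)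

theorem isOpen_isInsideContours {N : ℕ} (q : ℂ) (z : Fin N → ℂ) (r : ℝ) :
    IsOpen {z' | IsInsideContours q z r z'} := by
  simp only [IsInsideContours, Set.ofPred_and, Set.ofPred_forall]
  refine (isOpen_iInter_of_finite fun i => isOpen_lt (by fun_prop) (by fun_prop)).inter
    ((isOpen_iInter_of_finite fun i => isOpen_iInter_of_finite fun j =>
      isOpen_iInter_of_finite fun _ => isOpen_lt (by fun_prop) (by fun_prop)).inter
    (isOpen_iInter_of_finite fun i => isOpen_iInter_of_finite fun j =>
      isOpen_lt (by fun_prop) (by fun_prop)))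

theorem IsContourRadius.isInsideContours {N : ℕ} {q : ℂ} {z : Fin N → ℂ} {r : ℝ}
    (h : IsContourRadius q z r) : IsInsideContours q z r z :=
  ⟨fun i => by simpa using h.1, fun i j hij => by linarith [h.1, h.2.1 i j hij], h.2.2⟩

theorem IsInsideContours.sub_ne_zero {N : ℕ} {q : ℂ} {z : Fin N → ℂ} {r : ℝ} {z' : Fin N → ℂ}
    (h : IsInsideContours q z r z') (w : ℂ) (c i : Fin N) (hw : w ∈ Metric.sphere (z c) r) :
    w - z' i ≠ 0 := by
  rw [_root_.sub_ne_zero]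
  rintro rfl
  have hw' : dist (z' i) (z c) = r := hw
  by_cases hc : z i = z c
  · have := h.1 i
    rw [hc] at this
    linarith
  · linarith [h.2.1 i c hc]

theorem IsInsideContours.bracket_ne_zero {N : ℕ} {q : ℂ} (hq : q ≠ 0) {z : Fin N → ℂ} {r : ℝ}
    {z' : Fin N → ℂ} (h : IsInsideContours q z r z') (w : ℂ) (c i : Fin N)
    (hw : w ∈ Metric.closedBall (z c) r) : bracket q w (z' i) ≠ 0 := by
  intro h0
  have : w = (q ^ 2)⁻¹ * z' i := by
    unfold bracket at h0
    field_simp at h0 ⊢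
    linear_combination h0
  have h1 := h.2.2 c i
  rw [← this, dist_comm] at h1
  exact absurd hw (not_le.2 h1)

/-- The integral formula with inhomogeneities `z'` and the contours attached to `z`. -/
noncomputable def shiftedIntegral {n : ℕ} (q : ℂ) (z : Fin (2 * n + 1) → ℂ) (r : ℝ)
    (a : Fin n ↪o Fin (2 * n + 1)) (z' : Fin (2 * n + 1) → ℂ) : ℂ :=
  (∏ i, ∏ j ∈ Finset.Ioi i, (q * z' i - q⁻¹ * z' j)) *
    ((1 / (2 * (Real.pi : ℂ) * Complex.I)) ^ n *
      ∑ s ∈ Fintype.piFinset (fun _ : Fin n => Finset.univ.image z),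
        torusIntegral (integrandPhi q z' a) s (fun _ => r))

theorem mem_range_of_mem_piFinset {n N : ℕ} {z : Fin N → ℂ} {s : Fin n → ℂ}
    (hs : s ∈ Fintype.piFinset (fun _ : Fin n => Finset.univ.image z)) (l : Fin n) :
    ∃ c, z c = s l := by
  simpa using Fintype.mem_piFinset.1 hs l

theorem differentiable_arrowWeight {N : ℕ} (q : ℂ) (z : Fin N → ℂ) (a : Fin N) :
    Differentiable ℂ (arrowWeight q z a) := by
  unfold arrowWeight
  refine Differentiable.fun_finsetProd (𝔸' := ℂ) fun i _ => ?_
  unfold bracket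
  split_ifs <;> fun_prop

theorem differentiable_fun_prod {ι E : Type*} [NormedAddCommGroup E] [NormedSpace ℂ E]
    (u : Finset ι) (f : ι → E → ℂ) (hf : ∀ i ∈ u, Differentiable ℂ (f i)) :
    Differentiable ℂ fun w => ∏ i ∈ u, f i w := by
  classical
  exact fun w => (HasFDerivAt.finsetProd fun i hi => (hf i hi w).hasFDerivAt).differentiableAt

theorem differentiable_arrowWeight_mul_pairWeight {n N : ℕ} (q : ℂ) (z : Fin N → ℂ)
    (a : Fin n → Fin N) :
    Differentiable ℂ fun w : Fin n → ℂ => (∏ l, arrowWeight q z (a l) (w l)) *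
      ∏ l, ∏ m ∈ Finset.Ioi l, pairWeight q (w l) (w m) := by
  refine Differentiable.mul ?_ ?_
  · refine differentiable_fun_prod _ _ fun l _ => ?_
    exact (differentiable_arrowWeight q z (a l)).comp (differentiable_apply l)
  · refine differentiable_fun_prod _ _ fun l _ => ?_
    refine differentiable_fun_prod _ _ fun m _ => ?_
    unfold pairWeight bracket
    fun_prop

theorem List.count_ofFn {α : Type*} [DecidableEq α] {N : ℕ} (f : Fin N → α) (b : α) :
    (List.ofFn f).count b = (Finset.univ.filter fun i => f i = b).card := by
  induction N with
  | zero => simp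
  | succ N ih =>
    rw [List.ofFn_succ, List.count_cons, ih, Fin.univ_succ, Finset.filter_cons]
    simp [Finset.filter_map]
    split_ifs <;> simp [Finset.card_map]

theorem downConfig_eq_one_iff {n N : ℕ} (a : Fin n ↪o Fin N) (i : Fin N) :
    downConfig a i = 1 ↔ i ∈ Set.range a := by
  unfold downConfig
  split_ifs with hi <;> simp [hi]

theorem count_ofFn_downConfig {n N : ℕ} (a : Fin n ↪o Fin N) :
    (List.ofFn (downConfig a)).count 1 = n := by
  rw [List.count_ofFn]
  have : (Finset.univ.filter fun i => downConfig a i = 1) = Finset.univ.map a.toEmbedding := by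
    ext i
    simp [downConfig_eq_one_iff]
  rw [this, Finset.card_map, Finset.card_univ, Fintype.card_fin]

/-- The discs are centred at the possibly coinciding points of z, while the poles are the distinct
points of z'. One disc may hold several of them, but each pole lies in exactly one disc. -/
theorem shiftedIntegral_eq_chainComponent {n : ℕ} (q : ℂ) (hq : q ≠ 0) (z : Fin (2 * n + 1) → ℂ)
    (r : ℝ) (hr : 0 < r) (a : Fin n ↪o Fin (2 * n + 1)) (z' : Fin (2 * n + 1) → ℂ)
    (h : IsInsideContours q z r z') (hg : IsGeneric q (List.ofFn z')) :
    shiftedIntegral q z r a z' = chainComponent q (chainSites (downConfig a) z') := by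
  have hg' := (isGeneric_ofFn q z').1 hg
  set S := Finset.univ.image z' with hS
  set e : ℂ → ℂ := fun w => (q - q⁻¹) * w / ∏ s ∈ S, bracket q w s with he
  set f : (Fin n → ℂ) → ℂ := fun w => (∏ l, arrowWeight q z' (a l) (w l)) *
      ∏ l, ∏ m ∈ Finset.Ioi l, pairWeight q (w l) (w m) with hf
  have hfd : Differentiable ℂ f := differentiable_arrowWeight_mul_pairWeight q z' a
  have hint : ∀ s ∈ Fintype.piFinset (fun _ : Fin n => Finset.univ.image z),
      torusIntegral (integrandPhi q z' a) s (fun _ => r) =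
      torusIntegral (fun w => f w * ∏ l, (e (w l) / ∏ t ∈ S, (w l - t))) s (fun _ => r) := by
    intro s hs
    refine torusIntegral_congr hr.le fun w hw => ?_
    choose c hc using mem_range_of_mem_piFinset hs
    refine integrandPhi_eq q z' hg'.1 a w (fun l i => ?_) (fun l i => ?_)
    · exact h.sub_ne_zero _ (c l) i (by rw [hc]; exact hw l)
    · exact h.bracket_ne_zero hq _ (c l) i (by
        rw [hc]; exact Metric.sphere_subset_closedBall (hw l))
  have hpoles : ∀ k ∈ S, ∃ c ∈ Finset.univ.image z, dist k c < r ∧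
      ∀ c' ∈ Finset.univ.image z, c' ≠ c → r < dist k c' := by
    intro k hk
    obtain ⟨i, -, rfl⟩ := Finset.mem_image.1 hk
    refine ⟨z i, by simp, h.1 i, fun c' hc' hne => ?_⟩
    obtain ⟨j, -, rfl⟩ := Finset.mem_image.1 hc'
    exact h.2.1 i j hne.symm
  have hed : ∀ c ∈ Finset.univ.image z, ∀ w ∈ Metric.closedBall c r, DifferentiableAt ℂ e w := by
    intro c hc w hw
    obtain ⟨i, -, rfl⟩ := Finset.mem_image.1 hc
    refine DifferentiableAt.div (by fun_prop) ?_ ?_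
    · refine DifferentiableAt.fun_finsetProd fun s _ => ?_
      unfold bracket
      fun_prop
    · refine Finset.prod_ne_zero_iff.2 fun s hs => ?_
      obtain ⟨j, -, rfl⟩ := Finset.mem_image.1 hs
      exact h.bracket_ne_zero hq w i j hw
  have hsum := sum_torusIntegral_mul_prod S (Finset.univ.image z) r hr e hpoles hed f hfd
  have hrs := residueSum_chainSites q S (fun _ => 1) (downConfig a) z' a a.strictMono
    (downConfig_eq_one_iff a)
  have hSl : (List.ofFn z').toFinset = S := by
    ext x; simp only [hS, List.mem_toFinset, List.mem_ofFn', Set.mem_range, Finset.mem_image, Finset.mem_univ, true_and]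
  have hcount : ((chainSites (downConfig a) z').map Prod.fst).count 1 = n := by
    rw [map_fst_chainSites, count_ofFn_downConfig]
  have hpi : (1 / (2 * (Real.pi : ℂ) * Complex.I)) ^ n * (2 * Real.pi * Complex.I) ^ n = 1 := by
    rw [← mul_pow, one_div_mul_cancel Complex.two_pi_I_ne_zero, one_pow]
  unfold chainComponent residueComponent
  rw [hcount, if_pos (by simp [chainSites]), map_snd_chainSites, hSl, hrs, bracketProd_ofFn]
  unfold shiftedIntegral
  rw [Finset.sum_congr rfl hint, hsum, ← mul_assoc ((1 / _) ^ n), hpi, one_mul]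
  congr 1
  refine Finset.sum_congr rfl fun k _ => ?_
  have : ∀ l, nodeWeight q S (k l) = e (k l) / ∏ t ∈ S.erase (k l), (k l - t) := by
    intro l
    rw [nodeWeight, he, div_div, mul_comm (∏ s ∈ S.erase _, _)]
  simp only [hf, this, mul_one, Finset.prod_mul_distrib]
  ring

/-- The contours stay put and no pole crosses them while z' remains inside, so this is a parametric
integral of a jointly continuous function over a compact box. -/
theorem continuousOn_shiftedIntegral {n : ℕ} (q : ℂ) (hq : q ≠ 0) (z : Fin (2 * n + 1) → ℂ)
    (r : ℝ) (hr : 0 ≤ r) (a : Fin n ↪o Fin (2 * n + 1)) :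
    ContinuousOn (shiftedIntegral q z r a) {z' | IsInsideContours q z r z'} := by
  unfold shiftedIntegral
  refine ContinuousOn.mul (by fun_prop) (continuousOn_const.mul ?_)
  refine continuousOn_finsetSum _ fun s hs => ?_
  choose c hc using mem_range_of_mem_piFinset hs
  rw [continuousOn_iff_continuous_domRestrict]
  have : LocallyCompactSpace {z' | IsInsideContours q z r z'} :=
    (isOpen_isInsideContours q z r).locallyCompactSpace
  unfold torusIntegral
  refine continuous_parametric_integral_of_continuous
    (X := {z' | IsInsideContours q z r z'})
    (f := fun z' θ => (∏ i, ((r : ℝ) : ℂ) * Complex.exp (θ i * Complex.I) * Complex.I) •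
      integrandPhi q z' a (torusMap s (fun _ => r) θ)) ?_ isCompact_Icc
  have hw : ∀ l, Continuous fun p : {z' | IsInsideContours q z r z'} × (Fin n → ℝ) =>
      torusMap s (fun _ => r) p.2 l := fun l =>
    (continuous_apply l).comp ((continuous_torusMap s fun _ => r).comp continuous_snd)
  have hz : ∀ i, Continuous fun p : {z' | IsInsideContours q z r z'} × (Fin n → ℝ) =>
      (p.1 : Fin (2 * n + 1) → ℂ) i := fun i =>
    (continuous_apply i).comp (continuous_subtype_val.comp continuous_fst)
  have hA : Continuous fun p : {z' | IsInsideContours q z r z'} × (Fin n → ℝ) =>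
      ∏ i, ((r : ℝ) : ℂ) * Complex.exp (p.2 i * Complex.I) * Complex.I := by fun_prop
  suffices hB : Continuous fun p : {z' | IsInsideContours q z r z'} × (Fin n → ℝ) =>
      integrandPhi q p.1 a (torusMap s (fun _ => r) p.2) from hA.smul hB
  unfold integrandPhi
  refine Continuous.div ?_ ?_ ?_
  · fun_prop
  · fun_prop
  rintro ⟨⟨z', h⟩, θ⟩
  have hwl : ∀ l, torusMap s (fun _ => r) θ l ∈ Metric.sphere (z (c l)) r := fun l => by
    rw [hc]
    exact torusMap_mem_sphere s r hr θ l
  refine Finset.prod_ne_zero_iff.2 fun l _ => mul_ne_zero ?_ ?_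
  · exact Finset.prod_ne_zero_iff.2 fun i _ => h.sub_ne_zero _ _ i (hwl l)
  · exact Finset.prod_ne_zero_iff.2 fun i _ =>
      h.bracket_ne_zero hq _ _ i (Metric.sphere_subset_closedBall (hwl l))

theorem exists_isContourRadius {N : ℕ} (q : ℂ) (z : Fin N → ℂ)
    (hz : ∀ i j, z i ≠ (q ^ 2)⁻¹ * z j) : ∃ r, IsContourRadius q z r := by
  have key : ∀ d : ℝ, 0 < d → ∀ᶠ r in nhdsWithin (0 : ℝ) (Set.Ioi 0), 2 * r < d ∧ r < d := by
    intro d hd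
    filter_upwards [Ioo_mem_nhdsGT (half_pos hd)] with r hr
    constructor <;> linarith [hr.1, hr.2]
  have h1 : ∀ᶠ r in nhdsWithin (0 : ℝ) (Set.Ioi 0),
      ∀ i j, z i ≠ z j → 2 * r < dist (z i) (z j) := by
    simp only [Filter.eventually_all]
    exact fun i j hij => (key _ (dist_pos.2 hij)).mono fun r hr => hr.1
  have h2 : ∀ᶠ r in nhdsWithin (0 : ℝ) (Set.Ioi 0),
      ∀ i j, r < dist (z i) ((q ^ 2)⁻¹ * z j) := by
    simp only [Filter.eventually_all]
    exact fun i j => (key _ (dist_pos.2 (hz i j))).mono fun r hr => hr.2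
  obtain ⟨r, hr1, hr2, hr0⟩ := (h1.and (h2.and self_mem_nhdsWithin)).exists
  exact ⟨r, hr0, hr1, hr2⟩

theorem bracket_ne_zero_iff {q : ℂ} (hq : q ≠ 0) (u v : ℂ) :
    bracket q u v ≠ 0 ↔ u ≠ (q ^ 2)⁻¹ * v := by
  unfold bracket
  rw [not_iff_not]
  constructor
  · intro h
    field_simp at h ⊢
    linear_combination h
  · rintro rfl
    field_simp
    ring

theorem psiIntegral_eq_shiftedIntegral {n : ℕ} (q : ℂ) (z : Fin (2 * n + 1) → ℂ) (r : ℝ)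
    (a : Fin n ↪o Fin (2 * n + 1)) : psiIntegral q z r a = shiftedIntegral q z r a z := rfl

/-- Covers coinciding z_i. The contours of z are kept while the inhomogeneities are perturbed to
generic ones, where the residue theorem applies, and continuity returns to z. -/
theorem eval_eq_psiIntegral {n : ℕ} {q : ℂ} (hq : ‖q‖ = 1) (hq2 : q - q⁻¹ ≠ 0)
    (a : Fin n ↪o Fin (2 * n + 1)) (p : MvPolynomial (Fin (2 * n + 1)) ℂ)
    (hp : ∀ z, IsGeneric q (List.ofFn z) →
      MvPolynomial.eval z p = chainComponent q (chainSites (downConfig a) z))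
    (z : Fin (2 * n + 1) → ℂ) (r : ℝ) (hr : IsContourRadius q z r) :
    MvPolynomial.eval z p = psiIntegral q z r a := by
  have hq0 : q ≠ 0 := norm_pos_iff.1 (hq ▸ one_pos)
  have hU := (isOpen_isInsideContours q z r).mem_nhds hr.isInsideContours
  rw [psiIntegral_eq_shiftedIntegral]
  refine eq_of_eq_on_isGeneric hq hq2 z (f := fun w => MvPolynomial.eval w p)
    (MvPolynomial.continuous_eval p).continuousAt
    ((continuousOn_shiftedIntegral q hq0 z r hr.1.le a).continuousAt hU) ?_
  filter_upwards [hU] with w hw hg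
  rw [hp w hg, shiftedIntegral_eq_chainComponent q hq0 z r hr.1 a w hw hg]

theorem IsGivenByIntegral.eval_eq_chainComponent {n : ℕ} {q : ℂ} (hq : q ≠ 0)
    {Ψ : PolynomialComponents n} (h : IsGivenByIntegral q Ψ) (a : Fin n ↪o Fin (2 * n + 1))
    {z : Fin (2 * n + 1) → ℂ} (hz : IsGeneric q (List.ofFn z)) :
    MvPolynomial.eval z (Ψ a) = chainComponent q (chainSites (downConfig a) z) := by
  obtain ⟨r, hr⟩ := exists_isContourRadius q z fun i j =>
    (bracket_ne_zero_iff hq _ _).1 (((isGeneric_ofFn q z).1 hz).2 i j)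
  rw [h z r hr a, psiIntegral_eq_shiftedIntegral,
    shiftedIntegral_eq_chainComponent q hq z r hr.1 a z hr.isInsideContours hz]

theorem existsUnique_isGivenByIntegral {n : ℕ} {q : ℂ} (hq : ‖q‖ = 1) (hq2 : q - q⁻¹ ≠ 0) :
    ∃! Ψ : PolynomialComponents n, IsGivenByIntegral q Ψ := by
  choose P hP using fun a : Fin n ↪o Fin (2 * n + 1) =>
    exists_eval_eq_chainComponent q (downConfig a)
  refine ⟨P, fun z r hr a => eval_eq_psiIntegral hq hq2 a (P a) (hP a) z r hr,
    fun Ψ hΨ => funext fun a => MvPolynomial.eq_of_eval_eq_on_isGeneric hq hq2 _ _ fun z hz => ?_⟩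
  rw [hΨ.eval_eq_chainComponent (norm_pos_iff.1 (hq ▸ one_pos)) a hz, hP a z hz]

/-! ### The vector Ψ: eigenvector equation and nonvanishing -/

theorem downConfig_injective {n N : ℕ} :
    Function.Injective (downConfig : (Fin n ↪o Fin N) → Fin N → Fin 2) := by
  intro a b hab
  refine OrderEmbedding.range_inj.1 (Set.ext fun i => ?_)
  rw [← downConfig_eq_one_iff, hab, downConfig_eq_one_iff]

theorem exists_downConfig_eq {n N : ℕ} (μ : Fin N → Fin 2) (hμ : (List.ofFn μ).count 1 = n) :
    ∃ a : Fin n ↪o Fin N, downConfig a = μ := by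
  rw [List.count_ofFn] at hμ
  refine ⟨Finset.orderEmbOfFin _ hμ, funext fun i => ?_⟩
  have h := downConfig_eq_one_iff (Finset.orderEmbOfFin _ hμ) i
  rw [Finset.range_orderEmbOfFin] at h
  simp only [Finset.coe_filter, Finset.mem_univ, true_and, Set.mem_ofPred_eq] at h
  omega

theorem IsGivenByIntegral.psiVector_apply {n : ℕ} {q : ℂ} (hq : q ≠ 0)
    {Ψ : PolynomialComponents n} (h : IsGivenByIntegral q Ψ) {z : Fin (2 * n + 1) → ℂ}
    (hz : IsGeneric q (List.ofFn z)) (μ : Fin (2 * n + 1) → Fin 2) :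
    psiVector Ψ z μ = chainComponent q (chainSites μ z) := by
  simp only [psiVector, Finset.sum_apply, Pi.smul_apply, smul_eq_mul]
  by_cases hμ : (List.ofFn μ).count 1 = n
  · obtain ⟨a, rfl⟩ := exists_downConfig_eq μ hμ
    rw [Finset.sum_eq_single a, Pi.single_eq_same, mul_one, h.eval_eq_chainComponent hq a hz]
    · intro b _ hb
      rw [Pi.single_eq_of_ne (fun e => hb (downConfig_injective e).symm), mul_zero]
    · simp
  · rw [Finset.sum_eq_zero, chainComponent, if_neg]
    · rw [map_fst_chainSites, chainSites, List.length_ofFn]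
      omega
    · intro b _
      rw [Pi.single_eq_of_ne, mul_zero]
      rintro rfl
      exact hμ (count_ofFn_downConfig b)

theorem continuous_psiVector {n : ℕ} (Ψ : PolynomialComponents n) : Continuous (psiVector Ψ) := by
  unfold psiVector
  exact continuous_finsetSum _ fun a _ =>
    (MvPolynomial.continuous_eval (Ψ a)).smul continuous_const

theorem continuousAt_sixVertexR_apply {E : Type*} [TopologicalSpace E] (q : ℂ) {x : E → ℂ} {e : E}
    (hx : ContinuousAt x e) (h : q - q⁻¹ * x e ≠ 0) (s t : Fin 2 × Fin 2) :
    ContinuousAt (fun e => sixVertexR q (x e) s t) e := by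
  unfold sixVertexR weightA weightB weightC weightC'
  split_ifs <;> fun_prop (disch := assumption)

theorem continuousAt_transferMatrix_apply {N : ℕ} (q x : ℂ) (z : Fin N → ℂ) (hz : ∀ i, z i ≠ 0)
    (hx : ∀ i, q - q⁻¹ * (x / z i) ≠ 0) (μ ν : Fin N → Fin 2) :
    ContinuousAt (fun w => transferMatrix q x w μ ν) z := by
  simp only [transferMatrix_apply, List.ofFn_eq_map]
  refine tendsto_finsetSum _ fun α _ => ?_
  have h : Filter.Tendsto (fun w : Fin N → ℂ => ((List.finRange N).map fun i =>
      auxiliaryMatrix (sixVertexR q (x / w i)) (μ i) (ν i)).prod) (nhds z) (nhds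
        ((List.finRange N).map fun i =>
          auxiliaryMatrix (sixVertexR q (x / z i)) (μ i) (ν i)).prod) := by
    refine tendsto_list_prod _ fun i _ => ?_
    refine tendsto_pi_nhds.2 fun α => tendsto_pi_nhds.2 fun γ => ?_
    refine continuousAt_sixVertexR_apply q (x := fun w : Fin N → ℂ => x / w i) ?_ (hx i) _ _
    exact continuousAt_const.div (continuous_apply i).continuousAt (hz i)
  exact tendsto_pi_nhds.1 (tendsto_pi_nhds.1 h α) α

theorem bracket_eq_mul {q x : ℂ} {z : ℂ} (hz : z ≠ 0) :
    bracket q z x = z * (q - q⁻¹ * (x / z)) := by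
  unfold bracket
  field_simp

/-- Both sides are continuous in z where T is defined, so the generic identity of
`transferApply_chainComponent` passes to the limit. -/
theorem IsGivenByIntegral.transferMatrix_mulVec_psiVector {n : ℕ} {q : ℂ} (hq : ‖q‖ = 1)
    (hq2 : q - q⁻¹ ≠ 0) (h3 : q ^ 3 = 1) (hs : 1 + q + q ^ 2 = 0)
    {Ψ : PolynomialComponents n} (h : IsGivenByIntegral q Ψ) (z : Fin (2 * n + 1) → ℂ)
    (hz : ∀ i, z i ≠ 0) (x : ℂ) (hx : ∀ i, q - q⁻¹ * (x / z i) ≠ 0) :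
    (transferMatrix q x z).mulVec (psiVector Ψ z) = psiVector Ψ z := by
  have hq0 : q ≠ 0 := norm_pos_iff.1 (hq ▸ one_pos)
  refine eq_of_eq_on_isGeneric hq hq2 z
    (f := fun w => (transferMatrix q x w).mulVec (psiVector Ψ w)) ?_
    (continuous_psiVector Ψ).continuousAt ?_
  · refine tendsto_pi_nhds.2 fun μ => tendsto_finsetSum _ fun ν _ => ?_
    exact (continuousAt_transferMatrix_apply q x z hz hx μ ν).mul
      ((continuous_apply ν).comp (continuous_psiVector Ψ)).continuousAt
  · have e1 : ∀ᶠ w in nhds z, ∀ i, w i ≠ 0 :=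
      Filter.eventually_all.2 fun i => (continuous_apply i).continuousAt.eventually_ne (hz i)
    have e2 : ∀ᶠ w in nhds z, ∀ i, q - q⁻¹ * (x / w i) ≠ 0 := by
      refine Filter.eventually_all.2 fun i => ?_
      have hc : ContinuousAt (fun w : Fin (2 * n + 1) → ℂ => q - q⁻¹ * (x / w i)) z :=
        continuousAt_const.sub (continuousAt_const.mul
          (continuousAt_const.div (continuous_apply i).continuousAt (hz i)))
      exact hc.eventually_ne (hx i)
    filter_upwards [e1, e2] with w hw hxw hg
    have e : psiVector Ψ w = fun μ => chainComponent q (chainSites μ w) :=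
      funext fun μ => h.psiVector_apply hq0 hg μ
    rw [e]
    funext μ
    rw [transferMatrix_mulVec, transferApply_chainComponent q h3 hs]
    · rwa [map_snd_chainSites]
    · intro p hp
      obtain ⟨i, rfl⟩ := List.mem_ofFn.1 hp
      rw [bracket_eq_mul (hw i)]
      exact mul_ne_zero (hw i) (hxw i)

theorem bracketProd_ne_zero {q : ℂ} (l : List ℂ) (h : ∀ u ∈ l, ∀ v ∈ l, bracket q u v ≠ 0) :
    bracketProd q l ≠ 0 := by
  induction l with
  | nil => simp [bracketProd]
  | cons u l ih =>
    refine mul_ne_zero (List.prod_ne_zero ?_)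
      (ih fun v hv w hw => h v (by simp [hv]) w (by simp [hw]))
    rw [List.mem_map]
    rintro ⟨v, hv, h0⟩
    exact h u (by simp) v (by simp [hv]) h0

/-- The component with the down arrows at the first n sites is a product of z_i's and brackets. The
formula is known at generic points, extends by continuity to coinciding z_i, and none of its factors
vanishes under `hz`. -/
theorem IsGivenByIntegral.psiVector_ne_zero {n : ℕ} {q : ℂ} (hq : ‖q‖ = 1) (hq2 : q - q⁻¹ ≠ 0)
    {Ψ : PolynomialComponents n} (h : IsGivenByIntegral q Ψ) (z : Fin (2 * n + 1) → ℂ)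
    (hz : ∀ i j, z i ≠ (q ^ 2)⁻¹ * z j) : psiVector Ψ z ≠ 0 := by
  have hq0 : q ≠ 0 := norm_pos_iff.1 (hq ▸ one_pos)
  have hb : ∀ u ∈ List.ofFn z, ∀ v ∈ List.ofFn z, bracket q u v ≠ 0 := by
    intro u hu v hv
    obtain ⟨i, rfl⟩ := List.mem_ofFn.1 hu
    obtain ⟨j, rfl⟩ := List.mem_ofFn.1 hv
    exact (bracket_ne_zero_iff hq0 _ _).2 (hz i j)
  let μ : Fin (2 * n + 1) → Fin 2 := fun i => if (i : ℕ) < n then 1 else 0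
  have hμ : List.ofFn μ = List.replicate n 1 ++ List.replicate (n + 1) 0 := by
    refine List.ext_getElem (by simp; omega) fun k h1 h2 => ?_
    rw [List.getElem_ofFn, List.getElem_append]
    simp [μ]
  obtain ⟨p₁, h₁⟩ := exists_eval_eq_prod ((List.finRange (2 * n + 1)).take n)
  obtain ⟨p₂, h₂⟩ := exists_eval_eq_bracketProd q ((List.finRange (2 * n + 1)).take n)
  obtain ⟨p₃, h₃⟩ := exists_eval_eq_bracketProd q ((List.finRange (2 * n + 1)).drop n)
  have key : psiVector Ψ z μ = MvPolynomial.eval z (p₁ * p₂ * p₃) := by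
    refine eq_of_eq_on_isGeneric hq hq2 z (f := fun w => psiVector Ψ w μ)
      (g := fun w => MvPolynomial.eval w (p₁ * p₂ * p₃))
      ((continuous_apply μ).comp (continuous_psiVector Ψ)).continuousAt
      (MvPolynomial.continuous_eval _).continuousAt (Filter.Eventually.of_forall fun w hw => ?_)
    rw [h.psiVector_apply hq0 hw, chainComponent_chainSites_sorted q n _ μ hμ w hw, if_pos rfl,
      map_mul, map_mul, h₁, h₂, h₃, List.map_take, List.map_drop, ← List.ofFn_eq_map]
  intro h0
  have h0' := congrFun h0 μ
  rw [key, map_mul, map_mul, h₁, h₂, h₃, List.map_take, List.map_drop, ← List.ofFn_eq_map] at h0'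
  refine mul_ne_zero (mul_ne_zero (List.prod_ne_zero fun h => ?_) (bracketProd_ne_zero _ ?_))
    (bracketProd_ne_zero _ ?_) h0'
  · exact hb 0 (List.mem_of_mem_take h) 0 (List.mem_of_mem_take h) (by simp [bracket])
  · exact fun u hu v hv => hb u (List.mem_of_mem_take hu) v (List.mem_of_mem_take hv)
  · exact fun u hu v hv => hb u (List.mem_of_mem_drop hu) v (List.mem_of_mem_drop hv)

/-! ### The homogeneous limit and the XXZ Hamiltonian -/

theorem siteOp_mulVec {m : ℕ} (A : Matrix (Fin 2) (Fin 2) ℂ) (i : Fin m)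
    (v : (Fin m → Fin 2) → ℂ) (μ : Fin m → Fin 2) :
    (siteOp A i).mulVec v μ = ∑ β, A (μ i) β * v (Function.update μ i β) := by
  symm
  refine Finset.sum_of_injOn (fun β => Function.update μ i β)
    (Function.update_injective μ i).injOn (by simp) ?_ ?_
  · intro ν _ hν
    suffices h : siteOp A i μ ν = 0 from mul_eq_zero_of_left h _
    refine if_neg fun h => ?_
    refine hν ⟨ν i, by simp, funext fun l => ?_⟩
    by_cases hl : l = i
    · subst hl; simp
    · simp [hl, h l hl]
  · intro β _
    have h : siteOp A i μ (Function.update μ i β) = A (μ i) (Function.update μ i β i) :=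
      if_pos fun l hl => by rw [Function.update_of_ne hl]
    rw [Function.update_self] at h
    exact congrArg (· * v _) h.symm

/-- The operator of a bond of the Hamiltonian `H_XXZ(-1/2)`. -/
noncomputable def bondOp {m : ℕ} (i j : Fin m) : Matrix (Fin m → Fin 2) (Fin m → Fin 2) ℂ :=
  siteOp pauliX i * siteOp pauliX j + siteOp pauliY i * siteOp pauliY j
    + (-1 / 2 : ℂ) • (siteOp pauliZ i * siteOp pauliZ j)

/-- Needed for N = 1, where the periodic bond joins the site to itself: each Pauli matrix squares to
1 and 1 + 1 - 1/2 = 3/2. -/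
theorem bondOp_self_mulVec {m : ℕ} (i : Fin m) (v : (Fin m → Fin 2) → ℂ) :
    (bondOp i i).mulVec v = (3 / 2 : ℂ) • v := by
  funext μ
  have e : Function.update μ i (μ i) = μ := Function.update_eq_self i μ
  simp only [bondOp, Matrix.add_mulVec, Matrix.smul_mulVec, ← Matrix.mulVec_mulVec, Pi.add_apply,
    Pi.smul_apply, siteOp_mulVec, Fin.sum_univ_two, Function.update_self, Function.update_idem,
    smul_eq_mul]
  obtain h | h : μ i = 0 ∨ μ i = 1 := by omega
  all_goals
    rw [h] at e ⊢
    simp [pauliX, pauliY, pauliZ, e]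
    ring_nf
    try simp
    try ring

theorem update_update_eq_comp_swap {m : ℕ} {i j : Fin m} (μ : Fin m → Fin 2) :
    Function.update (Function.update μ i (μ j)) j (μ i) = μ ∘ Equiv.swap i j := by
  funext k
  by_cases hj : k = j
  · subst hj; simp
  · by_cases hi : k = i
    · subst hi; simp [hj]
    · simp [hi, hj, Equiv.swap_apply_of_ne_of_ne hi hj]

theorem bondOp_mulVec {m : ℕ} {i j : Fin m} (hij : i ≠ j) (v : (Fin m → Fin 2) → ℂ)
    (μ : Fin m → Fin 2) :
    (bondOp i j).mulVec v μ = if μ i = μ j then -(1 / 2) * v μ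
      else 2 * v (μ ∘ Equiv.swap i j) + 1 / 2 * v μ := by
  have e : Function.update (Function.update μ i (μ i)) j (μ j) = μ := by simp
  have e' := update_update_eq_comp_swap (i := i) (j := j) μ
  simp only [bondOp, Matrix.add_mulVec, Matrix.smul_mulVec, ← Matrix.mulVec_mulVec, Pi.add_apply,
    Pi.smul_apply, siteOp_mulVec, Fin.sum_univ_two, Function.update_of_ne hij.symm,
    smul_eq_mul]
  obtain hi | hi : μ i = 0 ∨ μ i = 1 := by omega
  all_goals
    obtain hj | hj : μ j = 0 ∨ μ j = 1 := by omega
    all_goals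
      rw [hi, hj] at e e' ⊢
      simp [pauliX, pauliY, pauliZ, e, e']
      try ring_nf
      try simp
      try ring

theorem hamiltonianXXZ_eq (N : ℕ) [NeZero N] :
    hamiltonianXXZ N (-1 / 2) = -(1 / 2 : ℂ) • ∑ i : Fin N, bondOp i (i + 1) := rfl

/-- The derivative at `z_1 = ⋯ = z_N = 1` of the exchange relation of the sites `i` and `j`. -/
theorem bond_identity_of_exchange {N : ℕ} {q : ℂ} (hq : q ≠ 0) (hs : 1 + q + q ^ 2 = 0)
    {i j : Fin N} (hij : i ≠ j) (P : (Fin N → Fin 2) → MvPolynomial (Fin N) ℂ)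
    (hsame : ∀ μ, μ i = μ j →
      (MvPolynomial.C q * MvPolynomial.X j - MvPolynomial.C q⁻¹ * MvPolynomial.X i) * P μ =
      (MvPolynomial.C q * MvPolynomial.X i - MvPolynomial.C q⁻¹ * MvPolynomial.X j) *
        MvPolynomial.rename (Equiv.swap i j) (P (μ ∘ Equiv.swap i j)))
    (hne : ∀ μ, μ i ≠ μ j → (MvPolynomial.X j - MvPolynomial.X i) * P μ +
      MvPolynomial.C (q - q⁻¹) * MvPolynomial.X (if μ i = 0 then j else i) *
        P (μ ∘ Equiv.swap i j) =
      (MvPolynomial.C q * MvPolynomial.X i - MvPolynomial.C q⁻¹ * MvPolynomial.X j) *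
        MvPolynomial.rename (Equiv.swap i j) (P (μ ∘ Equiv.swap i j))) (μ : Fin N → Fin 2) :
    (q - q⁻¹) * (MvPolynomial.eval 1 (MvPolynomial.pderiv i (P μ)) -
      MvPolynomial.eval 1 (MvPolynomial.pderiv j (P μ))) =
    (if μ i = μ j then -MvPolynomial.eval 1 (P μ)
      else MvPolynomial.eval 1 (P (μ ∘ Equiv.swap i j)) - 1 / 2 * MvPolynomial.eval 1 (P μ)) +
      (q - q⁻¹) / 2 * (((μ i : ℕ) : ℂ) - ((μ j : ℕ) : ℂ)) * MvPolynomial.eval 1 (P μ) := by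
  have hinv : q⁻¹ = -1 - q := by
    field_simp
    linear_combination hs
  have hr : ∀ p : MvPolynomial (Fin N) ℂ,
      MvPolynomial.pderiv j (MvPolynomial.rename (Equiv.swap i j) p) =
        MvPolynomial.rename (Equiv.swap i j) (MvPolynomial.pderiv i p) := by
    intro p
    have := MvPolynomial.pderiv_rename (R := ℂ) (Equiv.swap i j).injective i p
    rwa [Equiv.swap_apply_left] at this
  have h1 : ∀ p : MvPolynomial (Fin N) ℂ,
      MvPolynomial.eval 1 (MvPolynomial.rename (Equiv.swap i j) p) = MvPolynomial.eval 1 p := by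
    intro p
    rw [MvPolynomial.eval_rename]
    rfl
  by_cases h : μ i = μ j
  · have e : μ ∘ Equiv.swap i j = μ := by
      funext k
      by_cases hi : k = i
      · subst hi; simp [h]
      · by_cases hj : k = j
        · subst hj; simp [h]
        · simp [Equiv.swap_apply_of_ne_of_ne hi hj]
    have hd := congrArg (fun p => MvPolynomial.eval 1 (MvPolynomial.pderiv j p)) (hsame μ h)
    simp only [MvPolynomial.pderiv_mul, map_sub, MvPolynomial.pderiv_C, MvPolynomial.pderiv_X_self,
      MvPolynomial.pderiv_X_of_ne hij, hr, h1, map_add, map_mul, MvPolynomial.eval_C,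
      MvPolynomial.eval_X, Pi.one_apply, map_one, map_zero, e] at hd
    rw [if_pos h, h]
    rw [hinv] at hd ⊢
    linear_combination -hd
  · set ν := μ ∘ Equiv.swap i j with hν
    have e : ν ∘ Equiv.swap i j = μ := by
      funext k; simp [hν]
    have hνi : ν i = μ j := by simp [hν]
    have hνj : ν j = μ i := by simp [hν]
    -- The relation is taken at the swapped configuration, so that its right-hand side contains `P
    -- μ` with z_i and z_j interchanged; ∂_j of that gives ∂_i of `P μ` at 1, while [z_i,z_j] gives
    -- the value at 1. On the left the factor z_j - z_i vanishes at 1, and only its derivative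
    -- contributes.
    have hd := congrArg (fun p => MvPolynomial.eval 1 (MvPolynomial.pderiv j p))
      (hne ν (by rw [hνi, hνj]; exact fun h' => h h'.symm))
    rw [e] at hd
    rw [if_neg h]
    obtain hi | hi : μ i = 0 ∨ μ i = 1 := by omega
    · have hj : μ j = 1 := by omega
      rw [hνi, hj, if_neg one_ne_zero] at hd
      simp only [MvPolynomial.pderiv_mul, map_sub, MvPolynomial.pderiv_C,
        MvPolynomial.pderiv_X_self, MvPolynomial.pderiv_X_of_ne hij, hr, h1, map_add, map_mul,
        MvPolynomial.eval_C, MvPolynomial.eval_X, Pi.one_apply, map_one, map_zero] at hd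
      rw [hi, hj]
      rw [hinv] at hd ⊢
      simp only [Fin.val_zero, Fin.val_one, Nat.cast_zero, Nat.cast_one]
      linear_combination -hd
    · have hj : μ j = 0 := by omega
      rw [hνi, hj, if_pos rfl] at hd
      simp only [MvPolynomial.pderiv_mul, map_sub, MvPolynomial.pderiv_C,
        MvPolynomial.pderiv_X_self, MvPolynomial.pderiv_X_of_ne hij, hr, h1, map_add, map_mul,
        MvPolynomial.eval_C, MvPolynomial.eval_X, Pi.one_apply, map_one, map_zero] at hd
      rw [hi, hj]
      rw [hinv] at hd ⊢
      simp only [Fin.val_zero, Fin.val_one, Nat.cast_zero, Nat.cast_one]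
      linear_combination -hd

/-- Cyclic invariance of the solution. -/
theorem chainComponent_chainSites_rotate {N : ℕ} {q : ℂ} (h3 : q ^ 3 = 1)
    (μ : Fin (N + 1) → Fin 2) (z : Fin (N + 1) → ℂ) (hz : IsGeneric q (List.ofFn z)) :
    chainComponent q (chainSites (μ ∘ Equiv.addRight 1) (z ∘ Equiv.addRight 1)) =
      chainComponent q (chainSites μ z) := by
  have e1 : chainSites μ z =
      (μ 0, z 0) :: List.ofFn fun i : Fin N => (μ i.succ, z i.succ) := by
    rw [chainSites, List.ofFn_succ]
  have e2 : chainSites (μ ∘ Equiv.addRight 1) (z ∘ Equiv.addRight 1) =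
      (List.ofFn fun i : Fin N => (μ i.succ, z i.succ)) ++ [(μ 0, z 0)] := by
    rw [chainSites, List.ofFn_succ', List.concat_eq_append]
    simp [Fin.coeSucc_eq_succ]
  rw [e2, e1]
  refine (chainComponent_rotate q h3 _ _ ?_).symm
  rwa [← e1, map_snd_chainSites]

/-- Proved for the bond of the first two sites and carried to all others by cyclic invariance. This
also reaches the bond joining the last site to the first, which is not a neighbouring pair in the
list. -/
theorem bond_identity {N : ℕ} [NeZero N] (hN : 1 < N) {q : ℂ} (hq : ‖q‖ = 1) (hq2 : q - q⁻¹ ≠ 0)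
    (h3 : q ^ 3 = 1) (hs : 1 + q + q ^ 2 = 0) (P : (Fin N → Fin 2) → MvPolynomial (Fin N) ℂ)
    (hP : ∀ μ z, IsGeneric q (List.ofFn z) →
      MvPolynomial.eval z (P μ) = chainComponent q (chainSites μ z))
    (i : Fin N) (μ : Fin N → Fin 2) :
    (q - q⁻¹) * (MvPolynomial.eval 1 (MvPolynomial.pderiv i (P μ)) -
      MvPolynomial.eval 1 (MvPolynomial.pderiv (i + 1) (P μ))) =
    (if μ i = μ (i + 1) then -MvPolynomial.eval 1 (P μ) else
      MvPolynomial.eval 1 (P (μ ∘ Equiv.swap i (i + 1))) - 1 / 2 * MvPolynomial.eval 1 (P μ)) +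
      (q - q⁻¹) / 2 * (((μ i : ℕ) : ℂ) - ((μ (i + 1) : ℕ) : ℂ)) * MvPolynomial.eval 1 (P μ) := by
  have hq0 : q ≠ 0 := norm_pos_iff.1 (hq ▸ one_pos)
  obtain ⟨N, rfl⟩ : ∃ k, N = k + 1 := ⟨N - 1, by omega⟩
  have hrot : ∀ μ, P μ = MvPolynomial.rename (Equiv.addRight 1) (P (μ ∘ Equiv.addRight 1)) := by
    intro μ
    refine MvPolynomial.eq_of_eval_eq_on_isGeneric hq hq2 _ _ fun z hz => ?_
    rw [MvPolynomial.eval_rename, hP μ z hz, hP _ _ (hz.comp_equiv _),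
      chainComponent_chainSites_rotate h3 μ z hz]
  have hV : ∀ μ, MvPolynomial.eval 1 (P (μ ∘ Equiv.addRight 1)) = MvPolynomial.eval 1 (P μ) := by
    intro μ
    rw [hrot μ, MvPolynomial.eval_rename]
    rfl
  have hD : ∀ μ i, MvPolynomial.eval 1 (MvPolynomial.pderiv (i + 1) (P μ)) =
      MvPolynomial.eval 1 (MvPolynomial.pderiv i (P (μ ∘ Equiv.addRight 1))) := by
    intro μ i
    have := MvPolynomial.pderiv_rename (R := ℂ) (Equiv.addRight (1 : Fin (N + 1))).injective i
      (P (μ ∘ Equiv.addRight 1))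
    rw [← hrot, Equiv.coe_addRight] at this
    rw [this, MvPolynomial.eval_rename]
    rfl
  suffices h : ∀ (m : ℕ) (i : Fin (N + 1)), (i : ℕ) = m → ∀ μ : Fin (N + 1) → Fin 2,
      (q - q⁻¹) * (MvPolynomial.eval 1 (MvPolynomial.pderiv i (P μ)) -
        MvPolynomial.eval 1 (MvPolynomial.pderiv (i + 1) (P μ))) =
      (if μ i = μ (i + 1) then -MvPolynomial.eval 1 (P μ) else
        MvPolynomial.eval 1 (P (μ ∘ Equiv.swap i (i + 1))) - 1 / 2 * MvPolynomial.eval 1 (P μ)) +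
        (q - q⁻¹) / 2 * (((μ i : ℕ) : ℂ) - ((μ (i + 1) : ℕ) : ℂ)) * MvPolynomial.eval 1 (P μ) from
    h i i rfl μ
  intro m
  induction m with
  | zero =>
    rintro i hi μ
    obtain rfl : i = 0 := Fin.ext hi
    have h01 : ((0 : Fin (N + 1)) : ℕ) + 1 = (0 + 1 : Fin (N + 1)) := by
      rw [Fin.val_zero, zero_add, zero_add, Fin.val_one', Nat.mod_eq_of_lt hN]
    refine bond_identity_of_exchange hq0 hs (fun h => ?_) P (fun ν hν => ?_) (fun ν hν => ?_) μ
    · rw [← h] at h01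
      omega
    · refine MvPolynomial.eq_of_eval_eq_on_isGeneric hq hq2 _ _ fun z hz => ?_
      have hex := chainSites_swap_same q 0 (0 + 1) h01 ν z hν
      rw [← hP _ z hz, ← hP _ _ (hz.comp_equiv _)] at hex
      simpa [MvPolynomial.eval_rename, bracket] using hex
    · refine MvPolynomial.eq_of_eval_eq_on_isGeneric hq hq2 _ _ fun z hz => ?_
      have hz' := ((isGeneric_ofFn q z).1 hz).2
      obtain h0 | h0 : ν 0 = 0 ∨ ν 0 = 1 := by omega
      · have hex := chainSites_exchange_down_up q 0 (0 + 1) h01 ν z h0 (by omega) (hz' _ _)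
        rw [← hP _ z hz, ← hP _ z hz, ← hP _ _ (hz.comp_equiv _)] at hex
        rw [if_pos h0]
        simpa [MvPolynomial.eval_rename, bracket] using hex
      · have hex := chainSites_exchange_up_down q hq0 0 (0 + 1) h01 ν z h0 (by omega) (hz' _ _)
        rw [← hP _ z hz, ← hP _ z hz, ← hP _ _ (hz.comp_equiv _)] at hex
        rw [if_neg (by rw [h0]; exact one_ne_zero)]
        simpa [MvPolynomial.eval_rename, bracket] using hex
  | succ m ih =>
    intro i hi μ
    obtain ⟨k, rfl⟩ : ∃ k, i = k + 1 := ⟨i - 1, by simp⟩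
    have hk : (k : ℕ) = m := by
      rcases eq_or_ne k (Fin.last N) with rfl | hkl
      · simp at hi
      · rw [Fin.val_add_one_of_lt (Fin.lt_last_iff_ne_last.2 hkl)] at hi
        omega
    have := ih k hk (μ ∘ Equiv.addRight 1)
    have hsw : (μ ∘ Equiv.addRight 1) ∘ Equiv.swap k (k + 1) =
        (μ ∘ Equiv.swap (k + 1) (k + 1 + 1)) ∘ Equiv.addRight 1 := by
      funext l
      simp only [Function.comp_apply]
      congr 1
      have := (Equiv.addRight (1 : Fin (N + 1))).injective.swap_apply k (k + 1) l
      simpa using this.symm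
    rw [← hD, ← hD, hsw, hV, hV] at this
    exact this

/-- By `bond_identity` each bond gives 3/2 plus multiples of ∂_i - ∂_(i+1) and μ_i - μ_(i+1). Both
telescope to zero around the ring, so no derivative of Ψ has to be known. -/
theorem sum_bondOp_mulVec {N : ℕ} [NeZero N] (hN : 1 < N) {q : ℂ} (hq : ‖q‖ = 1)
    (hq2 : q - q⁻¹ ≠ 0) (h3 : q ^ 3 = 1) (hs : 1 + q + q ^ 2 = 0)
    (P : (Fin N → Fin 2) → MvPolynomial (Fin N) ℂ)
    (hP : ∀ μ z, IsGeneric q (List.ofFn z) →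
      MvPolynomial.eval z (P μ) = chainComponent q (chainSites μ z)) :
    (∑ i : Fin N, bondOp i (i + 1)).mulVec (fun μ => MvPolynomial.eval 1 (P μ)) =
      (3 * (N : ℂ) / 2) • fun μ => MvPolynomial.eval 1 (P μ) := by
  funext μ
  set V : (Fin N → Fin 2) → ℂ := fun μ => MvPolynomial.eval 1 (P μ) with hV
  have htel : ∀ f : Fin N → ℂ, ∑ i, (f i - f (i + 1)) = 0 := fun f => by
    rw [Finset.sum_sub_distrib, sub_eq_zero]
    exact (Equiv.sum_comp (Equiv.addRight (1 : Fin N)) f).symm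
  have hb : ∀ i : Fin N, (bondOp i (i + 1)).mulVec V μ = 3 / 2 * V μ +
      2 * (q - q⁻¹) * (MvPolynomial.eval 1 (MvPolynomial.pderiv i (P μ)) -
        MvPolynomial.eval 1 (MvPolynomial.pderiv (i + 1) (P μ))) -
      (q - q⁻¹) * V μ * (((μ i : ℕ) : ℂ) - ((μ (i + 1) : ℕ) : ℂ)) := by
    intro i
    have hi : i ≠ i + 1 := fun h => by
      have h' : (1 : Fin N) = 0 := by simpa using h.symm
      have := congrArg Fin.val h'
      rw [Fin.val_one', Nat.mod_eq_of_lt hN, Fin.val_zero] at this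
      exact one_ne_zero this
    rw [bondOp_mulVec hi]
    have := bond_identity hN hq hq2 h3 hs P hP i μ
    split_ifs at this ⊢ <;> linear_combination -2 * this
  rw [Matrix.sum_mulVec, Finset.sum_apply, Finset.sum_congr rfl fun i _ => hb i,
    Finset.sum_sub_distrib, Finset.sum_add_distrib, ← Finset.mul_sum, ← Finset.mul_sum,
    ← Finset.mul_sum,
    htel (fun i => MvPolynomial.eval 1 (MvPolynomial.pderiv i (P μ))),
    htel (fun i => ((μ i : ℕ) : ℂ))]
  simp
  ring

theorem IsGivenByIntegral.hamiltonianXXZ_mulVec_psiVector {n : ℕ} {q : ℂ} (hq : ‖q‖ = 1)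
    (hq2 : q - q⁻¹ ≠ 0) (h3 : q ^ 3 = 1) (hs : 1 + q + q ^ 2 = 0)
    {Ψ : PolynomialComponents n} (h : IsGivenByIntegral q Ψ) :
    (hamiltonianXXZ (2 * n + 1) (-1 / 2)).mulVec (psiVector Ψ fun _ => 1) =
      (-(3 * ((2 * n + 1 : ℕ) : ℂ) / 4)) • psiVector Ψ fun _ => 1 := by
  rw [hamiltonianXXZ_eq, Matrix.smul_mulVec]
  rcases n.eq_zero_or_pos with rfl | hn
  · have e : ∑ i : Fin (2 * 0 + 1), bondOp i (i + 1) = bondOp 0 0 := by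
      rw [Fin.sum_univ_one]
      congr 1
    rw [e, bondOp_self_mulVec, smul_smul]
    congr 1
    norm_num
  · choose P hP using exists_eval_eq_chainComponent (N := 2 * n + 1) q
    have e : (psiVector Ψ fun _ => 1) = fun μ => MvPolynomial.eval 1 (P μ) := by
      funext μ
      refine eq_of_eq_on_isGeneric hq hq2 (fun _ => 1) (f := fun w => psiVector Ψ w μ)
        (g := fun w => MvPolynomial.eval w (P μ))
        ((continuous_apply μ).comp (continuous_psiVector Ψ)).continuousAt
        (MvPolynomial.continuous_eval _).continuousAt (Filter.Eventually.of_forall fun w hw => ?_)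
      rw [h.psiVector_apply (norm_pos_iff.1 (hq ▸ one_pos)) hw, hP μ w hw]
    rw [e, sum_bondOp_mulVec (by omega) hq hq2 h3 hs P hP, smul_smul]
    congr 1
    ring

/-! ### The cube roots of unity and the conclusion -/

theorem exp_mul_two_pi_I_div_three {q : ℂ}
    (hq : q = Complex.exp (2 * (Real.pi : ℂ) * Complex.I / 3) ∨
      q = Complex.exp (-(2 * (Real.pi : ℂ) * Complex.I / 3))) :
    ‖q‖ = 1 ∧ q ^ 3 = 1 ∧ 1 + q + q ^ 2 = 0 := by
  have hp := Complex.isPrimitiveRoot_exp 3 (by norm_num)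
  have h : IsPrimitiveRoot q 3 := by
    rcases hq with rfl | rfl
    · exact_mod_cast hp
    · rw [Complex.exp_neg]
      exact_mod_cast hp.inv
  refine ⟨h.norm'_eq_one (by norm_num), h.pow_eq_one, ?_⟩
  have := h.geom_sum_eq_zero (by norm_num)
  simpa [Finset.sum_range_succ] using this

theorem sub_inv_ne_zero_of_sum_eq_zero {q : ℂ} (h3 : q ^ 3 = 1) (hs : 1 + q + q ^ 2 = 0) :
    q - q⁻¹ ≠ 0 := by
  have hq0 : q ≠ 0 := by
    rintro rfl
    norm_num at h3
  intro h
  have h2 : q ^ 2 = 1 := by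
    field_simp at h
    linear_combination h
  have hq : q = -2 := by linear_combination hs - h2
  rw [hq] at h2
  norm_num at h2

theorem mainTheorem4 (n : ℕ) (q : ℂ)
    (hq : q = Complex.exp (2 * (Real.pi : ℂ) * Complex.I / 3) ∨
      q = Complex.exp (-(2 * (Real.pi : ℂ) * Complex.I / 3))) :
    (∃! Ψ : PolynomialComponents n, IsGivenByIntegral q Ψ) ∧
    ∀ Ψ : PolynomialComponents n, IsGivenByIntegral q Ψ →
      (∀ z : Fin (2 * n + 1) → ℂ, (∀ i, z i ≠ 0) →
        ∀ x : ℂ, (∀ i, q - q⁻¹ * (x / z i) ≠ 0) →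
          (transferMatrix q x z).mulVec (psiVector Ψ z) = psiVector Ψ z) ∧
      (∀ z : Fin (2 * n + 1) → ℂ, (∀ i j, z i ≠ (q ^ 2)⁻¹ * z j) →
        ∀ x : ℂ, (∀ i, q - q⁻¹ * (x / z i) ≠ 0) →
          Module.End.HasEigenvector (Matrix.toLin' (transferMatrix q x z)) 1 (psiVector Ψ z)) ∧
      Module.End.HasEigenvector (Matrix.toLin' (hamiltonianXXZ (2 * n + 1) (-1 / 2)))
        (-(3 * ((2 * n + 1 : ℕ) : ℂ) / 4)) (psiVector Ψ (fun _ => 1)) := by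
  obtain ⟨hn, h3, hs⟩ := exp_mul_two_pi_I_div_three hq
  have hq2 := sub_inv_ne_zero_of_sum_eq_zero h3 hs
  refine ⟨existsUnique_isGivenByIntegral hn hq2, fun Ψ h => ⟨?_, fun z hz x hx => ?_, ?_⟩⟩
  · exact h.transferMatrix_mulVec_psiVector hn hq2 h3 hs
  · refine ⟨Module.End.mem_eigenspace_iff.2 ?_, h.psiVector_ne_zero hn hq2 z hz⟩
    -- The case i = j of the hypothesis already excludes z_i = 0.
    have hz0 : ∀ i, z i ≠ 0 := fun i hi => hz i i (by rw [hi, mul_zero])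
    rw [Matrix.toLin'_apply, one_smul]
    exact h.transferMatrix_mulVec_psiVector hn hq2 h3 hs z hz0 x hx
  · refine ⟨Module.End.mem_eigenspace_iff.2 ?_, h.psiVector_ne_zero hn hq2 _ fun _ _ e => hq2 ?_⟩
    · rw [Matrix.toLin'_apply]
      exact h.hamiltonianXXZ_mulVec_psiVector hn hq2 h3 hs
    · have hq0 : q ≠ 0 := norm_pos_iff.1 (hn ▸ one_pos)
      field_simp at e ⊢
      linear_combination e
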